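/- **Theorem 2.1 (Global regularity).** Let $\Gamma$ be a subgroup of finite index of $\mathrm{SL}_2(\mathbb{Z})$, let $r>0$ be real, and let $f\neq 0$ be a modular form of weight $r$ for $\Gamma$ with unimodular multipliers $\mu_\gamma$; that is, $f$ is holomorphic on the upper half-plane $\mathbb{H}$, $f(\gamma z)=\mu_\gamma(cz+d)^r f(z)$ for every $\gamma=\begin{pmatrix}a&b\\c&d\end{pmatrix}\in\Gamma$ (with $|\mu_\gamma|=1$ and the branch $-\pi<\arg\le\pi$), and $f$ has at most polynomial growth as $\operatorname{Im} z\to0^+$. For a cusp $\mathfrak a=\gamma(\infty)$, $\gamma\in\mathrm{SL}_2(\mathbb{Z})$, put $f|_\gamma(z)=f(\gamma z)/(cz+d)^{r}$, let $m_{\mathfrak a}$ be the width of $\mathfrak a$ (the least $m\ge1$ with $\pm\gamma\begin{pmatrix}1&m\\0&1\end{pmatrix}\gamma^{-1}\in\Gamma$ for some choice of sign), let $\kappa_{\mathfrak a}\in[0,1)$ be the number with $f|_\gamma(z+m_{\mathfrak a})=e^{2\pi i\kappa_{\mathfrak a}}f|_\gamma(z)$, and let $a_n^{\mathfrak a}$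 be the coefficients of the Fourier expansion $f|_\gamma(m_{\mathfrak a}z)=\sum_{n\ge0}a_n^{\mathfrak a}e^{2\pi i(n+\kappa_{\mathfrak a})z}$. Assume $\kappa_{\mathfrak a}\in\mathbb{Q}$ for every cusp $\mathfrak a$. The form $f$ is a cusp form if at every cusp $\kappa_{\mathfrak a}>0$ or $a_0^{\mathfrak a}=0$. Put $\alpha_0=r/2$ if $f$ is a cusp form and $\alpha_0=r$ otherwise. Write $m,\kappa,a_n$ for the data at $\infty$ (with $\gamma$ the identity) and, for $\alpha>0$, consider the series $$f_\alpha(mx)=\sum_{n+\kappa>0}\frac{a_n}{(n+\kappa)^\alpha}e^{2\pi i(n+\kappa)x}\qquad(x\in\mathbb{R}).\tag{1}$$ For an integer $k\ge0$, $0\le s\le1$ and an open set $\Omega\subset\mathbb{R}$, let $\mathcal C^{k,s}(\Omega)$ be the set of continuous functions $g$ on $\Omega$ such that $g^{(k)}$ exists in $\Omega$ and, on every compact $K\subset\Omega$, is continuous and satisfies $|g^{(k)}(x)-g^{(k)}(y)|\le C_K|x-y|^s$. The class $\mathcal C^{k,s}_{\log}(\Omega)$ is defined in the same way with the bound $C_K|x-y|^s\,\bigl|\log|x-y|\bigr|$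 for $x,y\in K$, $0<|x-y|\le\frac12$. Let $[t]$ and $\{t\}$ be the integer and fractional parts of $t$. Let $\alpha>0$. Then: 1. If $\alpha\le\alpha_0$, the series (1) defining $f_\alpha$ diverges (its partial sums have no limit in $\mathbb{C}$) on a dense set of real points. 2. If $\alpha>\alpha_0$, the series (1) converges uniformly on $\mathbb{R}$ to a continuous function $f_\alpha$. Moreover $f_\alpha\in\mathcal C^{[\alpha-\alpha_0],\{\alpha-\alpha_0\}}(\mathbb{R})$ if $\alpha-\alpha_0\notin\mathbb{Z}$, and $f_\alpha\in\mathcal C^{\alpha-\alpha_0-1,\,1}_{\log}(\mathbb{R})$ if $\alpha-\alpha_0\in\mathbb{Z}$. 3. If $0<\alpha-\alpha_0\le1$, then $f_\alpha\notin\mathcal C^{1,0}(I)$ for every nonempty open interval $I$, and the same is true of $\operatorname{Re}f_\alpha$ and $\operatorname{Im}f_\alpha$. -/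

import Mathlib

open UpperHalfPlane Filter Topology MatrixGroups Manifold

noncomputable section

namespace FracInt

/-! ### Modular forms of real weight with a multiplier system -/

/-- `f` is a modular form of real weight `r` for the subgroup `Γ` of `SL(2, ℤ)` with (unimodular)
multipliers `μ`: it is holomorphic on the upper half-plane, satisfies
`f (γ z) = μ_γ (c z + d) ^ r f z` (principal branch, `-π < arg ≤ π`) for all `γ ∈ Γ`, and has at
most polynomial growth as `Im z → 0⁺`. -/
structure IsModularForm (Γ : Subgroup SL(2, ℤ)) (r : ℝ) (μ : Γ → Circle) (f : ℍ → ℂ) : Prop where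
  holo : MDifferentiable 𝓘(ℂ) 𝓘(ℂ) f
  transform : ∀ (γ : Γ) (z : ℍ),
    f ((γ : SL(2, ℤ)) • z) =
      (μ γ : ℂ) * (((γ : SL(2, ℤ)) 1 0 : ℂ) * (z : ℂ) + ((γ : SL(2, ℤ)) 1 1 : ℂ)) ^ (r : ℂ) * f z
  growth : ∃ C A δ : ℝ, 0 < δ ∧ ∀ z : ℍ, z.im < δ → ‖f z‖ ≤ C * z.im ^ (-A)

/-- The slash operator of weight `r`: `f|_γ (z) = f (γ z) / (c z + d) ^ r`. -/
def slash (r : ℝ) (f : ℍ → ℂ) (γ : SL(2, ℤ)) (z : ℍ) : ℂ :=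
  f (γ • z) / ((γ 1 0 : ℂ) * (z : ℂ) + (γ 1 1 : ℂ)) ^ (r : ℂ)

/-- The width of the cusp `γ(∞)` for `Γ`: the index of the stabilizer of that cusp in `Γ` in its
stabilizer in `SL(2, ℤ)`, both modulo `±1`. The latter stabilizer is `{±γ T ^ n γ⁻¹}`, so this is
the smallest `m ≥ 1` such that `γ T ^ m γ⁻¹` or its negative lies in `Γ`. -/
def width (Γ : Subgroup SL(2, ℤ)) (γ : SL(2, ℤ)) : ℕ :=
  sInf {m : ℕ | 0 < m ∧
    (γ * ModularGroup.T ^ m * γ⁻¹ ∈ Γ ∨ -(γ * ModularGroup.T ^ m * γ⁻¹) ∈ Γ)}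

/-- The cusp parameter of `g` with respect to the translation by `m`: the number `κ ∈ [0, 1)` with
`g (z + m) = e^{2πiκ} g z` for all `z` (it is unique when `g ≠ 0`). -/
def cuspParam (g : ℍ → ℂ) (m : ℕ) : ℝ :=
  sInf {κ : ℝ | 0 ≤ κ ∧ κ < 1 ∧
    ∀ z : ℍ, g ((m : ℝ) +ᵥ z) = Complex.exp (2 * Real.pi * Complex.I * κ) * g z}

/-- The `n`-th Fourier coefficient `a_n` in the expansion
`g (m z) = ∑_{n ≥ 0} a_n e^{2πi(n + κ)z}`, computed on the horizontal line `Im (m z) = 1`. -/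
def cuspCoeff (g : ℍ → ℂ) (m : ℕ) (κ : ℝ) (n : ℕ) : ℂ :=
  (1 / (m : ℂ)) * ∫ x in (0 : ℝ)..(m : ℝ),
    g (x +ᵥ UpperHalfPlane.I) *
      Complex.exp (-(2 * Real.pi * Complex.I * (n + κ) * ((x + Complex.I) / m)))

/-- `f` is cuspidal at the cusp `γ(∞)`: either the cusp parameter is positive or the coefficient
`a_0` of the Fourier expansion at that cusp is zero. (Passing to a scaling matrix multiplies the
coefficients by the nonzero constant `m ^ (r / 2)`, which is irrelevant here.) -/
def IsCuspidalAt (Γ : Subgroup SL(2, ℤ)) (r : ℝ) (f : ℍ → ℂ) (γ : SL(2, ℤ)) : Prop :=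
  0 < cuspParam (slash r f γ) (width Γ γ) ∨
    cuspCoeff (slash r f γ) (width Γ γ) (cuspParam (slash r f γ) (width Γ γ)) 0 = 0

/-- `f` is a cusp form: it is cuspidal at every cusp. Every element of `ℚ ∪ {∞}` is of the form
`γ(∞)` with `γ ∈ SL(2, ℤ)`. -/
def IsCuspForm (Γ : Subgroup SL(2, ℤ)) (r : ℝ) (f : ℍ → ℂ) : Prop :=
  ∀ γ : SL(2, ℤ), IsCuspidalAt Γ r f γ

open Classical in
/-- The critical exponent `α₀`: it is `r / 2` for cusp forms and `r` otherwise. -/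
def alphaZero (Γ : Subgroup SL(2, ℤ)) (r : ℝ) (f : ℍ → ℂ) : ℝ :=
  if IsCuspForm Γ r f then r / 2 else r

/-! ### The fractional integral -/

/-- The `n`-th term, at the point `x`, of the series defining the `α`-fractional integral
`f_α (m x) = ∑_{n + κ > 0} a_n / (n + κ) ^ α * e^{2πi(n + κ)x}`, where `m`, `κ` and `a_n` are the
width, the parameter and the Fourier coefficients of `f` at the cusp `∞`. -/
def fracTerm (Γ : Subgroup SL(2, ℤ)) (f : ℍ → ℂ) (α : ℝ) (n : ℕ) (x : ℝ) : ℂ :=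
  let m : ℕ := width Γ 1
  let κ : ℝ := cuspParam f m
  if 0 < (n : ℝ) + κ then
    cuspCoeff f m κ n / ((((n : ℝ) + κ) ^ α : ℝ) : ℂ) *
      Complex.exp (2 * Real.pi * Complex.I * (n + κ) * (x / m))
  else 0

/-- Partial sums of the series defining `f_α`. -/
def fracSum (Γ : Subgroup SL(2, ℤ)) (f : ℍ → ℂ) (α : ℝ) (N : ℕ) (x : ℝ) : ℂ :=
  ∑ n ∈ Finset.range N, fracTerm Γ f α n x

/-- The `α`-fractional integral `f_α`, the pointwise limit of the partial sums of its series. -/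
def fracInt (Γ : Subgroup SL(2, ℤ)) (f : ℍ → ℂ) (α : ℝ) (x : ℝ) : ℂ :=
  limUnder atTop fun N : ℕ => fracSum Γ f α N x

/-! ### Regularity classes -/

variable {E : Type*} [NormedAddCommGroup E] [NormedSpace ℝ E]

/-- The class `Λ^s(K)`: continuous functions with a uniform `s`-Hölder condition on `K`. -/
def MemHolder (s : ℝ) (g : ℝ → E) (K : Set ℝ) : Prop :=
  ContinuousOn g K ∧ ∃ C : ℝ, ∀ x ∈ K, ∀ y ∈ K, ‖g x - g y‖ ≤ C * |x - y| ^ s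

/-- The class `Λ^s_log(K)`: the modulus `|x - y| ^ s` is replaced by `|x - y| ^ s log |x - y|`.
The bound concerns small `|x - y|`, since the logarithm vanishes at `|x - y| = 1`. -/
def MemHolderLog (s : ℝ) (g : ℝ → E) (K : Set ℝ) : Prop :=
  ContinuousOn g K ∧ ∃ C : ℝ, ∀ x ∈ K, ∀ y ∈ K, |x - y| ≤ 1 / 2 →
    ‖g x - g y‖ ≤ C * (|x - y| ^ s * |(Real.log |x - y|)|)

/-- The `k`-th derivative of `g` exists at every point of the open set `Ω`. -/
def HasDerivsOn (k : ℕ) (g : ℝ → E) (Ω : Set ℝ) : Prop :=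
  ∀ j < k, ∀ x ∈ Ω, DifferentiableAt ℝ (iteratedDeriv j g) x

/-- The class `C^{k,s}(Ω)` for an open set `Ω`: continuous functions whose `k`-th derivative exists
in `Ω` and belongs to `Λ^s(K)` for every compact `K ⊆ Ω`. -/
def MemCk (k : ℕ) (s : ℝ) (g : ℝ → E) (Ω : Set ℝ) : Prop :=
  ContinuousOn g Ω ∧ HasDerivsOn k g Ω ∧
    ∀ K ⊆ Ω, IsCompact K → MemHolder s (iteratedDeriv k g) K

/-- The class `C^{k,s}_log(Ω)` for an open set `Ω`. -/
def MemCkLog (k : ℕ) (s : ℝ) (g : ℝ → E) (Ω : Set ℝ) : Prop :=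
  ContinuousOn g Ω ∧ HasDerivsOn k g Ω ∧
    ∀ K ⊆ Ω, IsCompact K → MemHolderLog s (iteratedDeriv k g) K

end FracInt

end

/-! Write a = α₀ and let H be f minus its constant term at ∞. The arithmetic of f enters through two
facts only. Growth: |f(z)|(Im z)^(r/2) is Γ-invariant, so finitely many cosets and the Fourier
expansions at the cusps give |H(z)| ≤ C (Im z)^(-a) (`isFourierExpansion`). Sharpness: y^a |f(x+iy)|
fails to tend to 0 for a dense set of real x (`dense_not_tendsto`). For cusp forms this is Baire's
theorem together with the fact that a Γ-orbit accumulates at every rational. Otherwise the cusps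
equivalent to one with nonzero constant term are dense, and y^r |f| has a nonzero limit on the
vertical line above each of them that is a rational number.

The rest is analysis of H. By Euler's integral, f_α(x) equals (2π/m)^α/Γ(α) times the integral of
t^(α-1) H(x+it) over t > 0, which converges for α > a. At height y the Fourier tail of H beyond N is
at most a constant times e^(-πNy/m)(y^(-a) + y^(-a-ε)) (`norm_tail_le`), and integrating this gives
uniform convergence of the series. Cutting the integral at t = |x-x'|, with the bound on H below the
cut and Cauchy's bound on H' above it, yields the Hölder exponent α-a, with a logarithm when α-a =
1. Each differentiation lowers α by one.

Both negative results show that good behaviour at x would force y^a |H(x+iy)| → 0, against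
sharpness. Up to a constant, y^α H(x+iy) is the series of f_α(x) weighted by φ(2π(n+κ)y/m), where
φ(t) = t^α e^(-t). As φ(0) = 0 and φ has bounded variation, convergence of the series makes this
tend to 0 (`tendsto_weighted_sum_zero`). For differentiability, φ extended by zero has Fourier
transform K, a multiple of (1+2πiw)^(-α-1). Integrating f_α(x+2πyw) against K(w) recovers y^α
H(x+iy), while the conjugate of f_α, having only negative frequencies, integrates to 0. So real and
imaginary parts are detected as well as f_α itself. If such a combination is differentiable at x,
removing its first-order part leaves a contribution o(y^(α-a)) because α-a ≤ 1
(`tendsto_of_differentiableAt`). -/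

namespace FracInt

/-! ### Fourier expansions on the upper half-plane -/

/-- The exponential `e^{2πi(n + κ)z/m}`. -/
noncomputable def expMode (m κ : ℝ) (n : ℕ) (z : ℂ) : ℂ :=
  Complex.exp (2 * Real.pi * Complex.I * (n + κ) * (z / m))

lemma norm_expMode (m κ : ℝ) (n : ℕ) (z : ℂ) :
    ‖expMode m κ n z‖ = Real.exp (-(2 * Real.pi * (n + κ) / m * z.im)) := by
  rw [expMode, Complex.norm_exp]
  congr 1
  have : 2 * (Real.pi : ℂ) * Complex.I * (n + κ) * (z / m) =
      ((2 * Real.pi * (n + κ) / m : ℝ) : ℂ) * (Complex.I * z) := by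
    push_cast; ring
  rw [this, Complex.re_ofReal_mul]
  simp

lemma expMode_add (m κ : ℝ) (n : ℕ) (z w : ℂ) :
    expMode m κ n (z + w) = expMode m κ n z * expMode m κ n w := by
  rw [expMode, expMode, expMode, ← Complex.exp_add]
  congr 1
  ring

lemma expMode_zero (m κ : ℝ) (n : ℕ) : expMode m κ n 0 = 1 := by
  simp [expMode]

lemma expMode_neg_mul (m κ : ℝ) (n : ℕ) (z : ℂ) :
    expMode m κ n (-z) * expMode m κ n z = 1 := by
  rw [← expMode_add, neg_add_cancel, expMode_zero]

lemma expMode_add_nat (m κ : ℝ) (n k : ℕ) (z : ℂ) :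
    expMode m κ (n + k) z = expMode m κ n z * expMode m 0 1 z ^ k := by
  rw [expMode, expMode, expMode, ← Complex.exp_nat_mul, ← Complex.exp_add]
  congr 1
  push_cast
  ring

@[fun_prop]
lemma differentiable_expMode (m κ : ℝ) (n : ℕ) : Differentiable ℂ (expMode m κ n) := by
  unfold expMode
  fun_prop

@[fun_prop]
lemma continuous_expMode (m κ : ℝ) (n : ℕ) : Continuous (expMode m κ n) :=
  (differentiable_expMode m κ n).continuous

/-- `H` is holomorphic on the upper half-plane, with a Fourier expansion
`H z = ∑ c_n e^{2πi(n + κ)z/m}` supported on positive frequencies, and is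
bounded by a multiple of `(Im z) ^ (-a)`. -/
structure IsFourierExpansion (m κ a : ℝ) (c : ℕ → ℂ) (H : ℂ → ℂ) : Prop where
  m_pos : 0 < m
  κ_nonneg : 0 ≤ κ
  a_pos : 0 < a
  coeff_eq_zero : ∀ n : ℕ, ¬ 0 < (n : ℝ) + κ → c n = 0
  holo : DifferentiableOn ℂ H {z | 0 < z.im}
  hasSum : ∀ z : ℂ, 0 < z.im → HasSum (fun n => c n * expMode m κ n z) (H z)
  bound : ∃ C : ℝ, 0 < C ∧ ∀ z : ℂ, 0 < z.im → ‖H z‖ ≤ C * z.im ^ (-a)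

lemma integral_expMode_mul (m κ : ℝ) (hm : 0 < m) (n k : ℕ) (t : ℝ) :
    ∫ u in (0 : ℝ)..m, expMode m κ k (u + t * Complex.I) * expMode m κ n (-(u + t * Complex.I)) =
      if k = n then (m : ℂ) else 0 := by
  split_ifs with h
  · subst h
    have e : ∀ u : ℝ, expMode m κ k (u + t * Complex.I) * expMode m κ k (-(u + t * Complex.I)) =
        1 := fun u => by rw [mul_comm, expMode_neg_mul]
    rw [intervalIntegral.integral_congr fun u _ => e u]
    simp
  · have hm' : (m : ℂ) ≠ 0 := by exact_mod_cast hm.ne'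
    have hkn : (k : ℂ) - n ≠ 0 := sub_ne_zero.mpr (by exact_mod_cast h)
    set d : ℂ := 2 * Real.pi * Complex.I * ((k : ℂ) - n) / m with hd
    have hd0 : d ≠ 0 := by
      rw [hd]
      exact div_ne_zero (mul_ne_zero Complex.two_pi_I_ne_zero hkn) hm'
    have key : ∀ u : ℝ, expMode m κ k (u + t * Complex.I) *
        expMode m κ n (-(u + t * Complex.I)) = Complex.exp (d * (t * Complex.I)) *
          Complex.exp (d * u) := by
      intro u
      rw [expMode, expMode, ← Complex.exp_add, ← Complex.exp_add, hd]
      congr 1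
      field_simp
      ring
    simp_rw [key]
    rw [intervalIntegral.integral_const_mul, integral_exp_mul_complex hd0]
    have h1 : Complex.exp (d * m) = 1 := by
      rw [Complex.exp_eq_one_iff]
      refine ⟨(k : ℤ) - n, ?_⟩
      rw [hd]
      push_cast
      field_simp
    simp [h1]

namespace IsFourierExpansion

variable {m κ a : ℝ} {c : ℕ → ℂ} {H : ℂ → ℂ}

lemma continuous_comp_line (h : IsFourierExpansion m κ a c H) {t : ℝ} (ht : 0 < t) :
    Continuous fun u : ℝ => H (u + t * Complex.I) := by
  have := h.holo.continuousOn
  refine this.comp_continuous (by fun_prop) ?_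
  intro u
  simpa using ht

lemma summable_norm (h : IsFourierExpansion m κ a c H) {t : ℝ} (ht : 0 < t) :
    Summable fun n => ‖c n‖ * Real.exp (-(2 * Real.pi * (n + κ) / m * t)) := by
  have := (h.hasSum (t * Complex.I) (by simpa using ht)).summable.norm
  simpa [norm_mul, norm_expMode] using this

lemma coeff_eq (h : IsFourierExpansion m κ a c H) (n : ℕ) {t : ℝ} (ht : 0 < t) :
    c n = (1 / (m : ℂ)) * ∫ u in (0 : ℝ)..m,
      H (u + t * Complex.I) * expMode m κ n (-(u + t * Complex.I)) := by
  have hm' : (m : ℂ) ≠ 0 := by exact_mod_cast h.m_pos.ne'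
  have key : HasSum (fun k => ∫ u in (0 : ℝ)..m, c k * expMode m κ k (u + t * Complex.I) *
      expMode m κ n (-(u + t * Complex.I)))
      (∫ u in (0 : ℝ)..m, H (u + t * Complex.I) * expMode m κ n (-(u + t * Complex.I))) := by
    refine intervalIntegral.hasSum_integral_of_dominated_convergence
      (fun k _ => ‖c k‖ * Real.exp (-(2 * Real.pi * (k + κ) / m * t)) *
        Real.exp (2 * Real.pi * (n + κ) / m * t)) ?_ ?_ ?_ ?_ ?_
    · intro k
      exact Continuous.aestronglyMeasurable (by fun_prop)
    · intro k
      filter_upwards with u _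
      simp [norm_expMode]
    · filter_upwards with u _
      exact (h.summable_norm ht).mul_right _
    · simp
    · filter_upwards with u _
      exact (h.hasSum _ (by simpa using ht)).mul_right _
  have e1 : ∀ k, (∫ u in (0 : ℝ)..m, c k * expMode m κ k (u + t * Complex.I) *
      expMode m κ n (-(u + t * Complex.I))) = if k = n then c k * m else 0 := by
    intro k
    simp_rw [mul_assoc]
    rw [intervalIntegral.integral_const_mul, integral_expMode_mul m κ h.m_pos]
    split_ifs <;> simp
  simp_rw [e1] at key
  have e2 : HasSum (fun k => if k = n then c k * (m : ℂ) else 0) (c n * m) := by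
    simpa using hasSum_ite_eq n (c n * (m : ℂ)) |>.congr_fun (fun k => by
      by_cases hk : k = n <;> simp [hk])
  rw [key.unique e2]
  field_simp

/-- Each coefficient with n ≥ N is written as an integral over the line of height t. Summing under
the integral sign leaves a geometric series, convergent because t lies strictly below Im z. -/
lemma tail_eq (h : IsFourierExpansion m κ a c H) (N : ℕ) {z : ℂ} {t : ℝ} (ht : 0 < t)
    (hz : t < z.im) :
    H z - ∑ n ∈ Finset.range N, c n * expMode m κ n z =
      (1 / (m : ℂ)) * ∫ u in (0 : ℝ)..m, H (u + t * Complex.I) *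
        (expMode m κ N (z - (u + t * Complex.I)) *
          (1 - expMode m 0 1 (z - (u + t * Complex.I)))⁻¹) := by
  have him : ∀ u : ℝ, (z - (u + t * Complex.I)).im = z.im - t := by intro u; simp
  have h1 : HasSum (fun k => c (k + N) * expMode m κ (k + N) z)
      (H z - ∑ n ∈ Finset.range N, c n * expMode m κ n z) :=
    (hasSum_nat_add_iff' N).mpr (h.hasSum z (ht.trans hz))
  set r : ℝ := Real.exp (-(2 * Real.pi / m * (z.im - t))) with hr
  have hr1 : r < 1 := by
    rw [hr, Real.exp_lt_one_iff]
    have := h.m_pos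
    have : 0 < z.im - t := by linarith
    have := Real.pi_pos
    simp only [Left.neg_neg_iff]
    positivity
  have hr0 : 0 ≤ r := (Real.exp_pos _).le
  have hq : ∀ u : ℝ, ‖expMode m 0 1 (z - (u + t * Complex.I))‖ = r := by
    intro u
    rw [norm_expMode, him]
    simp [hr]
  have key : HasSum (fun k => ∫ u in (0 : ℝ)..m, H (u + t * Complex.I) *
      (expMode m κ N (z - (u + t * Complex.I)) * expMode m 0 1 (z - (u + t * Complex.I)) ^ k))
      (∫ u in (0 : ℝ)..m, H (u + t * Complex.I) * (expMode m κ N (z - (u + t * Complex.I)) *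
          (1 - expMode m 0 1 (z - (u + t * Complex.I)))⁻¹)) := by
    refine intervalIntegral.hasSum_integral_of_dominated_convergence
      (fun k u => ‖H (u + t * Complex.I)‖ *
        (Real.exp (-(2 * Real.pi * (N + κ) / m * (z.im - t))) * r ^ k)) ?_ ?_ ?_ ?_ ?_
    · intro k
      exact Continuous.aestronglyMeasurable ((h.continuous_comp_line ht).mul (by fun_prop))
    · intro k
      filter_upwards with u _
      rw [norm_mul, norm_mul, norm_pow, hq, norm_expMode, him]
    · filter_upwards with u _
      exact ((summable_geometric_of_lt_one hr0 hr1).mul_left _).mul_left _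
    · simp_rw [tsum_mul_left]
      exact Continuous.intervalIntegrable ((h.continuous_comp_line ht).norm.mul continuous_const) _ _
    · filter_upwards with u _
      refine HasSum.mul_left _ (HasSum.mul_left _ ?_)
      exact hasSum_geometric_of_norm_lt_one (by rw [hq]; exact hr1)
  have e1 : ∀ k, (1 / (m : ℂ)) * (∫ u in (0 : ℝ)..m, H (u + t * Complex.I) *
      (expMode m κ N (z - (u + t * Complex.I)) * expMode m 0 1 (z - (u + t * Complex.I)) ^ k)) =
      c (k + N) * expMode m κ (k + N) z := by
    intro k
    rw [h.coeff_eq (k + N) ht, mul_assoc, ← intervalIntegral.integral_mul_const]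
    congr 1
    refine intervalIntegral.integral_congr fun u _ => ?_
    rw [← expMode_add_nat, add_comm N k, mul_assoc, ← expMode_add]
    ring_nf
  have h2 := key.mul_left (1 / (m : ℂ))
  simp_rw [e1] at h2
  exact h1.unique h2

end IsFourierExpansion

/-! ### Bounds for the geometric kernel and for the tail of the Fourier series. -/

lemma norm_one_sub_exp_ge_sin (ρ φ : ℝ) (hρ : 0 ≤ ρ) :
    |Real.sin (φ / 2)| ≤ ‖1 - (ρ : ℂ) * Complex.exp (φ * Complex.I)‖ := by
  apply Real.abs_le_sqrt
  have e : Complex.normSq (1 - (ρ : ℂ) * Complex.exp (φ * Complex.I)) =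
      (1 - ρ * Real.cos φ) ^ 2 + (ρ * Real.sin φ) ^ 2 := by
    rw [Complex.normSq_apply]
    simp [Complex.exp_ofReal_mul_I_re, Complex.exp_ofReal_mul_I_im]
    ring
  rw [e]
  have h1 : Real.cos φ = 1 - 2 * Real.sin (φ / 2) ^ 2 := by
    have := Real.sin_sq_eq_half_sub (φ / 2)
    rw [mul_div_cancel₀ _ (two_ne_zero)] at this
    linarith
  have h2 := Real.sin_sq_add_cos_sq φ
  have h3 : 0 ≤ Real.sin (φ / 2) ^ 2 := sq_nonneg _
  have h4 : Real.sin (φ / 2) ^ 2 ≤ 1 := Real.sin_sq_le_one _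
  have h5 : (1 - ρ * Real.cos φ) ^ 2 + (ρ * Real.sin φ) ^ 2 = 1 - 2 * ρ * Real.cos φ + ρ ^ 2 := by
    linear_combination ρ ^ 2 * h2
  rw [h5, h1]
  nlinarith [mul_nonneg hρ h3, mul_nonneg hρ (sub_nonneg.mpr h4), sq_nonneg (1 - ρ)]

lemma norm_one_sub_exp_ge (ρ φ : ℝ) (hρ : 0 ≤ ρ) :
    1 - ρ ≤ ‖1 - (ρ : ℂ) * Complex.exp (φ * Complex.I)‖ := by
  have := norm_sub_norm_le (1 : ℂ) ((ρ : ℂ) * Complex.exp (φ * Complex.I))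
  simpa [Complex.norm_exp_ofReal_mul_I, abs_of_nonneg hρ] using this

lemma expMode_zero_one_eq (m : ℝ) (u s : ℝ) :
    expMode m 0 1 (u + s * Complex.I) = (Real.exp (-(2 * Real.pi / m * s)) : ℝ) *
      Complex.exp ((2 * Real.pi * u / m : ℝ) * Complex.I) := by
  rw [expMode, Complex.ofReal_exp, ← Complex.exp_add]
  congr 1
  push_cast
  linear_combination (2 * Real.pi * s / m) * Complex.I_sq

lemma one_div_one_sub_exp_neg_rpow_le {s ε : ℝ} (hs : 0 < s) (hε0 : 0 ≤ ε) (hε1 : ε ≤ 1) :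
    (1 - Real.exp (-s)) ^ (-ε) ≤ 1 + s ^ (-ε) := by
  have h1 : Real.exp (-s) ≤ 1 / (1 + s) := by
    rw [Real.exp_neg, ← one_div]
    apply one_div_le_one_div_of_le (by positivity)
    linarith [Real.add_one_le_exp s]
  have h2 : s / (1 + s) ≤ 1 - Real.exp (-s) := by
    have : s / (1 + s) = 1 - 1 / (1 + s) := by field_simp; ring
    linarith
  calc (1 - Real.exp (-s)) ^ (-ε) ≤ (s / (1 + s)) ^ (-ε) :=
        Real.rpow_le_rpow_of_nonpos (by positivity) h2 (by linarith)
    _ = (1 + s⁻¹) ^ ε := by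
        rw [Real.rpow_neg (by positivity), ← Real.inv_rpow (by positivity)]
        congr 1
        field_simp
        ring
    _ ≤ 1 ^ ε + (s⁻¹) ^ ε := Real.rpow_add_le_add_rpow zero_le_one (by positivity) hε0 hε1
    _ = 1 + s ^ (-ε) := by rw [Real.one_rpow, Real.inv_rpow hs.le, Real.rpow_neg hs.le]

/-- Jordan's inequality on each half of the period. The exponent ε - 1 is not positive, so the sine
produces a singularity at both endpoints, integrable when ε > 0. -/
lemma sin_rpow_le {m u ε : ℝ} (hu0 : 0 < u) (hu1 : u < m) (hε1 : ε ≤ 1) :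
    |Real.sin (Real.pi * u / m)| ^ (ε - 1) ≤
      (2 / m) ^ (ε - 1) * (u ^ (ε - 1) + (m - u) ^ (ε - 1)) := by
  have hm : 0 < m := hu0.trans hu1
  have aux : ∀ v : ℝ, 0 < v → v ≤ m / 2 →
      |Real.sin (Real.pi * v / m)| ^ (ε - 1) ≤ (2 / m) ^ (ε - 1) * v ^ (ε - 1) := by
    intro v hv0 hv1
    rw [← Real.mul_rpow (by positivity) hv0.le]
    refine Real.rpow_le_rpow_of_nonpos (by positivity) ?_ (by linarith)
    have h1 : Real.pi * v / m ≤ Real.pi / 2 := by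
      rw [div_le_div_iff₀ hm two_pos]
      nlinarith [Real.pi_pos]
    have h2 := Real.mul_le_sin (x := Real.pi * v / m) (by positivity) h1
    refine le_trans (le_of_eq ?_) (h2.trans (le_abs_self _))
    field_simp
  have hp : 0 ≤ (2 / m) ^ (ε - 1) := by positivity
  have hmu : 0 < m - u := by linarith
  rw [mul_add]
  rcases le_total u (m / 2) with h | h
  · exact (aux u hu0 h).trans (le_add_of_nonneg_right (by positivity))
  · have e : Real.sin (Real.pi * u / m) = Real.sin (Real.pi * (m - u) / m) := by
      rw [← Real.sin_pi_sub]
      congr 1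
      field_simp
    rw [e]
    exact (aux (m - u) hmu (by linarith)).trans (le_add_of_nonneg_left (by positivity))

/-- The `L¹` norm over a period of the geometric kernel blows up slower than any power. -/
lemma integral_kernel_le {m ε : ℝ} (hm : 0 < m) (hε0 : 0 < ε) (hε1 : ε ≤ 1) :
    ∃ C : ℝ, 0 < C ∧ ∀ x s : ℝ, 0 < s →
      ∫ u in (0 : ℝ)..m, ‖(1 - expMode m 0 1 (x - u + s * Complex.I))⁻¹‖ ≤
        C * (1 + s ^ (-ε)) := by
  set g : ℝ → ℝ := fun u => (2 / m) ^ (ε - 1) * (u ^ (ε - 1) + (m - u) ^ (ε - 1)) with hg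
  have hgi : IntervalIntegrable g MeasureTheory.volume 0 m := by
    have h1 : IntervalIntegrable (fun u : ℝ => u ^ (ε - 1)) MeasureTheory.volume 0 m :=
      intervalIntegral.intervalIntegrable_rpow' (by linarith)
    have h2 := (h1.comp_sub_left m).symm
    simp only [sub_zero, sub_self] at h2
    exact (h1.add h2).const_mul _
  set J : ℝ := ∫ u in (0 : ℝ)..m, g u with hJ
  have hJ0 : 0 ≤ J := by
    refine intervalIntegral.integral_nonneg hm.le fun u hu => ?_
    have : 0 ≤ m - u := by linarith [hu.2]
    have : 0 ≤ u := hu.1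
    simp only [hg]
    positivity
  have hpm : 0 < 2 * Real.pi / m := by have := Real.pi_pos; positivity
  refine ⟨(J + 1) * (1 + (2 * Real.pi / m) ^ (-ε)), by positivity, fun x s hs => ?_⟩
  set F : ℝ → ℝ := fun u => ‖(1 - expMode m 0 1 (u + s * Complex.I))⁻¹‖ with hF
  have hρ1 : Real.exp (-(2 * Real.pi / m * s)) < 1 := by
    rw [Real.exp_lt_one_iff, Left.neg_neg_iff]
    positivity
  have hlow : ∀ u : ℝ, 1 - Real.exp (-(2 * Real.pi / m * s)) ≤
      ‖1 - expMode m 0 1 (u + s * Complex.I)‖ := by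
    intro u
    rw [expMode_zero_one_eq]
    exact norm_one_sub_exp_ge _ _ (Real.exp_pos _).le
  have hne : ∀ u : ℝ, 1 - expMode m 0 1 (u + s * Complex.I) ≠ 0 := by
    intro u hu
    have := hlow u
    rw [hu, norm_zero] at this
    linarith
  have hFc : Continuous F := by
    refine Continuous.norm (Continuous.inv₀ (by fun_prop) hne)
  have hper : Function.Periodic F m := by
    intro u
    have hm' : (m : ℂ) ≠ 0 := by exact_mod_cast hm.ne'
    simp only [hF]
    have : expMode m 0 1 (((u + m : ℝ) : ℂ) + s * Complex.I) =
        expMode m 0 1 (u + s * Complex.I) := by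
      rw [expMode, expMode, Complex.exp_eq_exp_iff_exists_int]
      refine ⟨1, ?_⟩
      push_cast
      field_simp
      ring
    rw [this]
  have e1 : ∫ u in (0 : ℝ)..m, ‖(1 - expMode m 0 1 (x - u + s * Complex.I))⁻¹‖ =
      ∫ u in (0 : ℝ)..m, F u := by
    have h1 := intervalIntegral.integral_comp_sub_left (a := 0) (b := m) F x
    have h2 := hper.intervalIntegral_add_eq (x - m) 0
    simp only [sub_add_cancel, zero_add, sub_zero] at h1 h2
    rw [← h2, ← h1]
    simp [hF]
  rw [e1]
  -- Interpolation of the two lower bounds for D: split 1/D as D^(-ε) · D^(ε-1). The first factor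
  -- uses the bound by 1 - ρ, uniform in u; the second uses the sine bound, uniform in s and
  -- integrable in u.
  have hpt : ∀ u ∈ Set.Ioo 0 m, F u ≤ (1 - Real.exp (-(2 * Real.pi / m * s))) ^ (-ε) * g u := by
    intro u hu
    set D := ‖1 - expMode m 0 1 (u + s * Complex.I)‖ with hD
    have hD0 : 0 < D := norm_pos_iff.mpr (hne u)
    have hsin : |Real.sin (Real.pi * u / m)| ≤ D := by
      rw [hD, expMode_zero_one_eq]
      convert norm_one_sub_exp_ge_sin _ _ (Real.exp_pos _).le using 3
      ring
    have hspos : 0 < |Real.sin (Real.pi * u / m)| := by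
      rw [abs_pos]
      apply (Real.sin_pos_of_pos_of_lt_pi _ _).ne'
      · have := hu.1; have := Real.pi_pos; positivity
      · rw [div_lt_iff₀ hm]
        exact mul_lt_mul_of_pos_left hu.2 Real.pi_pos
    calc F u = D ^ (-ε) * D ^ (ε - 1) := by
          rw [← Real.rpow_add hD0, hF]
          simp only [norm_inv]
          rw [show -ε + (ε - 1) = -1 by ring, Real.rpow_neg_one]
      _ ≤ (1 - Real.exp (-(2 * Real.pi / m * s))) ^ (-ε) *
            |Real.sin (Real.pi * u / m)| ^ (ε - 1) := by
          refine mul_le_mul ?_ ?_ (by positivity) ?_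
          · exact Real.rpow_le_rpow_of_nonpos (by linarith) (hlow u) (by linarith)
          · exact Real.rpow_le_rpow_of_nonpos hspos hsin (by linarith)
          · exact Real.rpow_nonneg (by linarith) _
      _ ≤ _ := by
          exact mul_le_mul_of_nonneg_left (sin_rpow_le hu.1 hu.2 hε1)
            (Real.rpow_nonneg (by linarith) _)
  calc ∫ u in (0 : ℝ)..m, F u
      ≤ ∫ u in (0 : ℝ)..m, (1 - Real.exp (-(2 * Real.pi / m * s))) ^ (-ε) * g u :=
        intervalIntegral.integral_mono_on_of_le_Ioo hm.le (hFc.intervalIntegrable _ _)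
          (hgi.const_mul _) hpt
    _ = (1 - Real.exp (-(2 * Real.pi / m * s))) ^ (-ε) * J :=
        intervalIntegral.integral_const_mul _ _
    _ ≤ (1 + (2 * Real.pi / m * s) ^ (-ε)) * (J + 1) := by
        gcongr
        · exact one_div_one_sub_exp_neg_rpow_le (by positivity) hε0.le hε1
        · linarith
    _ ≤ _ := by
        rw [Real.mul_rpow hpm.le hs.le]
        have h1 : 0 ≤ (2 * Real.pi / m) ^ (-ε) := by positivity
        have h2 : 0 ≤ s ^ (-ε) := by positivity
        nlinarith [mul_nonneg h1 hJ0, mul_nonneg h2 hJ0]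

namespace IsFourierExpansion

variable {m κ a : ℝ} {c : ℕ → ℂ} {H : ℂ → ℂ}

/-- Use `tail_eq` on the line at half the height of z. There H contributes (Im z)^(-a), the kernel
contributes 1 + (Im z)^(-ε), and the N-th mode, now at height Im z / 2, contributes the exponential
with π in place of 2π. -/
lemma norm_tail_le (h : IsFourierExpansion m κ a c H) {ε : ℝ} (hε0 : 0 < ε) (hε1 : ε ≤ 1) :
    ∃ C : ℝ, 0 < C ∧ ∀ (N : ℕ) (z : ℂ), 0 < z.im →
      ‖H z - ∑ n ∈ Finset.range N, c n * expMode m κ n z‖ ≤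
        C * Real.exp (-(Real.pi * (N + κ) / m * z.im)) * (z.im ^ (-a) + z.im ^ (-(a + ε))) := by
  obtain ⟨B, hB0, hB⟩ := h.bound
  obtain ⟨J, hJ0, hJ⟩ := integral_kernel_le h.m_pos hε0 hε1
  have hm := h.m_pos
  refine ⟨1 / m * (B * 2 ^ a * J * (1 + 2 ^ ε)), by positivity, fun N z hz => ?_⟩
  set t := z.im / 2 with ht
  have ht0 : 0 < t := by positivity
  rw [h.tail_eq N ht0 (by linarith), norm_mul]
  have e0 : ‖(1 / (m : ℂ))‖ = 1 / m := by simp [abs_of_pos hm]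
  rw [e0, mul_assoc (1 / m), mul_assoc (1 / m)]
  refine mul_le_mul_of_nonneg_left ?_ (by positivity)
  set E := Real.exp (-(Real.pi * (N + κ) / m * z.im)) with hE
  have hw : ∀ u : ℝ, z - (u + t * Complex.I) = z.re - u + t * Complex.I := by
    intro u
    apply Complex.ext
    · simp
    · simp [ht]; ring
  have hcont : Continuous fun u : ℝ => (1 - expMode m 0 1 (z.re - u + t * Complex.I))⁻¹ := by
    refine Continuous.inv₀ (by fun_prop) fun u hu => ?_
    have h1 : ‖expMode m 0 1 (z.re - u + t * Complex.I)‖ < 1 := by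
      rw [norm_expMode, Real.exp_lt_one_iff, Left.neg_neg_iff]
      have := Real.pi_pos
      simp
      positivity
    rw [← sub_eq_zero.mp hu] at h1
    simp at h1
  calc _ ≤ ∫ u in (0 : ℝ)..m, (B * t ^ (-a) * E) *
          ‖(1 - expMode m 0 1 (z.re - u + t * Complex.I))⁻¹‖ := by
        refine intervalIntegral.norm_integral_le_of_norm_le hm.le ?_
          (Continuous.intervalIntegrable (continuous_const.mul hcont.norm) _ _)
        filter_upwards with u _
        rw [norm_mul, norm_mul, hw, ← mul_assoc]
        gcongr
        · simpa using hB (u + t * Complex.I) (by simpa using ht0)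
        · rw [norm_expMode, hE]
          apply le_of_eq
          congr 1
          simp [ht]
          ring
    _ = (B * t ^ (-a) * E) *
          ∫ u in (0 : ℝ)..m, ‖(1 - expMode m 0 1 (z.re - u + t * Complex.I))⁻¹‖ :=
        intervalIntegral.integral_const_mul _ _
    _ ≤ (B * t ^ (-a) * E) * (J * (1 + t ^ (-ε))) := by
        gcongr
        exact hJ _ _ ht0
    _ = B * 2 ^ a * J * (E * (z.im ^ (-a) + 2 ^ ε * (z.im ^ (-a) * z.im ^ (-ε)))) := by
        have e : ∀ p : ℝ, t ^ (-p) = 2 ^ p * z.im ^ (-p) := by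
          intro p
          rw [ht, Real.div_rpow hz.le zero_le_two, Real.rpow_neg zero_le_two, div_inv_eq_mul,
            mul_comm]
        rw [e, e]
        ring
    _ ≤ _ := by
        rw [neg_add, Real.rpow_add hz]
        have h1 : 0 ≤ z.im ^ (-a) := by positivity
        have h2 : 0 ≤ z.im ^ (-a) * z.im ^ (-ε) := by positivity
        have h3 : (0 : ℝ) ≤ 2 ^ ε := by positivity
        have h4 : z.im ^ (-a) + 2 ^ ε * (z.im ^ (-a) * z.im ^ (-ε)) ≤
            (1 + 2 ^ ε) * (z.im ^ (-a) + z.im ^ (-a) * z.im ^ (-ε)) := by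
          nlinarith [mul_nonneg h3 h1]
        calc B * 2 ^ a * J * (E * (z.im ^ (-a) + 2 ^ ε * (z.im ^ (-a) * z.im ^ (-ε))))
            ≤ B * 2 ^ a * J * (E * ((1 + 2 ^ ε) * (z.im ^ (-a) + z.im ^ (-a) * z.im ^ (-ε)))) := by
              gcongr
          _ = _ := by ring

end IsFourierExpansion

end FracInt


/-! ### The fractional integral as a Mellin transform, and uniform convergence. -/

namespace FracInt

lemma integrableOn_rpow_mul_exp_neg_mul {s b : ℝ} (hs : 0 < s) (hb : 0 < b) :
    MeasureTheory.IntegrableOn (fun t : ℝ => t ^ (s - 1) * Real.exp (-(b * t))) (Set.Ioi 0) := by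
  have := integrableOn_rpow_mul_exp_neg_mul_rpow (s := s - 1) (p := 1) (by linarith) one_pos hb
  simpa [neg_mul] using this

/-- Partial sums of the fractional integral of order `α` of a Fourier series. -/
noncomputable def fracPartial (m κ α : ℝ) (c : ℕ → ℂ) (N : ℕ) (x : ℝ) : ℂ :=
  ∑ n ∈ Finset.range N, c n / ((((n : ℝ) + κ) ^ α : ℝ) : ℂ) * expMode m κ n x

/-- The fractional integral of order `α`, as an integral along vertical half-lines. -/
noncomputable def fracLimit (m α : ℝ) (H : ℂ → ℂ) (x : ℝ) : ℂ :=
  (((2 * Real.pi / m) ^ α / Real.Gamma α : ℝ) : ℂ) *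
    ∫ t in Set.Ioi (0 : ℝ), ((t ^ (α - 1) : ℝ) : ℂ) * H (x + t * Complex.I)

namespace IsFourierExpansion

variable {m κ a : ℝ} {c : ℕ → ℂ} {H : ℂ → ℂ}

lemma freq_pos (h : IsFourierExpansion m κ a c H) {n : ℕ} (hn : 0 < (n : ℝ) + κ) :
    0 < 2 * Real.pi * (n + κ) / m := by
  have := h.m_pos
  have := Real.pi_pos
  positivity

lemma term_vertical (n : ℕ) (α x t : ℝ) :
    ((t ^ (α - 1) : ℝ) : ℂ) * (c n * expMode m κ n (x + t * Complex.I)) =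
      c n * expMode m κ n x *
        ((t ^ (α - 1) * Real.exp (-(2 * Real.pi * (n + κ) / m * t)) : ℝ) : ℂ) := by
  have : expMode m κ n (t * Complex.I) =
      ((Real.exp (-(2 * Real.pi * (n + κ) / m * t)) : ℝ) : ℂ) := by
    rw [expMode, Complex.ofReal_exp]
    congr 1
    push_cast
    linear_combination (2 * Real.pi * (n + κ) / m * t) * Complex.I_sq
  rw [expMode_add, this]
  push_cast
  ring

lemma integrableOn_term (h : IsFourierExpansion m κ a c H) {α : ℝ} (hα : 0 < α) (n : ℕ) (x : ℝ) :
    MeasureTheory.IntegrableOn (fun t : ℝ => ((t ^ (α - 1) : ℝ) : ℂ) *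
      (c n * expMode m κ n (x + t * Complex.I))) (Set.Ioi 0) := by
  by_cases hn : 0 < (n : ℝ) + κ
  · simp_rw [term_vertical]
    exact (integrableOn_rpow_mul_exp_neg_mul hα (h.freq_pos hn)).ofReal.const_mul _
  · simp [h.coeff_eq_zero n hn]

lemma integral_term (h : IsFourierExpansion m κ a c H) {α : ℝ} (hα : 0 < α) (n : ℕ) (x : ℝ) :
    (((2 * Real.pi / m) ^ α / Real.Gamma α : ℝ) : ℂ) * ∫ t in Set.Ioi (0 : ℝ),
      ((t ^ (α - 1) : ℝ) : ℂ) * (c n * expMode m κ n (x + t * Complex.I)) =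
      c n / ((((n : ℝ) + κ) ^ α : ℝ) : ℂ) * expMode m κ n x := by
  by_cases hn : 0 < (n : ℝ) + κ
  · simp_rw [term_vertical]
    have hm := h.m_pos
    have hpi := Real.pi_pos
    have hΓ := (Real.Gamma_pos_of_pos hα).ne'
    rw [MeasureTheory.integral_const_mul, integral_complex_ofReal,
      Real.integral_rpow_mul_exp_neg_mul_Ioi hα (h.freq_pos hn)]
    have e : (1 / (2 * Real.pi * (n + κ) / m)) ^ α =
        ((2 * Real.pi / m) ^ α)⁻¹ * ((n + κ) ^ α)⁻¹ := by
      rw [← Real.inv_rpow (by positivity), ← Real.inv_rpow hn.le,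
        ← Real.mul_rpow (by positivity) (by positivity)]
      congr 1
      field_simp
    rw [e]
    have h1 : (2 * Real.pi / m) ^ α ≠ 0 := by positivity
    have h2 : ((n : ℝ) + κ) ^ α ≠ 0 := by positivity
    rw [show c n / ((((n : ℝ) + κ) ^ α : ℝ) : ℂ) * expMode m κ n x =
      (((((n : ℝ) + κ) ^ α)⁻¹ : ℝ) : ℂ) * (c n * expMode m κ n x) by push_cast; ring]
    rw [mul_left_comm, ← Complex.ofReal_mul, mul_comm]
    congr 2
    field_simp
  · simp [h.coeff_eq_zero n hn]

lemma continuousOn_vertical (h : IsFourierExpansion m κ a c H) (x : ℝ) :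
    ContinuousOn (fun t : ℝ => H (x + t * Complex.I)) (Set.Ioi 0) := by
  refine h.holo.continuousOn.comp (by fun_prop) fun t ht => ?_
  simpa using ht

lemma aestronglyMeasurable_vertical (h : IsFourierExpansion m κ a c H) (α x : ℝ) :
    MeasureTheory.AEStronglyMeasurable (fun t : ℝ => ((t ^ (α - 1) : ℝ) : ℂ) *
      H (x + t * Complex.I)) (MeasureTheory.volume.restrict (Set.Ioi 0)) := by
  refine ContinuousOn.aestronglyMeasurable ?_ measurableSet_Ioi
  refine ContinuousOn.mul ?_ (h.continuousOn_vertical x)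
  refine Complex.continuous_ofReal.comp_continuousOn ?_
  intro t ht
  exact (Real.continuousAt_rpow_const _ _ (Or.inl (ne_of_gt ht))).continuousWithinAt

lemma norm_tail_vertical_le (h : IsFourierExpansion m κ a c H) {α : ℝ} (hα : a < α) :
    ∃ C ε : ℝ, 0 < C ∧ 0 < α - a - ε ∧ ∀ (N : ℕ) (x t : ℝ), 0 < t →
      ‖((t ^ (α - 1) : ℝ) : ℂ) * (H (x + t * Complex.I) -
        ∑ n ∈ Finset.range N, c n * expMode m κ n (x + t * Complex.I))‖ ≤
      C * (t ^ (α - a - 1) * Real.exp (-(Real.pi * (N + κ) / m * t)) +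
        t ^ (α - a - ε - 1) * Real.exp (-(Real.pi * (N + κ) / m * t))) := by
  -- Half of α - a keeps α - a - ε positive, so both powers of t stay integrable at 0; the cap 1 is
  -- the range allowed in `norm_tail_le`.
  set ε := min ((α - a) / 2) 1 with hε
  have hε0 : 0 < ε := lt_min (by linarith) one_pos
  obtain ⟨C, hC0, hC⟩ := h.norm_tail_le hε0 (min_le_right _ _)
  refine ⟨C, ε, hC0, ?_, fun N x t ht => ?_⟩
  · have : ε ≤ (α - a) / 2 := min_le_left _ _
    linarith
  · have h1 := hC N (x + t * Complex.I) (by simpa using ht)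
    have him : ((x : ℂ) + t * Complex.I).im = t := by simp
    rw [him] at h1
    rw [norm_mul, Complex.norm_real, Real.norm_of_nonneg (by positivity)]
    refine (mul_le_mul_of_nonneg_left h1 (by positivity)).trans (le_of_eq ?_)
    rw [show α - a - 1 = (α - 1) + (-a) by ring, show α - a - ε - 1 = (α - 1) + (-(a + ε)) by ring,
      Real.rpow_add ht, Real.rpow_add ht]
    ring

/-- The term n = 0 is integrated separately. What remains is the tail with N = 1, whose bound decays
exponentially even when κ = 0. -/
lemma integrableOn_vertical (h : IsFourierExpansion m κ a c H) {α : ℝ} (hα : a < α) (x : ℝ) :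
    MeasureTheory.IntegrableOn (fun t : ℝ => ((t ^ (α - 1) : ℝ) : ℂ) *
      H (x + t * Complex.I)) (Set.Ioi 0) := by
  obtain ⟨C, ε, -, hε, hC⟩ := h.norm_tail_vertical_le hα
  have hα0 := h.a_pos.trans hα
  have hb : 0 < Real.pi * ((1 : ℕ) + κ) / m := by
    have := h.m_pos; have := Real.pi_pos; have := h.κ_nonneg
    positivity
  have hterm := h.integrableOn_term hα0 0 x
  have hmeas := (h.aestronglyMeasurable_vertical α x).sub hterm.aestronglyMeasurable
  have htail : MeasureTheory.IntegrableOn (fun t : ℝ => ((t ^ (α - 1) : ℝ) : ℂ) *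
      H (x + t * Complex.I) - ((t ^ (α - 1) : ℝ) : ℂ) *
      (c 0 * expMode m κ 0 (x + t * Complex.I))) (Set.Ioi 0) := by
    refine MeasureTheory.Integrable.mono' (((integrableOn_rpow_mul_exp_neg_mul
      (sub_pos.mpr hα) hb).add (integrableOn_rpow_mul_exp_neg_mul hε hb)).const_mul C) hmeas ?_
    filter_upwards [MeasureTheory.ae_restrict_mem measurableSet_Ioi] with t ht
    have := hC 1 x t ht
    simpa [mul_sub] using this
  refine (htail.add hterm).congr (Eventually.of_forall fun t => ?_)
  simp

/-- Integrating the tail bound gives two Gamma integrals with rate π(N+κ)/m, hence negative powers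
of N, uniformly in x. -/
lemma norm_fracPartial_sub_le (h : IsFourierExpansion m κ a c H) {α : ℝ} (hα : a < α) :
    ∃ C ε : ℝ, 0 < α - a - ε ∧ ∀ (N : ℕ) (x : ℝ), 1 ≤ N →
      ‖fracPartial m κ α c N x - fracLimit m α H x‖ ≤
        C * ((1 / (Real.pi * (N + κ) / m)) ^ (α - a) * Real.Gamma (α - a) +
          (1 / (Real.pi * (N + κ) / m)) ^ (α - a - ε) * Real.Gamma (α - a - ε)) := by
  obtain ⟨C, ε, -, hε, hC⟩ := h.norm_tail_vertical_le hα
  have hα0 := h.a_pos.trans hα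
  set A : ℝ := (2 * Real.pi / m) ^ α / Real.Gamma α with hA
  refine ⟨|A| * C, ε, hε, fun N x hN => ?_⟩
  have hb : 0 < Real.pi * (N + κ) / m := by
    have := h.m_pos; have := Real.pi_pos; have := h.κ_nonneg
    have : (0 : ℝ) < N := by exact_mod_cast hN
    positivity
  have e : fracPartial m κ α c N x - fracLimit m α H x = -((A : ℂ) * ∫ t in Set.Ioi (0 : ℝ),
      ((t ^ (α - 1) : ℝ) : ℂ) * (H (x + t * Complex.I) -
        ∑ n ∈ Finset.range N, c n * expMode m κ n (x + t * Complex.I))) := by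
    simp_rw [mul_sub, Finset.mul_sum]
    rw [MeasureTheory.integral_sub (h.integrableOn_vertical hα x)
      (MeasureTheory.integrable_finsetSum _ fun n _ => h.integrableOn_term hα0 n x),
      MeasureTheory.integral_finsetSum _ fun n _ => h.integrableOn_term hα0 n x, mul_sub,
      Finset.mul_sum, neg_sub, fracLimit, fracPartial]
    congr 1
    refine Finset.sum_congr rfl fun n _ => ?_
    exact (h.integral_term hα0 n x).symm
  rw [e, norm_neg, norm_mul, Complex.norm_real, Real.norm_eq_abs, mul_assoc]
  refine mul_le_mul_of_nonneg_left ?_ (abs_nonneg _)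
  rw [← Real.integral_rpow_mul_exp_neg_mul_Ioi (sub_pos.mpr hα) hb,
    ← Real.integral_rpow_mul_exp_neg_mul_Ioi hε hb,
    ← MeasureTheory.integral_add (integrableOn_rpow_mul_exp_neg_mul (sub_pos.mpr hα) hb)
      (integrableOn_rpow_mul_exp_neg_mul hε hb), ← MeasureTheory.integral_const_mul]
  refine MeasureTheory.norm_integral_le_of_norm_le (((integrableOn_rpow_mul_exp_neg_mul
      (sub_pos.mpr hα) hb).add (integrableOn_rpow_mul_exp_neg_mul hε hb)).const_mul C) ?_
  filter_upwards [MeasureTheory.ae_restrict_mem measurableSet_Ioi] with t ht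
  exact hC N x t ht

/-- The Fourier series of the fractional integral converges uniformly. -/
theorem tendstoUniformly_fracPartial (h : IsFourierExpansion m κ a c H) {α : ℝ} (hα : a < α) :
    TendstoUniformly (fracPartial m κ α c) (fracLimit m α H) atTop := by
  obtain ⟨C, ε, hε, hC⟩ := h.norm_fracPartial_sub_le hα
  have hm := h.m_pos
  have hinv : Tendsto (fun N : ℕ => 1 / (Real.pi * (N + κ) / m)) atTop (𝓝 0) := by
    simp_rw [one_div]
    refine tendsto_inv_atTop_zero.comp ?_
    refine Tendsto.atTop_div_const hm (Tendsto.const_mul_atTop Real.pi_pos ?_)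
    exact tendsto_atTop_add_const_right _ _ tendsto_natCast_atTop_atTop
  have hp : ∀ p : ℝ, 0 < p →
      Tendsto (fun N : ℕ => (1 / (Real.pi * (N + κ) / m)) ^ p) atTop (𝓝 0) := by
    intro p hp
    have := hinv.rpow_const (p := p) (Or.inr hp.le)
    rwa [Real.zero_rpow hp.ne'] at this
  have hlim := (((hp _ (sub_pos.mpr hα)).mul_const (Real.Gamma (α - a))).add
    ((hp _ hε).mul_const (Real.Gamma (α - a - ε)))).const_mul C
  simp only [zero_mul, add_zero, mul_zero] at hlim
  rw [Metric.tendstoUniformly_iff]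
  intro δ hδ
  filter_upwards [hlim.eventually (gt_mem_nhds hδ), eventually_ge_atTop 1] with N h1 h2 x
  rw [dist_comm, dist_eq_norm]
  exact (hC N x h2).trans_lt h1

lemma continuous_fracPartial (α : ℝ) (N : ℕ) : Continuous (fracPartial m κ α c N) := by
  unfold fracPartial
  fun_prop

theorem continuous_fracLimit (h : IsFourierExpansion m κ a c H) {α : ℝ} (hα : a < α) :
    Continuous (fracLimit m α H) :=
  (h.tendstoUniformly_fracPartial hα).continuous
    (Frequently.of_forall fun N => continuous_fracPartial α N)

lemma hasDerivAt_fracPartial (h : IsFourierExpansion m κ a c H) (α : ℝ) (N : ℕ) (x : ℝ) :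
    HasDerivAt (fracPartial m κ α c N)
      (2 * Real.pi * Complex.I / m * fracPartial m κ (α - 1) c N x) x := by
  unfold fracPartial
  rw [Finset.mul_sum]
  refine HasDerivAt.fun_sum fun n _ => ?_
  have h1 : HasDerivAt (fun x : ℝ => expMode m κ n x)
      (expMode m κ n x * (2 * Real.pi * Complex.I * (n + κ) * (1 / m))) x := by
    unfold expMode
    have := ((Complex.ofRealCLM.hasDerivAt (x := x)).div_const (m : ℂ)).const_mul
      (2 * Real.pi * Complex.I * (n + κ))
    simpa using this.cexp
  have h2 : 2 * Real.pi * Complex.I / m *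
      (c n / ((((n : ℝ) + κ) ^ (α - 1) : ℝ) : ℂ) * expMode m κ n x) =
      c n / ((((n : ℝ) + κ) ^ α : ℝ) : ℂ) *
        (expMode m κ n x * (2 * Real.pi * Complex.I * (n + κ) * (1 / m))) := by
    by_cases hn : 0 < (n : ℝ) + κ
    · have h3 : ((n : ℂ) + κ) ≠ 0 := by exact_mod_cast hn.ne'
      have e : ((((n : ℝ) + κ) ^ α : ℝ) : ℂ) =
          ((((n : ℝ) + κ) ^ (α - 1) : ℝ) : ℂ) * (n + κ) := by
        rw [Real.rpow_sub_one hn.ne']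
        push_cast
        field_simp
      have h2 : ((((n : ℝ) + κ) ^ (α - 1) : ℝ) : ℂ) ≠ 0 := by
        exact_mod_cast (Real.rpow_pos_of_pos hn _).ne'
      rw [e]
      field_simp
    · simp [h.coeff_eq_zero n hn]
  rw [h2]
  exact h1.const_mul _

theorem hasDerivAt_fracLimit (h : IsFourierExpansion m κ a c H) {α : ℝ} (hα : a < α - 1) (x : ℝ) :
    HasDerivAt (fracLimit m α H) (2 * Real.pi * Complex.I / m * fracLimit m (α - 1) H x) x := by
  refine hasDerivAt_of_tendstoUniformly (f := fun N x => fracPartial m κ α c N x)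
    (f' := fun N x => 2 * Real.pi * Complex.I / m * fracPartial m κ (α - 1) c N x)
    (g' := fun x => 2 * Real.pi * Complex.I / m * fracLimit m (α - 1) H x) (l := atTop) ?_
    (Eventually.of_forall fun N y => h.hasDerivAt_fracPartial α N y)
    (fun y => (h.tendstoUniformly_fracPartial (by linarith)).tendsto_at y) x
  have hu := h.tendstoUniformly_fracPartial hα
  exact (uniformContinuous_const_smul (2 * Real.pi * Complex.I / m : ℂ)).comp_tendstoUniformly hu

theorem iteratedDeriv_fracLimit (h : IsFourierExpansion m κ a c H) (k : ℕ) {α : ℝ}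
    (hα : a < α - k) :
    iteratedDeriv k (fracLimit m α H) =
      fun x => (2 * Real.pi * Complex.I / m) ^ k * fracLimit m (α - k) H x := by
  induction k with
  | zero => simp
  | succ k ih =>
    push_cast at hα
    rw [iteratedDeriv_succ, ih (by linarith)]
    ext x
    have := (h.hasDerivAt_fracLimit (α := α - k) (by linarith) x).const_mul
      ((2 * Real.pi * Complex.I / m : ℂ) ^ k)
    rw [this.deriv]
    push_cast
    rw [show α - (k + 1) = α - k - 1 by ring]
    ring

lemma hasDerivsOn_fracLimit (h : IsFourierExpansion m κ a c H) (k : ℕ) {α : ℝ}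
    (hα : a < α - k) : HasDerivsOn k (fracLimit m α H) Set.univ := by
  intro j hj x _
  have hj' : (j : ℝ) + 1 ≤ k := by exact_mod_cast hj
  rw [h.iteratedDeriv_fracLimit j (by linarith)]
  exact ((h.hasDerivAt_fracLimit (α := α - j) (by linarith) x).const_mul _).differentiableAt

end IsFourierExpansion

end FracInt


/-! ### Hölder regularity of the fractional integral. -/

namespace FracInt

/-- This is u ≤ e^u at u = py/b, raised to the power b and inverted. -/
lemma exp_neg_mul_le_rpow {p b y : ℝ} (hp : 0 < p) (hb : 0 < b) (hy : 0 < y) :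
    Real.exp (-(p * y)) ≤ (b / p) ^ b * y ^ (-b) := by
  have h1 : p * y / b ≤ Real.exp (p * y / b) := by
    linarith [Real.add_one_le_exp (p * y / b)]
  have h2 : (p * y / b) ^ b ≤ Real.exp (p * y) := by
    calc (p * y / b) ^ b ≤ Real.exp (p * y / b) ^ b :=
          Real.rpow_le_rpow (by positivity) h1 hb.le
      _ = Real.exp (p * y) := by
          rw [← Real.exp_mul]
          congr 1
          field_simp
  rw [Real.exp_neg, Real.rpow_neg hy.le]
  have h3 : (b / p) ^ b * (y ^ b)⁻¹ = ((p * y / b) ^ b)⁻¹ := by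
    rw [← Real.inv_rpow hy.le, ← Real.mul_rpow (by positivity) (by positivity),
      ← Real.inv_rpow (by positivity)]
    congr 1
    field_simp
  rw [h3]
  exact inv_anti₀ (by positivity) h2

namespace IsFourierExpansion

variable {m κ a : ℝ} {c : ℕ → ℂ} {H : ℂ → ℂ}

/-- Beyond the growth bound, `H` decays faster than any power at `i∞`. -/
lemma norm_le_rpow (h : IsFourierExpansion m κ a c H) {b : ℝ} (hb : a ≤ b) :
    ∃ C : ℝ, 0 < C ∧ ∀ z : ℂ, 0 < z.im → ‖H z‖ ≤ C * z.im ^ (-b) := by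
  obtain ⟨B, hB0, hB⟩ := h.bound
  obtain ⟨C, hC0, hC⟩ := h.norm_tail_le one_pos le_rfl
  have hb0 : 0 < b := h.a_pos.trans_le hb
  have hm := h.m_pos
  have hpi := Real.pi_pos
  have hκ := h.κ_nonneg
  -- The tail with N = 1 decays at i∞ in any case. The zeroth mode decays when its frequency is
  -- positive and is absent otherwise.
  have h0 : ∃ D : ℝ, 0 ≤ D ∧ ∀ z : ℂ, 0 < z.im → ‖c 0 * expMode m κ 0 z‖ ≤ D * z.im ^ (-b) := by
    by_cases h0 : 0 < ((0 : ℕ) : ℝ) + κ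
    · refine ⟨‖c 0‖ * (b / (2 * Real.pi * ((0 : ℕ) + κ) / m)) ^ b, by positivity, fun z hz => ?_⟩
      rw [norm_mul, norm_expMode, mul_assoc ‖c 0‖]
      exact mul_le_mul_of_nonneg_left (exp_neg_mul_le_rpow (h.freq_pos h0) hb0 hz)
        (norm_nonneg _)
    · exact ⟨0, le_rfl, fun z _ => by simp [h.coeff_eq_zero 0 h0]⟩
  obtain ⟨D, hD0, hD⟩ := h0
  set p := Real.pi * ((1 : ℕ) + κ) / m with hp
  have hp0 : 0 < p := by positivity
  refine ⟨B + (C * (b / p) ^ b * 2 + D), by positivity, fun z hz => ?_⟩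
  have hzb : 0 < z.im ^ (-b) := by positivity
  rcases le_total z.im 1 with h1 | h1
  · calc ‖H z‖ ≤ B * z.im ^ (-a) := hB z hz
      _ ≤ B * z.im ^ (-b) := by
          gcongr B * ?_
          exact Real.rpow_le_rpow_of_exponent_ge hz h1 (by linarith)
      _ ≤ _ := by
          gcongr
          have : 0 ≤ C * (b / p) ^ b * 2 + D := by positivity
          linarith
  · have h2 := hC 1 z hz
    simp only [Finset.range_one, Finset.sum_singleton] at h2
    have h3 : z.im ^ (-a) + z.im ^ (-(a + 1)) ≤ 2 := by
      have e1 := Real.rpow_le_one_of_one_le_of_nonpos h1 (by linarith [h.a_pos] : -a ≤ 0)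
      have e2 := Real.rpow_le_one_of_one_le_of_nonpos h1 (by linarith [h.a_pos] : -(a + 1) ≤ 0)
      linarith
    calc ‖H z‖ ≤ ‖H z - c 0 * expMode m κ 0 z‖ + ‖c 0 * expMode m κ 0 z‖ := by
          have := norm_add_le (H z - c 0 * expMode m κ 0 z) (c 0 * expMode m κ 0 z)
          simpa using this
      _ ≤ C * ((b / p) ^ b * z.im ^ (-b)) * 2 + D * z.im ^ (-b) := by
          refine add_le_add (h2.trans ?_) (hD z hz)
          gcongr
          exact exp_neg_mul_le_rpow hp0 hb0 hz
      _ ≤ _ := by nlinarith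

/-- Cauchy's estimate on the disc of radius Im z / 2 bounds H' by a multiple of (Im z)^(-b-1); the
mean value inequality in the half-plane of height at least t finishes. -/
lemma norm_sub_horizontal_le (h : IsFourierExpansion m κ a c H) {b : ℝ} (hb : a ≤ b) :
    ∃ C : ℝ, 0 < C ∧ ∀ x x' t : ℝ, 0 < t →
      ‖H (x + t * Complex.I) - H (x' + t * Complex.I)‖ ≤ C * |x - x'| * t ^ (-b - 1) := by
  obtain ⟨C, hC0, hC⟩ := h.norm_le_rpow hb
  have hb0 : 0 < b := h.a_pos.trans_le hb
  have hopen : IsOpen {z : ℂ | 0 < z.im} := isOpen_lt continuous_const Complex.continuous_im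
  have hderiv : ∀ z : ℂ, 0 < z.im → ‖deriv H z‖ ≤ C * 2 ^ b * 2 * z.im ^ (-b - 1) := by
    intro z hz
    have hsub : ∀ w ∈ Metric.closedBall z (z.im / 2), z.im / 2 ≤ w.im := by
      intro w hw
      rw [mem_closedBall_iff_norm] at hw
      have := (Complex.abs_im_le_norm (w - z)).trans hw
      rw [Complex.sub_im] at this
      linarith [(abs_le.mp this).1]
    have hd : DiffContOnCl ℂ H (Metric.ball z (z.im / 2)) := by
      refine DifferentiableOn.diffContOnCl_ball (U := {z | 0 < z.im}) h.holo fun w hw => ?_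
      have := hsub w hw
      exact (by positivity : 0 < z.im / 2).trans_le this
    have := Complex.norm_deriv_le_of_forall_mem_sphere_norm_le (C := C * (z.im / 2) ^ (-b))
      (by positivity : 0 < z.im / 2) hd fun w hw => ?_
    · refine this.trans (le_of_eq ?_)
      rw [Real.div_rpow hz.le zero_le_two, Real.rpow_neg zero_le_two, Real.rpow_sub_one hz.ne']
      field_simp
    · have hw' := hsub w (Metric.sphere_subset_closedBall hw)
      refine (hC w (by linarith)).trans ?_
      gcongr C * ?_
      exact Real.rpow_le_rpow_of_nonpos (by positivity) hw' (by linarith)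
  refine ⟨C * 2 ^ b * 2, by positivity, fun x x' t ht => ?_⟩
  have hconv := convex_halfSpace_im_ge t
  have hmem : ∀ y : ℝ, (y : ℂ) + t * Complex.I ∈ {z : ℂ | t ≤ z.im} := fun y => by simp
  have := hconv.norm_image_sub_le_of_norm_deriv_le (𝕜 := ℂ) (f := H)
    (C := C * 2 ^ b * 2 * t ^ (-b - 1)) (x := x' + t * Complex.I) (y := x + t * Complex.I)
    (fun z hz => h.holo.differentiableAt (hopen.mem_nhds (lt_of_lt_of_le ht hz)))
    (fun z hz => (hderiv z (lt_of_lt_of_le ht hz)).trans ?_) (hmem _) (hmem _)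
  · refine this.trans (le_of_eq ?_)
    have e : ((x : ℂ) + t * Complex.I) - (x' + t * Complex.I) = ((x - x' : ℝ) : ℂ) := by
      push_cast; ring
    rw [e, Complex.norm_real, Real.norm_eq_abs]
    ring
  · gcongr _ * ?_
    exact Real.rpow_le_rpow_of_nonpos ht hz (by linarith)

/-- The integrand of the difference of two values of a fractional integral. -/
lemma fracLimit_sub (h : IsFourierExpansion m κ a c H) {α : ℝ} (hα : a < α) (x x' : ℝ) {d : ℝ}
    (hd : 0 ≤ d) :
    ‖fracLimit m α H x - fracLimit m α H x'‖ ≤ |(2 * Real.pi / m) ^ α / Real.Gamma α| *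
      (‖∫ t in Set.Ioc 0 d, ((t ^ (α - 1) : ℝ) : ℂ) *
          (H (x + t * Complex.I) - H (x' + t * Complex.I))‖ +
        ‖∫ t in Set.Ioi d, ((t ^ (α - 1) : ℝ) : ℂ) *
          (H (x + t * Complex.I) - H (x' + t * Complex.I))‖) := by
  have h1 := h.integrableOn_vertical hα x
  have h2 := h.integrableOn_vertical hα x'
  have h3 : MeasureTheory.IntegrableOn (fun t : ℝ => ((t ^ (α - 1) : ℝ) : ℂ) *
      (H (x + t * Complex.I) - H (x' + t * Complex.I))) (Set.Ioi 0) := by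
    simp_rw [mul_sub]
    exact h1.sub h2
  rw [fracLimit, fracLimit, ← mul_sub, ← MeasureTheory.integral_sub h1 h2, norm_mul,
    Complex.norm_real, Real.norm_eq_abs]
  refine mul_le_mul_of_nonneg_left ?_ (abs_nonneg _)
  simp_rw [← mul_sub]
  rw [← Set.Ioc_union_Ioi_eq_Ioi hd] at h3 ⊢
  rw [MeasureTheory.setIntegral_union (Set.Ioc_disjoint_Ioi le_rfl) measurableSet_Ioi
    h3.left_of_union h3.right_of_union]
  exact norm_add_le _ _

lemma norm_integral_Ioc_le (h : IsFourierExpansion m κ a c H) {α : ℝ} (hα : a < α) :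
    ∃ C : ℝ, 0 ≤ C ∧ ∀ x x' d : ℝ, 0 ≤ d → ‖∫ t in Set.Ioc 0 d, ((t ^ (α - 1) : ℝ) : ℂ) *
          (H (x + t * Complex.I) - H (x' + t * Complex.I))‖ ≤ C * d ^ (α - a) := by
  obtain ⟨B, hB0, hB⟩ := h.bound
  have hβ : 0 < α - a := by linarith
  refine ⟨2 * B / (α - a), by positivity, fun x x' d hd => ?_⟩
  have hint : MeasureTheory.IntegrableOn (fun t : ℝ => 2 * B * t ^ (α - a - 1)) (Set.Ioc 0 d) := by
    rw [← intervalIntegrable_iff_integrableOn_Ioc_of_le hd]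
    exact (intervalIntegral.intervalIntegrable_rpow' (by linarith)).const_mul _
  refine (MeasureTheory.norm_integral_le_of_norm_le hint ?_).trans (le_of_eq ?_)
  · filter_upwards [MeasureTheory.ae_restrict_mem measurableSet_Ioc] with t ht
    have ht0 : 0 < t := ht.1
    rw [norm_mul, Complex.norm_real, Real.norm_of_nonneg (by positivity)]
    have h1 := hB (x + t * Complex.I) (by simpa using ht0)
    have h2 := hB (x' + t * Complex.I) (by simpa using ht0)
    have him : ∀ y : ℝ, ((y : ℂ) + t * Complex.I).im = t := by intro y; simp
    rw [him] at h1 h2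
    calc t ^ (α - 1) * ‖H (x + t * Complex.I) - H (x' + t * Complex.I)‖
        ≤ t ^ (α - 1) * (B * t ^ (-a) + B * t ^ (-a)) := by
          gcongr
          exact (norm_sub_le _ _).trans (add_le_add h1 h2)
      _ = _ := by
          rw [show α - a - 1 = (α - 1) + -a by ring, Real.rpow_add ht0]
          ring
  · rw [← intervalIntegral.integral_of_le hd, intervalIntegral.integral_const_mul,
      integral_rpow (Or.inl (by linarith)), sub_add_cancel, Real.zero_rpow hβ.ne']
    ring

/-- The exponent b is left free above a: b = a serves the Hölder bound, and b = a + 1 makes the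
integral over t > 1 converge when α = a + 1. -/
lemma norm_integral_Ioi_le (h : IsFourierExpansion m κ a c H) {α b : ℝ} (hb : a ≤ b)
    (hα : α - b < 1) :
    ∃ C : ℝ, 0 ≤ C ∧ ∀ x x' d : ℝ, 0 < d → ‖∫ t in Set.Ioi d, ((t ^ (α - 1) : ℝ) : ℂ) *
          (H (x + t * Complex.I) - H (x' + t * Complex.I))‖ ≤ C * |x - x'| * d ^ (α - b - 1) := by
  obtain ⟨C, hC0, hC⟩ := h.norm_sub_horizontal_le hb
  have hβ : 0 < 1 - (α - b) := by linarith
  refine ⟨C / (1 - (α - b)), by positivity, fun x x' d hd => ?_⟩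
  have hint : MeasureTheory.IntegrableOn (fun t : ℝ => C * |x - x'| * t ^ (α - b - 2))
      (Set.Ioi d) := (integrableOn_Ioi_rpow_of_lt (by linarith) hd).const_mul _
  refine (MeasureTheory.norm_integral_le_of_norm_le hint ?_).trans (le_of_eq ?_)
  · filter_upwards [MeasureTheory.ae_restrict_mem measurableSet_Ioi] with t ht
    have ht0 : 0 < t := hd.trans ht
    rw [norm_mul, Complex.norm_real, Real.norm_of_nonneg (by positivity)]
    refine (mul_le_mul_of_nonneg_left (hC x x' t ht0) (by positivity)).trans (le_of_eq ?_)
    rw [show α - b - 2 = (α - 1) + (-b - 1) by ring, Real.rpow_add ht0]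
    ring
  · rw [MeasureTheory.integral_const_mul, integral_Ioi_rpow_of_lt (by linarith) hd,
      show α - b - 2 + 1 = -(1 - (α - b)) by ring, show α - b - 1 = -(1 - (α - b)) by ring]
    field_simp

lemma norm_integral_Ioc_one_le (h : IsFourierExpansion m κ a c H) {α : ℝ} (hα : α = a + 1) :
    ∃ C : ℝ, 0 ≤ C ∧ ∀ x x' d : ℝ, 0 < d → d ≤ 1 →
      ‖∫ t in Set.Ioc d 1, ((t ^ (α - 1) : ℝ) : ℂ) *
          (H (x + t * Complex.I) - H (x' + t * Complex.I))‖ ≤ C * |x - x'| * |Real.log d| := by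
  obtain ⟨C, hC0, hC⟩ := h.norm_sub_horizontal_le le_rfl
  refine ⟨C, hC0.le, fun x x' d hd hd1 => ?_⟩
  have hint : MeasureTheory.IntegrableOn (fun t : ℝ => C * |x - x'| * t⁻¹) (Set.Ioc d 1) := by
    rw [← intervalIntegrable_iff_integrableOn_Ioc_of_le hd1]
    refine (intervalIntegral.intervalIntegrable_inv (fun t ht => ?_) continuousOn_id).const_mul _
    rw [Set.uIcc_of_le hd1] at ht
    exact (hd.trans_le ht.1).ne'
  refine (MeasureTheory.norm_integral_le_of_norm_le hint ?_).trans (le_of_eq ?_)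
  · filter_upwards [MeasureTheory.ae_restrict_mem measurableSet_Ioc] with t ht
    have ht0 : 0 < t := hd.trans ht.1
    rw [norm_mul, Complex.norm_real, Real.norm_of_nonneg (by positivity)]
    refine (mul_le_mul_of_nonneg_left (hC x x' t ht0) (by positivity)).trans (le_of_eq ?_)
    rw [← Real.rpow_neg_one, show (-1 : ℝ) = (α - 1) + (-a - 1) by rw [hα]; ring,
      Real.rpow_add ht0]
    ring
  · rw [MeasureTheory.integral_const_mul, ← intervalIntegral.integral_of_le hd1,
      integral_inv_of_pos hd one_pos, abs_of_nonpos (Real.log_nonpos hd.le hd1), one_div,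
      Real.log_inv]

/-- Cutting at t = |x - x'| balances the two estimates: both pieces are then of order |x -
x'|^(α-a). -/
theorem holder_fracLimit (h : IsFourierExpansion m κ a c H) {α : ℝ} (hα : a < α)
    (hα1 : α - a < 1) :
    ∃ C : ℝ, ∀ x x' : ℝ,
      ‖fracLimit m α H x - fracLimit m α H x'‖ ≤ C * |x - x'| ^ (α - a) := by
  obtain ⟨C₁, h1, hC₁⟩ := h.norm_integral_Ioc_le hα
  obtain ⟨C₂, h2, hC₂⟩ := h.norm_integral_Ioi_le le_rfl hα1
  refine ⟨|(2 * Real.pi / m) ^ α / Real.Gamma α| * (C₁ + C₂), fun x x' => ?_⟩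
  rcases eq_or_ne x x' with rfl | hne
  · simp [Real.zero_rpow (sub_pos.mpr hα).ne']
  have hd : 0 < |x - x'| := abs_pos.mpr (sub_ne_zero.mpr hne)
  refine (h.fracLimit_sub hα x x' hd.le).trans ?_
  rw [mul_assoc]
  refine mul_le_mul_of_nonneg_left ?_ (abs_nonneg _)
  refine (add_le_add (hC₁ x x' _ hd.le) (hC₂ x x' _ hd)).trans (le_of_eq ?_)
  rw [Real.rpow_sub_one hd.ne']
  field_simp

/-- With α - a = 1 the horizontal estimate makes the integrand of size |x - x'|/t, and the range
from |x - x'| to 1 produces the logarithm. The ranges below |x - x'| and above 1 give linear terms,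
absorbed because |log d| ≥ log 2 for 0 < d ≤ 1/2. -/
theorem holder_log_fracLimit (h : IsFourierExpansion m κ a c H) {α : ℝ} (hα : α = a + 1) :
    ∃ C : ℝ, ∀ x x' : ℝ, |x - x'| ≤ 1 / 2 →
      ‖fracLimit m α H x - fracLimit m α H x'‖ ≤
        C * (|x - x'| ^ (1 : ℝ) * |Real.log (|x - x'|)|) := by
  have hα' : a < α := by linarith
  obtain ⟨C₁, h1, hC₁⟩ := h.norm_integral_Ioc_le hα'
  obtain ⟨C₂, h2, hC₂⟩ := h.norm_integral_Ioc_one_le hα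
  obtain ⟨C₃, h3, hC₃⟩ := h.norm_integral_Ioi_le (α := α) (b := a + 1) (by linarith) (by linarith)
  have hl2 : 0 < Real.log 2 := Real.log_pos one_lt_two
  refine ⟨|(2 * Real.pi / m) ^ α / Real.Gamma α| * (C₂ + (C₁ + C₃) / Real.log 2),
    fun x x' hxx => ?_⟩
  rcases eq_or_ne x x' with rfl | hne
  · simp
  have hd : 0 < |x - x'| := abs_pos.mpr (sub_ne_zero.mpr hne)
  have hd1 : |x - x'| ≤ 1 := by linarith
  refine (h.fracLimit_sub hα' x x' hd.le).trans ?_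
  rw [mul_assoc]
  refine mul_le_mul_of_nonneg_left ?_ (abs_nonneg _)
  have hint : MeasureTheory.IntegrableOn (fun t : ℝ => ((t ^ (α - 1) : ℝ) : ℂ) *
      (H (x + t * Complex.I) - H (x' + t * Complex.I))) (Set.Ioi |x - x'|) := by
    simp_rw [mul_sub]
    exact ((h.integrableOn_vertical hα' x).sub (h.integrableOn_vertical hα' x')).mono_set
      (Set.Ioi_subset_Ioi hd.le)
  rw [← Set.Ioc_union_Ioi_eq_Ioi hd1] at hint ⊢
  rw [MeasureTheory.setIntegral_union (Set.Ioc_disjoint_Ioi le_rfl) measurableSet_Ioi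
    hint.left_of_union hint.right_of_union]
  have e1 := hC₁ x x' _ hd.le
  have e2 := hC₂ x x' _ hd hd1
  have e3 := hC₃ x x' 1 one_pos
  rw [show α - a = 1 by linarith, Real.rpow_one] at e1
  rw [Real.one_rpow, mul_one] at e3
  have hlog : Real.log 2 ≤ |Real.log (|x - x'|)| := by
    rw [abs_of_nonpos (Real.log_nonpos hd.le hd1), ← Real.log_inv]
    apply Real.log_le_log two_pos
    rw [le_inv_comm₀ two_pos hd]
    linarith
  have e4 : (C₁ + C₃) * |x - x'| ≤
      (C₁ + C₃) / Real.log 2 * (|x - x'| * |Real.log (|x - x'|)|) := by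
    rw [div_mul_eq_mul_div, le_div_iff₀ hl2, mul_assoc]
    gcongr
  rw [Real.rpow_one]
  refine (add_le_add e1 ((norm_add_le _ _).trans (add_le_add e2 e3))).trans ?_
  nlinarith

theorem memCk_fracLimit (h : IsFourierExpansion m κ a c H) {α : ℝ} (hα : a < α)
    (hj : ∀ j : ℤ, α - a ≠ j) :
    MemCk ⌊α - a⌋₊ (Int.fract (α - a)) (fracLimit m α H) Set.univ := by
  set k := ⌊α - a⌋₊ with hk
  have hk' : ((k : ℕ) : ℝ) = ⌊α - a⌋ := by
    rw [hk]
    exact natCast_floor_eq_intCast_floor (by linarith)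
  have hfr : Int.fract (α - a) = α - k - a := by
    rw [Int.fract, hk']; ring
  have hfr0 : 0 < Int.fract (α - a) := by
    refine lt_of_le_of_ne (Int.fract_nonneg _) fun h0 => ?_
    obtain ⟨j, hj'⟩ := Int.fract_eq_zero_iff.mp h0.symm
    exact hj j hj'.symm
  have hαk : a < α - k := by linarith
  refine ⟨(h.continuous_fracLimit hα).continuousOn, h.hasDerivsOn_fracLimit k hαk,
    fun K _ _ => ?_⟩
  rw [h.iteratedDeriv_fracLimit k hαk]
  refine ⟨(continuous_const.mul (h.continuous_fracLimit hαk)).continuousOn, ?_⟩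
  obtain ⟨C, hC⟩ := h.holder_fracLimit hαk (by rw [← hfr]; exact Int.fract_lt_one _)
  refine ⟨‖(2 * Real.pi * Complex.I / m : ℂ) ^ k‖ * C, fun x _ y _ => ?_⟩
  rw [← mul_sub, norm_mul, mul_assoc ‖_‖, hfr]
  exact mul_le_mul_of_nonneg_left (hC x y) (by positivity)

theorem memCkLog_fracLimit (h : IsFourierExpansion m κ a c H) {α : ℝ} {k : ℕ}
    (hk : α - a = (k : ℝ) + 1) :
    MemCkLog k 1 (fracLimit m α H) Set.univ := by
  have hk0 : (0 : ℝ) ≤ k := Nat.cast_nonneg k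
  have hα : a < α := by linarith
  have hαk : a < α - k := by linarith
  refine ⟨(h.continuous_fracLimit hα).continuousOn, h.hasDerivsOn_fracLimit k hαk,
    fun K _ _ => ?_⟩
  rw [h.iteratedDeriv_fracLimit k hαk]
  refine ⟨(continuous_const.mul (h.continuous_fracLimit hαk)).continuousOn, ?_⟩
  obtain ⟨C, hC⟩ := h.holder_log_fracLimit (α := α - k) (by linarith)
  refine ⟨‖(2 * Real.pi * Complex.I / m : ℂ) ^ k‖ * C, fun x _ y _ hxy => ?_⟩
  rw [← mul_sub, norm_mul, mul_assoc ‖_‖]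
  exact mul_le_mul_of_nonneg_left (hC x y hxy) (by positivity)

end IsFourierExpansion

end FracInt


/-! ### Convergence of the series at a point forces decay on the vertical line. -/

namespace FracInt

/-- An Abelian theorem: a convergent series, weighted by samples at a fine mesh of a function of
bounded variation vanishing at `0`, has small sum. -/
lemma tendsto_weighted_sum_zero {b : ℕ → ℂ} {l : ℂ}
    (hb : Tendsto (fun N => ∑ n ∈ Finset.range N, b n) atTop (𝓝 l))
    {lam : ℕ → ℝ} (hlam0 : ∀ n, 0 ≤ lam n) (hlam : Monotone lam)
    {φ Ψ : ℝ → ℝ} {M : ℝ} (hφ : φ 0 = 0)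
    (hφΨ : ∀ s t, 0 ≤ s → s ≤ t → |φ t - φ s| ≤ Ψ t - Ψ s)
    (hΨM : ∀ t, 0 ≤ t → Ψ t - Ψ 0 ≤ M) (hΨ : Continuous Ψ)
    {S : ℝ → ℂ} (hS : ∀ y, 0 < y → HasSum (fun n => b n * (φ (lam n * y) : ℂ)) (S y)) :
    Tendsto S (𝓝[>] 0) (𝓝 0) := by
  set D : ℕ → ℂ := fun N => ∑ n ∈ Finset.range N, b n - l with hD
  have hD0 : Tendsto D atTop (𝓝 0) := by simpa using hb.sub_const l
  obtain ⟨K, hK⟩ : ∃ K, ∀ N, ‖D N‖ ≤ K := by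
    obtain ⟨K, hK⟩ := hD0.norm.bddAbove_range
    exact ⟨K, fun N => hK ⟨N, rfl⟩⟩
  have hK0 : 0 ≤ K := (norm_nonneg _).trans (hK 0)
  have hM0 : 0 ≤ M := by simpa using hΨM 0 le_rfl
  -- Summation by parts, with the partial sums centred at their limit so that D tends to 0.
  have hparts : ∀ (p : ℕ → ℂ) (N : ℕ), ∑ n ∈ Finset.range N, b n * p n =
      D N * p N - D 0 * p 0 - ∑ n ∈ Finset.range N, D (n + 1) * (p (n + 1) - p n) := by
    intro p N
    induction N with
    | zero => simp
    | succ N ih =>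
      rw [Finset.sum_range_succ, ih, Finset.sum_range_succ]
      have : D (N + 1) = D N + b N := by
        simp only [hD, Finset.sum_range_succ]
        ring
      rw [this]
      ring
  have hφb : ∀ t, 0 ≤ t → |φ t| ≤ Ψ t - Ψ 0 := fun t ht => by
    simpa [hφ] using hφΨ 0 t le_rfl ht
  rw [Metric.tendsto_nhds]
  intro ε hε
  set η := ε / (2 * (M + 1)) with hη
  have hη0 : 0 < η := by positivity
  obtain ⟨P, hP⟩ : ∃ P, ∀ n, P ≤ n → ‖D n‖ ≤ η := by
    have := (Metric.tendsto_atTop.mp hD0) η hη0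
    obtain ⟨P, hP⟩ := this
    exact ⟨P, fun n hn => by simpa using (hP n hn).le⟩
  have hsmall : Tendsto (fun y : ℝ => K * (Ψ (lam 0 * y) - Ψ 0) +
      (η * M + K * (Ψ (lam P * y) - Ψ 0))) (𝓝[>] 0) (𝓝 (η * M)) := by
    have : Continuous (fun y : ℝ => K * (Ψ (lam 0 * y) - Ψ 0) +
      (η * M + K * (Ψ (lam P * y) - Ψ 0))) := by fun_prop
    have h0 := (this.tendsto 0).mono_left (nhdsWithin_le_nhds (s := Set.Ioi 0))
    simpa using h0
  have hlt : η * M < ε := by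
    rw [hη, div_mul_eq_mul_div, div_lt_iff₀ (by positivity)]
    nlinarith
  filter_upwards [hsmall.eventually (gt_mem_nhds hlt), self_mem_nhdsWithin] with y hy hy0
  have hy0 : 0 < y := hy0
  rw [dist_zero_right]
  refine lt_of_le_of_lt ?_ hy
  have ht0 : ∀ n, 0 ≤ lam n * y := fun n => mul_nonneg (hlam0 n) hy0.le
  have htm : ∀ n k, n ≤ k → lam n * y ≤ lam k * y := fun n k hnk =>
    mul_le_mul_of_nonneg_right (hlam hnk) hy0.le
  have hΨmono : ∀ n k, n ≤ k → Ψ (lam n * y) ≤ Ψ (lam k * y) := fun n k hnk => by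
    have := (abs_nonneg _).trans (hφΨ _ _ (ht0 n) (htm n k hnk))
    linarith
  have hbound : ∀ N, ‖∑ n ∈ Finset.range N, b n * (φ (lam n * y) : ℂ)‖ ≤
      ‖D N‖ * M + (K * (Ψ (lam 0 * y) - Ψ 0) + (η * M + K * (Ψ (lam P * y) - Ψ 0))) := by
    intro N
    -- Ψ plays the role of the variation of φ. From index P on, D is at most η and the total
    -- variation is at most M. Before P, D is only bounded by K, but the samples lie in [0, lam P *
    -- y], where the variation tends to 0 with y. The truncation min n P stops the second
    -- telescoping sum at P.
    have hterm : ∀ n, ‖D (n + 1) * ((φ (lam (n + 1) * y) : ℂ) - (φ (lam n * y) : ℂ))‖ ≤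
        η * (Ψ (lam (n + 1) * y) - Ψ (lam n * y)) +
          K * (Ψ (lam (min (n + 1) P) * y) - Ψ (lam (min n P) * y)) := by
      intro n
      have e1 := hφΨ _ _ (ht0 n) (htm n (n + 1) n.le_succ)
      have e2 : 0 ≤ Ψ (lam (n + 1) * y) - Ψ (lam n * y) := (abs_nonneg _).trans e1
      rw [norm_mul, ← Complex.ofReal_sub, Complex.norm_real, Real.norm_eq_abs]
      rcases le_or_gt P n with hn | hn
      · rw [min_eq_right hn, min_eq_right (hn.trans n.le_succ), sub_self, mul_zero, add_zero]
        exact mul_le_mul (hP _ (hn.trans n.le_succ)) e1 (abs_nonneg _) hη0.le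
      · rw [min_eq_left hn.le, min_eq_left (Nat.succ_le_of_lt hn)]
        have := mul_le_mul (hK (n + 1)) e1 (abs_nonneg _) hK0
        have := mul_nonneg hη0.le e2
        linarith
    have hsum : ‖∑ n ∈ Finset.range N, D (n + 1) *
        ((φ (lam (n + 1) * y) : ℂ) - (φ (lam n * y) : ℂ))‖ ≤
        η * M + K * (Ψ (lam P * y) - Ψ 0) := by
      refine (norm_sum_le_of_le _ fun n _ => hterm n).trans ?_
      rw [Finset.sum_add_distrib, ← Finset.mul_sum, ← Finset.mul_sum,
        Finset.sum_range_sub (fun n => Ψ (lam n * y)),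
        Finset.sum_range_sub (fun n => Ψ (lam (min n P) * y))]
      have e1 := hΨM _ (ht0 N)
      have e2 := (abs_nonneg _).trans (hφb _ (ht0 0))
      have e3 := hΨmono (min N P) P (min_le_right _ _)
      have e4 : Ψ 0 ≤ Ψ (lam (min 0 P) * y) := by
        rw [Nat.zero_min]
        linarith
      gcongr
      linarith
    rw [hparts]
    refine (norm_sub_le _ _).trans ?_
    have e1 : ‖D N * (φ (lam N * y) : ℂ) - D 0 * (φ (lam 0 * y) : ℂ)‖ ≤
        ‖D N‖ * M + K * (Ψ (lam 0 * y) - Ψ 0) := by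
      refine (norm_sub_le _ _).trans ?_
      rw [norm_mul, norm_mul, Complex.norm_real, Complex.norm_real, Real.norm_eq_abs,
        Real.norm_eq_abs]
      gcongr
      · exact (hφb _ (ht0 N)).trans (hΨM _ (ht0 N))
      · exact hK 0
      · exact hφb _ (ht0 0)
    linarith
  have hl := (hS y hy0).tendsto_sum_nat.norm
  refine le_of_tendsto_of_tendsto' hl (a₂ := K * (Ψ (lam 0 * y) - Ψ 0) +
    (η * M + K * (Ψ (lam P * y) - Ψ 0))) ?_ hbound
  have := (hD0.norm.mul_const M).add_const
    (K * (Ψ (lam 0 * y) - Ψ 0) + (η * M + K * (Ψ (lam P * y) - Ψ 0)))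
  simpa using this

/-- The function `t ^ α * e ^ (-t)`. -/
noncomputable def gammaWeight (α t : ℝ) : ℝ := t ^ α * Real.exp (-t)

lemma continuous_gammaWeight {α : ℝ} (hα : 0 < α) : Continuous (gammaWeight α) :=
  (Real.continuous_rpow_const hα.le).mul (by fun_prop)

lemma hasDerivAt_gammaWeight {α t : ℝ} (ht : 0 < t) :
    HasDerivAt (gammaWeight α) (t ^ (α - 1) * Real.exp (-t) * (α - t)) t := by
  have h1 := (Real.hasDerivAt_rpow_const (p := α) (Or.inl ht.ne')).mul ((hasDerivAt_neg t).exp)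
  refine h1.congr_deriv ?_
  have : t ^ α = t ^ (α - 1) * t := by rw [Real.rpow_sub_one ht.ne']; field_simp
  rw [this]
  ring

lemma monotoneOn_gammaWeight {α : ℝ} (hα : 0 < α) :
    MonotoneOn (gammaWeight α) (Set.Icc 0 α) := by
  refine monotoneOn_of_deriv_nonneg (convex_Icc 0 α) (continuous_gammaWeight hα).continuousOn
    (fun t ht => ?_) fun t ht => ?_
  · rw [interior_Icc] at ht
    exact (hasDerivAt_gammaWeight ht.1).differentiableAt.differentiableWithinAt
  · rw [interior_Icc] at ht
    rw [(hasDerivAt_gammaWeight ht.1).deriv]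
    have h1 : 0 < t := ht.1
    have h2 : 0 ≤ α - t := by linarith [ht.2]
    positivity

lemma antitoneOn_gammaWeight {α : ℝ} (hα : 0 < α) :
    AntitoneOn (gammaWeight α) (Set.Ici α) := by
  refine antitoneOn_of_deriv_nonpos (convex_Ici α) (continuous_gammaWeight hα).continuousOn
    (fun t ht => ?_) fun t ht => ?_
  · rw [interior_Ici] at ht
    exact (hasDerivAt_gammaWeight (hα.trans ht)).differentiableAt.differentiableWithinAt
  · rw [interior_Ici] at ht
    have h1 : 0 < t := hα.trans ht
    rw [(hasDerivAt_gammaWeight h1).deriv]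
    have h2 : 0 ≤ t - α := (sub_pos.mpr ht).le
    have : 0 ≤ t ^ (α - 1) * Real.exp (-t) * (t - α) := by positivity
    linarith

namespace IsFourierExpansion

variable {m κ a : ℝ} {c : ℕ → ℂ} {H : ℂ → ℂ}

/-- The expansion of `H` in terms of the coefficients of the fractional integral. -/
lemma hasSum_gammaWeight (h : IsFourierExpansion m κ a c H) (α x : ℝ) {y : ℝ} (hy : 0 < y) :
    HasSum (fun n : ℕ => c n / ((((n : ℝ) + κ) ^ α : ℝ) : ℂ) * expMode m κ n x *
      (gammaWeight α (2 * Real.pi / m * (n + κ) * y) : ℂ))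
      ((((2 * Real.pi / m) ^ α * y ^ α : ℝ) : ℂ) * H (x + y * Complex.I)) := by
  have hm := h.m_pos
  have hpi := Real.pi_pos
  set ω : ℝ := 2 * Real.pi / m with hω
  have hω0 : 0 < ω := by positivity
  have hs := (h.hasSum (x + y * Complex.I) (by simpa using hy)).mul_left
    ((ω ^ α * y ^ α : ℝ) : ℂ)
  refine hs.congr_fun fun n => ?_
  by_cases hn : 0 < (n : ℝ) + κ
  · have e0 : expMode m κ n (y * Complex.I) = ((Real.exp (-(ω * (n + κ) * y)) : ℝ) : ℂ) := by
      rw [expMode, Complex.ofReal_exp]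
      congr 1
      rw [hω]
      push_cast
      linear_combination (2 * Real.pi * (n + κ) / m * y) * Complex.I_sq
    have e1 : gammaWeight α (ω * (n + κ) * y) = ω ^ α * y ^ α * (n + κ) ^ α *
        Real.exp (-(ω * (n + κ) * y)) := by
      simp only [gammaWeight]
      rw [Real.mul_rpow (by positivity) hy.le, Real.mul_rpow hω0.le hn.le]
      ring
    have e2 : ((((n : ℝ) + κ) ^ α : ℝ) : ℂ) ≠ 0 := by
      exact_mod_cast (Real.rpow_pos_of_pos hn _).ne'
    rw [e1, expMode_add, e0]
    rw [Complex.ofReal_mul (_ * _), Complex.ofReal_mul (_ * _)]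
    field_simp
  · simp [h.coeff_eq_zero n hn]

/-- If the series defining the fractional integral converges at `x`, then `y ^ α * H (x + iy)`
tends to zero as `y → 0⁺`. -/
theorem tendsto_of_tendsto_fracPartial (h : IsFourierExpansion m κ a c H) {α : ℝ} (hα : 0 < α)
    {x : ℝ} {l : ℂ} (hl : Tendsto (fun N => fracPartial m κ α c N x) atTop (𝓝 l)) :
    Tendsto (fun y : ℝ => y ^ α * ‖H (x + y * Complex.I)‖) (𝓝[>] 0) (𝓝 0) := by
  have hm := h.m_pos
  have hpi := Real.pi_pos
  have hκ := h.κ_nonneg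
  set ω : ℝ := 2 * Real.pi / m with hω
  have hω0 : 0 < ω := by positivity
  set φ := gammaWeight α with hφ
  have hφ0 : φ 0 = 0 := by simp [hφ, gammaWeight, hα.ne']
  have hφnn : ∀ t, 0 ≤ t → 0 ≤ φ t := fun t ht => by
    simp only [hφ, gammaWeight]
    positivity
  have hmono := monotoneOn_gammaWeight hα
  have hanti := antitoneOn_gammaWeight hα
  -- φ increases on [0, α] and decreases afterwards, so up to an additive constant this is its
  -- variation function, with total variation at most 2φ(α).
  set Ψ : ℝ → ℝ := fun t => φ (min t α) - φ (max t α) with hΨ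
  have key : Tendsto (fun y : ℝ => ((ω ^ α * y ^ α : ℝ) : ℂ) * H (x + y * Complex.I))
      (𝓝[>] 0) (𝓝 0) := by
    refine tendsto_weighted_sum_zero (lam := fun n => ω * (n + κ)) (φ := φ) (Ψ := Ψ)
      (M := 2 * φ α) hl (fun n => by positivity) ?_ hφ0 ?_ ?_ ?_ ?_
    · intro n k hnk
      have : (n : ℝ) ≤ k := by exact_mod_cast hnk
      simp only
      gcongr
    · intro s t hs hst
      have e : ∀ u, φ u = φ (min u α) + φ (max u α) - φ α := by
        intro u
        rcases le_total u α with hu | hu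
        · rw [min_eq_left hu, max_eq_right hu]; ring
        · rw [min_eq_right hu, max_eq_left hu]; ring
      have e1 : φ (min s α) ≤ φ (min t α) :=
        hmono ⟨le_min hs hα.le, min_le_right _ _⟩ ⟨le_min (hs.trans hst) hα.le, min_le_right _ _⟩
          (min_le_min_right α hst)
      have e2 : φ (max t α) ≤ φ (max s α) :=
        hanti (le_max_right _ _ : α ≤ max s α) (le_max_right _ _ : α ≤ max t α)
          (max_le_max_right α hst)
      rw [e t, e s, abs_le]
      constructor <;> simp only [hΨ] <;> linarith
    · intro t ht
      have e1 : φ (min t α) ≤ φ α :=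
        hmono ⟨le_min ht hα.le, min_le_right _ _⟩ ⟨hα.le, le_rfl⟩ (min_le_right _ _)
      have e2 := hφnn (max t α) (ht.trans (le_max_left _ _))
      simp only [hΨ, min_eq_left hα.le, max_eq_right hα.le, hφ0]
      linarith
    · have := continuous_gammaWeight hα
      fun_prop
    · intro y hy
      exact h.hasSum_gammaWeight α x hy
  have h2 := key.norm.const_mul (ω ^ α)⁻¹
  simp only [norm_zero, mul_zero] at h2
  refine h2.congr' ?_
  filter_upwards [self_mem_nhdsWithin] with y hy
  have hy : 0 < y := hy
  rw [norm_mul, Complex.norm_real, Real.norm_of_nonneg (by positivity)]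
  field_simp

end IsFourierExpansion

end FracInt


namespace FracInt

/-! ### The Laplace kernel of the power weight and its Fourier inversion -/

lemma integrableOn_gammaWeight_mul_exp {α s : ℝ} (hα : 0 < α) (hs : s < 1) :
    MeasureTheory.IntegrableOn (fun t : ℝ => gammaWeight α t * Real.exp (s * t)) (Set.Ioi 0) := by
  refine (integrableOn_rpow_mul_exp_neg_mul (s := α + 1) (b := 1 - s) (by linarith)
    (by linarith)).congr (Eventually.of_forall fun t => ?_)
  simp only [gammaWeight, add_sub_cancel_right]
  rw [mul_assoc, ← Real.exp_add]
  ring_nf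

/-- For real z < 1 this is Euler's Gamma integral. Both sides are analytic on Re z < 1, so the
identity theorem extends it. -/
lemma integral_gammaWeight_mul_cexp {α : ℝ} (hα : 0 < α) {z : ℂ} (hz : z.re < 1) :
    ∫ t in Set.Ioi (0 : ℝ), (gammaWeight α t : ℂ) * Complex.exp (z * t) =
      Real.Gamma (α + 1) * (1 - z) ^ (-(α + 1) : ℂ) := by
  -- Seen as the moment generating function of the measure with density φ, the left side is analytic
  -- inside its domain of convergence.
  set ν : MeasureTheory.Measure ℝ :=
    (MeasureTheory.volume.restrict (Set.Ioi 0)).withDensity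
      (fun t => ((gammaWeight α t).toNNReal : ENNReal)) with hν
  have hmeas : Measurable fun t => (gammaWeight α t).toNNReal :=
    (continuous_gammaWeight hα).measurable.real_toNNReal
  have hnn : ∀ t ∈ Set.Ioi (0 : ℝ), ((gammaWeight α t).toNNReal : ℝ) = gammaWeight α t := by
    intro t ht
    have ht : 0 < t := ht
    rw [Real.coe_toNNReal]
    simp only [gammaWeight]
    positivity
  have hset : Set.Iio (1 : ℝ) ⊆ ProbabilityTheory.integrableExpSet id ν := by
    intro s hs
    rw [ProbabilityTheory.integrableExpSet, Set.mem_ofPred_eq, hν,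
      MeasureTheory.integrable_withDensity_iff_integrable_smul hmeas]
    refine MeasureTheory.IntegrableOn.congr_fun (integrableOn_gammaWeight_mul_exp hα hs)
      (fun t ht => ?_) measurableSet_Ioi
    simp only [id, NNReal.smul_def, smul_eq_mul]
    rw [hnn t ht]
  have hcm : ∀ w : ℂ, ProbabilityTheory.complexMGF id ν w =
      ∫ t in Set.Ioi (0 : ℝ), (gammaWeight α t : ℂ) * Complex.exp (w * t) := by
    intro w
    rw [ProbabilityTheory.complexMGF, hν, integral_withDensity_eq_integral_smul hmeas]
    refine MeasureTheory.setIntegral_congr_fun measurableSet_Ioi fun t ht => ?_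
    simp only [id, NNReal.smul_def, Complex.real_smul]
    rw [hnn t ht]
  have hsub : {w : ℂ | w.re < 1} ⊆
      {w : ℂ | w.re ∈ interior (ProbabilityTheory.integrableExpSet id ν)} := fun w hw =>
    interior_maximal hset isOpen_Iio hw
  have hA : AnalyticOnNhd ℂ (ProbabilityTheory.complexMGF id ν) {w : ℂ | w.re < 1} :=
    ProbabilityTheory.analyticOnNhd_complexMGF.mono hsub
  have hopen : IsOpen {w : ℂ | w.re < 1} := isOpen_lt Complex.continuous_re continuous_const
  have hB : AnalyticOnNhd ℂ (fun w : ℂ => Real.Gamma (α + 1) * (1 - w) ^ (-(α + 1) : ℂ))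
      {w : ℂ | w.re < 1} := by
    refine DifferentiableOn.analyticOnNhd (fun w hw => ?_) hopen
    have hw : w.re < 1 := hw
    refine DifferentiableAt.differentiableWithinAt ?_
    refine (DifferentiableAt.cpow_const (by fun_prop) ?_).const_mul _
    left
    simpa using hw
  have hconn : IsPreconnected {w : ℂ | w.re < 1} := (convex_halfSpace_re_lt 1).isPreconnected
  have hreal : ∀ s : ℝ, s < 1 → ProbabilityTheory.complexMGF id ν s =
      Real.Gamma (α + 1) * (1 - (s : ℂ)) ^ (-(α + 1) : ℂ) := by
    intro s hs
    have h1 : 0 < 1 - s := by linarith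
    have e : ∀ t : ℝ, (gammaWeight α t : ℂ) * Complex.exp (s * t) =
        ((t ^ (α + 1 - 1) * Real.exp (-((1 - s) * t)) : ℝ) : ℂ) := by
      intro t
      rw [← Complex.ofReal_mul, ← Complex.ofReal_exp, ← Complex.ofReal_mul, gammaWeight,
        mul_assoc, ← Real.exp_add]
      ring_nf
    rw [hcm]
    simp_rw [e]
    rw [integral_complex_ofReal,
      Real.integral_rpow_mul_exp_neg_mul_Ioi (by linarith : 0 < α + 1) h1, one_div,
      Real.inv_rpow h1.le, ← Real.rpow_neg h1.le, Complex.ofReal_mul,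
      Complex.ofReal_cpow h1.le, mul_comm]
    push_cast
    rfl
  have hfreq : ∃ᶠ w in 𝓝[≠] (0 : ℂ), ProbabilityTheory.complexMGF id ν w =
      Real.Gamma (α + 1) * (1 - w) ^ (-(α + 1) : ℂ) := by
    have ht : Tendsto (fun s : ℝ => (s : ℂ)) (𝓝[≠] 0) (𝓝[≠] 0) := by
      refine tendsto_nhdsWithin_iff.mpr ⟨?_, ?_⟩
      · exact (Complex.continuous_ofReal.tendsto' 0 0 (by simp)).mono_left nhdsWithin_le_nhds
      · filter_upwards [self_mem_nhdsWithin] with s hs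
        simpa using hs
    refine ht.frequently (Eventually.frequently ?_)
    filter_upwards [nhdsWithin_le_nhds (Iio_mem_nhds (zero_lt_one' ℝ))] with s hs
    exact hreal s hs
  rw [← hcm]
  exact hA.eqOn_of_preconnected_of_frequently_eq hB hconn (by simp) hfreq hz

/-- The weight `t ^ α * e ^ (-t)` on the positive half-line, extended by zero. -/
noncomputable def gammaCut (α t : ℝ) : ℂ := ((gammaWeight α (max t 0) : ℝ) : ℂ)

lemma gammaCut_of_nonpos {α t : ℝ} (hα : 0 < α) (ht : t ≤ 0) : gammaCut α t = 0 := by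
  simp [gammaCut, gammaWeight, max_eq_right ht, hα.ne']

lemma gammaCut_of_nonneg {α t : ℝ} (ht : 0 ≤ t) : gammaCut α t = gammaWeight α t := by
  rw [gammaCut, max_eq_left ht]

lemma continuous_gammaCut {α : ℝ} (hα : 0 < α) : Continuous (gammaCut α) :=
  Complex.continuous_ofReal.comp
    ((continuous_gammaWeight hα).comp (continuous_id.max continuous_const))

lemma gammaCut_eq_indicator {α : ℝ} (hα : 0 < α) :
    gammaCut α = (Set.Ioi 0).indicator fun t => (gammaWeight α t : ℂ) := by
  ext t
  rcases le_or_gt t 0 with ht | ht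
  · rw [gammaCut_of_nonpos hα ht, Set.indicator_of_notMem (by simpa using ht)]
  · rw [gammaCut_of_nonneg ht.le, Set.indicator_of_mem (by simpa using ht)]

lemma integrable_gammaCut {α : ℝ} (hα : 0 < α) : MeasureTheory.Integrable (gammaCut α) := by
  rw [gammaCut_eq_indicator hα, MeasureTheory.integrable_indicator_iff measurableSet_Ioi]
  have := integrableOn_gammaWeight_mul_exp hα (zero_lt_one' ℝ)
  simpa using! this.ofReal (𝕜 := ℂ)

/-- The Fourier transform of `gammaCut`. -/
noncomputable def gammaKernel (α w : ℝ) : ℂ :=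
  Real.Gamma (α + 1) * (1 + 2 * Real.pi * w * Complex.I) ^ (-(α + 1) : ℂ)

lemma gammaKernel_base_re (w : ℝ) : (1 + 2 * Real.pi * w * Complex.I).re = 1 := by
  simp

lemma fourier_gammaCut {α : ℝ} (hα : 0 < α) :
    FourierTransform.fourier (gammaCut α) = gammaKernel α := by
  ext w
  rw [Real.fourier_real_eq_integral_exp_smul, gammaCut_eq_indicator hα]
  have e : (fun v : ℝ => Complex.exp (((-2 * Real.pi * v * w : ℝ) : ℂ) * Complex.I) •
      (Set.Ioi (0 : ℝ)).indicator (fun t => (gammaWeight α t : ℂ)) v) =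
      (Set.Ioi (0 : ℝ)).indicator fun v => (gammaWeight α v : ℂ) *
        Complex.exp (-(2 * Real.pi * w * Complex.I) * v) := by
    ext v
    by_cases hv : v ∈ Set.Ioi (0 : ℝ)
    · rw [Set.indicator_of_mem hv, Set.indicator_of_mem hv, smul_eq_mul, mul_comm]
      congr 2
      push_cast
      ring
    · rw [Set.indicator_of_notMem hv, Set.indicator_of_notMem hv, smul_zero]
  rw [e, MeasureTheory.integral_indicator measurableSet_Ioi,
    integral_gammaWeight_mul_cexp hα (by simp), gammaKernel]
  simp

lemma continuous_gammaKernel (α : ℝ) : Continuous (gammaKernel α) := by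
  unfold gammaKernel
  refine continuous_const.mul (Continuous.cpow (by fun_prop) continuous_const fun w => ?_)
  left
  rw [gammaKernel_base_re]
  exact one_pos

lemma norm_gammaKernel_le {α : ℝ} (hα : 0 < α) (w : ℝ) :
    ‖gammaKernel α w‖ ≤ Real.Gamma (α + 1) * (1 + ‖w‖ ^ 2) ^ (-(α + 1) / 2) := by
  have hne : (1 + 2 * Real.pi * w * Complex.I) ≠ 0 := by
    intro h0
    have := gammaKernel_base_re w
    rw [h0] at this
    simp at this
  have hΓ := Real.Gamma_pos_of_pos (by linarith : 0 < α + 1)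
  have e : ‖(1 + 2 * Real.pi * w * Complex.I) ^ (-(α + 1) : ℂ)‖ =
      ‖(1 + 2 * Real.pi * w * Complex.I)‖ ^ (-(α + 1)) := by
    have := Complex.norm_cpow_of_ne_zero hne (-(α + 1) : ℂ)
    rw [this]
    simp
  rw [gammaKernel, norm_mul, e, Complex.norm_real, Real.norm_of_nonneg hΓ.le]
  refine mul_le_mul_of_nonneg_left ?_ hΓ.le
  have h1 : (1 + ‖w‖ ^ 2) ^ ((1 : ℝ) / 2) ≤ ‖(1 + 2 * Real.pi * w * Complex.I)‖ := by
    rw [← Real.sqrt_eq_rpow, Complex.norm_eq_sqrt_sq_add_sq]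
    apply Real.sqrt_le_sqrt
    have h3 : (3 : ℝ) < Real.pi := Real.pi_gt_three
    have h2 : 1 ≤ (2 * Real.pi) ^ 2 := by nlinarith
    have : w ^ 2 ≤ (2 * Real.pi * w) ^ 2 := by
      rw [mul_pow]
      nlinarith [sq_nonneg w]
    simp
    linarith
  calc ‖(1 + 2 * Real.pi * w * Complex.I)‖ ^ (-(α + 1))
      ≤ ((1 + ‖w‖ ^ 2) ^ ((1 : ℝ) / 2)) ^ (-(α + 1)) :=
        Real.rpow_le_rpow_of_nonpos (by positivity) h1 (by linarith)
    _ = _ := by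
        rw [← Real.rpow_mul (by positivity)]
        congr 1
        ring

/-- The kernel is O(|w|^(-α-1)) at infinity, so its absolute moments of order below α are finite.
They supply the dominating function in the scaling limit. -/
lemma integrable_rpow_mul_gammaKernel {α β : ℝ} (hα : 0 < α) (hβ : 0 ≤ β) (hβα : β < α) :
    MeasureTheory.Integrable fun w : ℝ => |w| ^ β * ‖gammaKernel α w‖ := by
  have h1 : MeasureTheory.Integrable fun w : ℝ => (1 + ‖w‖ ^ 2) ^ (-(α - β + 1) / 2) :=
    integrable_rpow_neg_one_add_norm_sq (by simpa using hβα)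
  refine (h1.const_mul (Real.Gamma (α + 1))).mono' ?_ (Eventually.of_forall fun w => ?_)
  · refine Continuous.aestronglyMeasurable ?_
    exact ((Real.continuous_rpow_const hβ).comp continuous_abs).mul (continuous_gammaKernel α).norm
  · have hΓ := Real.Gamma_pos_of_pos (by linarith : 0 < α + 1)
    rw [Real.norm_of_nonneg (by positivity)]
    have h2 : |w| ^ β ≤ (1 + ‖w‖ ^ 2) ^ (β / 2) := by
      calc |w| ^ β = (‖w‖ ^ 2) ^ (β / 2) := by
            rw [← Real.rpow_natCast, ← Real.rpow_mul (norm_nonneg _), Real.norm_eq_abs]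
            congr 1
            push_cast
            ring
        _ ≤ _ := Real.rpow_le_rpow (by positivity) (by linarith) (by linarith)
    calc |w| ^ β * ‖gammaKernel α w‖
        ≤ (1 + ‖w‖ ^ 2) ^ (β / 2) * (Real.Gamma (α + 1) * (1 + ‖w‖ ^ 2) ^ (-(α + 1) / 2)) := by
          gcongr
          exact norm_gammaKernel_le hα w
      _ = Real.Gamma (α + 1) * ((1 + ‖w‖ ^ 2) ^ (β / 2) * (1 + ‖w‖ ^ 2) ^ (-(α + 1) / 2)) := by
          ring
      _ = _ := by
          rw [← Real.rpow_add (by positivity)]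
          congr 2
          ring

lemma integrable_gammaKernel {α : ℝ} (hα : 0 < α) :
    MeasureTheory.Integrable (gammaKernel α) := by
  have := integrable_rpow_mul_gammaKernel hα le_rfl hα
  simp only [Real.rpow_zero, one_mul] at this
  exact (MeasureTheory.integrable_norm_iff (continuous_gammaKernel α).aestronglyMeasurable).mp this

/-- Fourier inversion. Since `gammaCut` vanishes for v ≤ 0, the kernel annihilates constants and all
negative frequencies. -/
lemma integral_exp_mul_gammaKernel {α : ℝ} (hα : 0 < α) (v : ℝ) :
    ∫ w : ℝ, Complex.exp ((2 * Real.pi * v * w : ℝ) * Complex.I) * gammaKernel α w =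
      gammaCut α v := by
  have h1 := (continuous_gammaCut hα).fourierInv_fourier_eq (integrable_gammaCut hα) (by
    rw [fourier_gammaCut hα]
    exact integrable_gammaKernel hα)
  rw [fourier_gammaCut hα] at h1
  have h2 := congrFun h1 v
  rw [Real.fourierInv_eq'] at h2
  rw [← h2]
  refine MeasureTheory.integral_congr_ae (Eventually.of_forall fun w => ?_)
  simp only [smul_eq_mul, RCLike.inner_apply, conj_trivial]
  ring_nf

end FracInt


/-! ### Differentiability at a point forces decay on the vertical line. -/

namespace FracInt

/-- A function differentiable at `x₀` with bounded values, after subtraction of a suitable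
trigonometric polynomial, is dominated by powers at `x₀`. -/
lemma exists_le_rpow_of_isLittleO {V : ℝ → ℂ} {M β : ℝ} (hV : ∀ v, ‖V v‖ ≤ M)
    (hV0 : V =o[𝓝 0] fun v : ℝ => v) (hβ0 : 0 < β) (hβ1 : β ≤ 1) :
    (∃ C, 0 ≤ C ∧ ∀ v, ‖V v‖ ≤ C * |v| ^ β) ∧
      Tendsto (fun v => ‖V v‖ / |v| ^ β) (𝓝 0) (𝓝 0) := by
  have hM : 0 ≤ M := (norm_nonneg _).trans (hV 0)
  have hle : ∀ v : ℝ, |v| ≤ 1 → |v| ≤ |v| ^ β := by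
    intro v hv
    rcases eq_or_ne v 0 with rfl | hv0
    · simp [hβ0.ne']
    · have := Real.rpow_le_rpow_of_exponent_ge (abs_pos.mpr hv0) hv hβ1
      rwa [Real.rpow_one] at this
  have hev : ∀ ε : ℝ, 0 < ε → ∀ᶠ v in 𝓝 (0 : ℝ), ‖V v‖ ≤ ε * |v| ^ β := by
    intro ε hε
    filter_upwards [hV0.bound hε, Metric.ball_mem_nhds (0 : ℝ) one_pos] with v h1 h2
    rw [mem_ball_zero_iff, Real.norm_eq_abs] at h2
    refine h1.trans ?_
    rw [Real.norm_eq_abs]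
    gcongr
    exact hle v h2.le
  constructor
  · obtain ⟨δ, hδ, hball⟩ := Metric.eventually_nhds_iff.mp (hev 1 one_pos)
    refine ⟨1 + M * (δ ^ β)⁻¹, by positivity, fun v => ?_⟩
    have hvβ : 0 ≤ |v| ^ β := by positivity
    rcases lt_or_ge |v| δ with hv | hv
    · refine (hball (by simpa using hv)).trans ?_
      gcongr
      have : 0 ≤ M * (δ ^ β)⁻¹ := by positivity
      linarith
    · have h1 : δ ^ β ≤ |v| ^ β := Real.rpow_le_rpow hδ.le hv hβ0.le
      have h2 : 1 ≤ (δ ^ β)⁻¹ * |v| ^ β := by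
        rw [← div_eq_inv_mul, le_div_iff₀ (by positivity), one_mul]
        exact h1
      calc ‖V v‖ ≤ M * 1 := by rw [mul_one]; exact hV v
        _ ≤ M * ((δ ^ β)⁻¹ * |v| ^ β) := by gcongr
        _ ≤ _ := by rw [← mul_assoc]; gcongr; linarith
  · rw [Metric.tendsto_nhds]
    intro ε hε
    filter_upwards [hev (ε / 2) (by positivity)] with v hv
    rw [dist_zero_right, Real.norm_of_nonneg (by positivity)]
    rcases eq_or_lt_of_le (by positivity : 0 ≤ |v| ^ β) with h0 | h0
    · rw [← h0]
      simpa using hε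
    · rw [div_lt_iff₀ h0]
      nlinarith

/-- Scaling limit of the transform of a function vanishing to first order. -/
lemma tendsto_rpow_mul_integral_gammaKernel {V : ℝ → ℂ} {M α β : ℝ} (hα : 0 < α)
    (hVc : Continuous V) (hV : ∀ v, ‖V v‖ ≤ M) (hV0 : V =o[𝓝 0] fun v : ℝ => v)
    (hβ0 : 0 < β) (hβ1 : β ≤ 1) (hβα : β < α) :
    Tendsto (fun y : ℝ => ((y ^ (-β) : ℝ) : ℂ) *
      ∫ w : ℝ, V (2 * Real.pi * y * w) * gammaKernel α w) (𝓝[>] 0) (𝓝 0) := by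
  obtain ⟨⟨C, hC0, hC⟩, hlim⟩ := exists_le_rpow_of_isLittleO hV hV0 hβ0 hβ1
  have hpi := Real.pi_pos
  simp_rw [← MeasureTheory.integral_const_mul]
  rw [show (0 : ℂ) = ∫ _ : ℝ, (0 : ℂ) by simp]
  refine MeasureTheory.tendsto_integral_filter_of_dominated_convergence
    (fun w => C * (2 * Real.pi) ^ β * (|w| ^ β * ‖gammaKernel α w‖)) ?_ ?_ ?_ ?_
  · refine Eventually.of_forall fun y => ?_
    refine Continuous.aestronglyMeasurable ?_
    exact continuous_const.mul ((hVc.comp (by fun_prop)).mul (continuous_gammaKernel α))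
  · filter_upwards [self_mem_nhdsWithin] with y hy
    have hy : 0 < y := hy
    refine Eventually.of_forall fun w => ?_
    rw [norm_mul, norm_mul, Complex.norm_real, Real.norm_of_nonneg (by positivity)]
    have e : |2 * Real.pi * y * w| ^ β = (2 * Real.pi) ^ β * y ^ β * |w| ^ β := by
      rw [abs_mul, abs_of_pos (by positivity : 0 < 2 * Real.pi * y),
        Real.mul_rpow (by positivity) (abs_nonneg _), Real.mul_rpow (by positivity) hy.le]
    calc y ^ (-β) * (‖V (2 * Real.pi * y * w)‖ * ‖gammaKernel α w‖)
        ≤ y ^ (-β) * ((C * ((2 * Real.pi) ^ β * y ^ β * |w| ^ β)) * ‖gammaKernel α w‖) := by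
          gcongr
          rw [← e]
          exact hC _
      _ = _ := by
          rw [Real.rpow_neg hy.le]
          have : y ^ β ≠ 0 := by positivity
          field_simp
  · exact (integrable_rpow_mul_gammaKernel hα hβ0.le hβα).const_mul _
  · refine Eventually.of_forall fun w => ?_
    rw [tendsto_zero_iff_norm_tendsto_zero]
    have h1 : Tendsto (fun y : ℝ => 2 * Real.pi * y * w) (𝓝[>] 0) (𝓝 0) := by
      have : Continuous fun y : ℝ => 2 * Real.pi * y * w := by fun_prop
      exact (this.tendsto' 0 0 (by simp)).mono_left nhdsWithin_le_nhds
    have h2 := (hlim.comp h1).mul_const ((2 * Real.pi) ^ β * |w| ^ β * ‖gammaKernel α w‖)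
    rw [zero_mul] at h2
    refine h2.congr' ?_
    filter_upwards [self_mem_nhdsWithin] with y hy
    have hy : 0 < y := hy
    rw [norm_mul, norm_mul, Complex.norm_real, Real.norm_of_nonneg (by positivity)]
    simp only [Function.comp]
    rcases eq_or_ne w 0 with rfl | hw
    · have : V 0 = 0 := by
        have := hC 0
        rw [abs_zero, Real.zero_rpow hβ0.ne', mul_zero] at this
        simpa using this
      simp [this]
    have e : |2 * Real.pi * y * w| ^ β = (2 * Real.pi) ^ β * y ^ β * |w| ^ β := by
      rw [abs_mul, abs_of_pos (by positivity : 0 < 2 * Real.pi * y),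
        Real.mul_rpow (by positivity) (abs_nonneg _), Real.mul_rpow (by positivity) hy.le]
    have hw' : 0 < |w| := abs_pos.mpr hw
    rw [e, Real.rpow_neg hy.le]
    field_simp

namespace IsFourierExpansion

variable {m κ a : ℝ} {c : ℕ → ℂ} {H : ℂ → ℂ}

lemma norm_fracLimit_le (h : IsFourierExpansion m κ a c H) {α : ℝ} (hα : a < α) :
    ∃ M : ℝ, ∀ x, ‖fracLimit m α H x‖ ≤ M := by
  obtain ⟨C, ε, -, hC⟩ := h.norm_fracPartial_sub_le hα
  refine ⟨‖c 0 / (((((0 : ℕ) : ℝ) + κ) ^ α : ℝ) : ℂ)‖ + C * ((1 / (Real.pi * ((1 : ℕ) + κ) / m)) ^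
    (α - a) * Real.Gamma (α - a) + (1 / (Real.pi * ((1 : ℕ) + κ) / m)) ^ (α - a - ε) *
      Real.Gamma (α - a - ε)), fun x => ?_⟩
  have h1 := hC 1 x le_rfl
  have h2 : ‖fracPartial m κ α c 1 x‖ = ‖c 0 / (((((0 : ℕ) : ℝ) + κ) ^ α : ℝ) : ℂ)‖ := by
    rw [fracPartial, Finset.sum_range_one, norm_mul, norm_expMode]
    simp
  have h3 := norm_sub_norm_le (fracLimit m α H x) (fracPartial m κ α c 1 x)
  rw [norm_sub_rev] at h3
  linarith

lemma expMode_line (n : ℕ) (x y w : ℝ) :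
    expMode m κ n ((x + 2 * Real.pi * y * w : ℝ) : ℂ) = expMode m κ n x *
      Complex.exp ((2 * Real.pi * (2 * Real.pi / m * (n + κ) * y) * w : ℝ) * Complex.I) := by
  rw [Complex.ofReal_add, expMode_add]
  congr 1
  rw [expMode]
  congr 1
  push_cast
  ring

/-- Term by term, a mode of frequency v ≥ 0 integrates to φ(v), while its conjugate has frequency -v
and integrates to 0. Thus q disappears from the result, which lets one argument treat f_α, its real
part and its imaginary part. Uniform convergence and integrability of the kernel justify the limit.
-/
lemma integral_fracLimit_mul_gammaKernel (h : IsFourierExpansion m κ a c H) {α : ℝ} (hα : a < α)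
    (p q : ℂ) (x : ℝ) {y : ℝ} (hy : 0 < y) :
    ∫ w : ℝ, (p * fracLimit m α H (x + 2 * Real.pi * y * w) +
      q * (starRingEnd ℂ) (fracLimit m α H (x + 2 * Real.pi * y * w))) * gammaKernel α w =
      p * ((((2 * Real.pi / m) ^ α * y ^ α : ℝ) : ℂ) * H (x + y * Complex.I)) := by
  have hα0 : 0 < α := h.a_pos.trans hα
  have hm := h.m_pos
  have hpi := Real.pi_pos
  obtain ⟨M, hM⟩ := h.norm_fracLimit_le hα
  have hu := h.tendstoUniformly_fracPartial hα
  have hK := integrable_gammaKernel hα0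
  set S : ℕ → ℝ → ℂ := fun N w => fracPartial m κ α c N (x + 2 * Real.pi * y * w) with hS
  have hSc : ∀ N, Continuous (S N) := fun N =>
    (continuous_fracPartial α N).comp (by fun_prop)
  have hexp : ∀ v : ℝ, MeasureTheory.Integrable fun w : ℝ =>
      Complex.exp ((2 * Real.pi * v * w : ℝ) * Complex.I) * gammaKernel α w := by
    intro v
    refine hK.bdd_mul (c := 1) (Continuous.aestronglyMeasurable (by fun_prop))
      (Eventually.of_forall fun w => ?_)
    rw [Complex.norm_exp_ofReal_mul_I]
  have hval : ∀ N, ∫ w : ℝ, (p * S N w + q * (starRingEnd ℂ) (S N w)) * gammaKernel α w =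
      p * ∑ n ∈ Finset.range N, c n / ((((n : ℝ) + κ) ^ α : ℝ) : ℂ) * expMode m κ n x *
        (gammaWeight α (2 * Real.pi / m * (n + κ) * y) : ℂ) := by
    intro N
    have e : ∀ w, (p * S N w + q * (starRingEnd ℂ) (S N w)) * gammaKernel α w =
        ∑ n ∈ Finset.range N,
          (p * (c n / ((((n : ℝ) + κ) ^ α : ℝ) : ℂ) * expMode m κ n x) *
            (Complex.exp ((2 * Real.pi * (2 * Real.pi / m * (n + κ) * y) * w : ℝ) * Complex.I) *
              gammaKernel α w) +
          q * (starRingEnd ℂ) (c n / ((((n : ℝ) + κ) ^ α : ℝ) : ℂ) * expMode m κ n x) *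
            (Complex.exp ((2 * Real.pi * (-(2 * Real.pi / m * (n + κ) * y)) * w : ℝ) *
              Complex.I) * gammaKernel α w)) := by
      intro w
      simp only [hS, fracPartial]
      rw [map_sum, Finset.mul_sum, Finset.mul_sum, ← Finset.sum_add_distrib, Finset.sum_mul]
      refine Finset.sum_congr rfl fun n _ => ?_
      rw [expMode_line, ← mul_assoc (c n / _), map_mul _ (c n / _ * _) (Complex.exp _),
        ← Complex.exp_conj]
      have : (starRingEnd ℂ) ((2 * Real.pi * (2 * Real.pi / m * (n + κ) * y) * w : ℝ) *
          Complex.I) = (2 * Real.pi * (-(2 * Real.pi / m * (n + κ) * y)) * w : ℝ) *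
            Complex.I := by
        rw [map_mul, Complex.conj_ofReal, Complex.conj_I]
        push_cast
        ring
      rw [this]
      ring
    simp_rw [e]
    rw [MeasureTheory.integral_finsetSum _ fun n _ =>
      ((hexp _).const_mul _).fun_add ((hexp _).const_mul _), Finset.mul_sum]
    refine Finset.sum_congr rfl fun n _ => ?_
    have hκ := h.κ_nonneg
    have hfreq : 0 ≤ 2 * Real.pi / m * (n + κ) * y := by positivity
    rw [MeasureTheory.integral_add ((hexp _).const_mul _) ((hexp _).const_mul _),
      MeasureTheory.integral_const_mul, MeasureTheory.integral_const_mul,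
      integral_exp_mul_gammaKernel hα0, integral_exp_mul_gammaKernel hα0,
      gammaCut_of_nonneg hfreq, gammaCut_of_nonpos hα0 (by linarith)]
    ring
  have hlim1 : Tendsto (fun N => ∫ w : ℝ, (p * S N w + q * (starRingEnd ℂ) (S N w)) *
      gammaKernel α w) atTop (𝓝 (∫ w : ℝ, (p * fracLimit m α H (x + 2 * Real.pi * y * w) +
      q * (starRingEnd ℂ) (fracLimit m α H (x + 2 * Real.pi * y * w))) * gammaKernel α w)) := by
    refine MeasureTheory.tendsto_integral_filter_of_dominated_convergence
      (fun w => (‖p‖ * (M + 1) + ‖q‖ * (M + 1)) * ‖gammaKernel α w‖) ?_ ?_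
      (hK.norm.const_mul _) ?_
    · refine Eventually.of_forall fun N => Continuous.aestronglyMeasurable ?_
      have := hSc N
      have := continuous_gammaKernel α
      have := Complex.continuous_conj.comp (hSc N)
      simp only [Function.comp_def] at this
      fun_prop
    · filter_upwards [Metric.tendstoUniformly_iff.mp hu 1 one_pos] with N hN
      refine Eventually.of_forall fun w => ?_
      have hb : ‖S N w‖ ≤ M + 1 := by
        have h1 := hN (x + 2 * Real.pi * y * w)
        rw [dist_eq_norm, norm_sub_rev] at h1
        have h2 := norm_sub_norm_le (S N w) (fracLimit m α H (x + 2 * Real.pi * y * w))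
        have h3 := hM (x + 2 * Real.pi * y * w)
        have h4 : ‖S N w - fracLimit m α H (x + 2 * Real.pi * y * w)‖ < 1 := h1
        linarith
      rw [norm_mul]
      gcongr
      refine (norm_add_le _ _).trans ?_
      rw [norm_mul, norm_mul, RCLike.norm_conj]
      gcongr
    · refine Eventually.of_forall fun w => ?_
      have h1 := hu.tendsto_at (x + 2 * Real.pi * y * w)
      exact ((h1.const_mul p).add (((Complex.continuous_conj.tendsto _).comp h1).const_mul
        q)).mul_const _
  have hlim2 := ((h.hasSum_gammaWeight α x hy).tendsto_sum_nat).const_mul p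
  simp_rw [hval] at hlim1
  exact tendsto_nhds_unique hlim1 hlim2

/-- If a nontrivial combination of the fractional integral and its conjugate is differentiable
at `x`, then `y ^ a * H (x + iy)` tends to zero as `y → 0⁺`. -/
theorem tendsto_of_differentiableAt (h : IsFourierExpansion m κ a c H) {α : ℝ} (hα : a < α)
    (hα1 : α ≤ a + 1) {p q : ℂ} (hp : p ≠ 0) {x : ℝ}
    (hd : DifferentiableAt ℝ (fun u => p * fracLimit m α H u +
      q * (starRingEnd ℂ) (fracLimit m α H u)) x) :
    Tendsto (fun y : ℝ => y ^ a * ‖H (x + y * Complex.I)‖) (𝓝[>] 0) (𝓝 0) := by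
  have ha := h.a_pos
  have hα0 : 0 < α := ha.trans hα
  have hm := h.m_pos
  have hpi := Real.pi_pos
  obtain ⟨M, hM⟩ := h.norm_fracLimit_le hα
  have hFc := h.continuous_fracLimit hα
  set F := fracLimit m α H with hF
  set U : ℝ → ℂ := fun u => p * F u + q * (starRingEnd ℂ) (F u) with hU
  have hUc : Continuous U :=
    (continuous_const.mul hFc).add (continuous_const.mul (Complex.continuous_conj.comp hFc))
  have hUb : ∀ u, ‖U u‖ ≤ ‖p‖ * M + ‖q‖ * M := by
    intro u
    refine (norm_add_le _ _).trans ?_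
    rw [norm_mul, norm_mul, RCLike.norm_conj]
    gcongr <;> exact hM u
  set D := deriv U x with hD
  -- The linear part is subtracted as D sin v rather than D v: this keeps V bounded, and the
  -- integral of the sine against the kernel is explicit.
  set V : ℝ → ℂ := fun v => U (x + v) - U x - D * (Real.sin v : ℂ) with hV
  have hVc : Continuous V := by
    have : Continuous fun v => U (x + v) := hUc.comp (by fun_prop)
    fun_prop
  have hVb : ∀ v, ‖V v‖ ≤ (‖p‖ * M + ‖q‖ * M) + ‖U x‖ + ‖D‖ := by
    intro v
    refine (norm_sub_le _ _).trans (add_le_add ((norm_sub_le _ _).trans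
      (add_le_add (hUb _) le_rfl)) ?_)
    rw [norm_mul, Complex.norm_real]
    exact mul_le_of_le_one_right (norm_nonneg _) (Real.abs_sin_le_one v)
  have hVo : V =o[𝓝 0] fun v : ℝ => v := by
    have h1 : HasDerivAt U D x := hd.hasDerivAt
    have h2 : HasDerivAt (fun v : ℝ => U (x + v)) D 0 := by
      have := HasDerivAt.comp_const_add x 0 (by simpa using h1)
      simpa using this
    have h3 : HasDerivAt (fun v : ℝ => (Real.sin v : ℂ)) 1 0 := by
      have := (Real.hasDerivAt_sin 0).ofReal_comp
      simpa using this
    have h4 : HasDerivAt V 0 0 := by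
      have := (h2.sub_const (U x)).fun_sub (h3.const_mul D)
      rwa [mul_one, sub_self] at this
    have h5 := h4.isLittleO
    simpa [hV] using h5
  -- The choice β = α - a turns y^α H into y^a H. It is positive, at most 1 by the upper bound on α,
  -- and below α because a > 0.
  have hlim := tendsto_rpow_mul_integral_gammaKernel hα0 hVc hVb hVo (β := α - a)
    (by linarith) (by linarith) (by linarith)
  have hK := integrable_gammaKernel hα0
  have hexp : ∀ v : ℝ, MeasureTheory.Integrable fun w : ℝ =>
      Complex.exp ((2 * Real.pi * v * w : ℝ) * Complex.I) * gammaKernel α w := by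
    intro v
    refine hK.bdd_mul (c := 1) (Continuous.aestronglyMeasurable (by fun_prop))
      (Eventually.of_forall fun w => ?_)
    rw [Complex.norm_exp_ofReal_mul_I]
  have hsin : ∀ y : ℝ, 0 < y → MeasureTheory.Integrable (fun w : ℝ =>
      (Real.sin (2 * Real.pi * y * w) : ℂ) * gammaKernel α w) ∧
      ∫ w : ℝ, (Real.sin (2 * Real.pi * y * w) : ℂ) * gammaKernel α w =
        -(Complex.I / 2) * gammaWeight α y := by
    intro y hy
    have e : ∀ w : ℝ, (Real.sin (2 * Real.pi * y * w) : ℂ) * gammaKernel α w =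
        (Complex.I / 2) * (Complex.exp ((2 * Real.pi * (-y) * w : ℝ) * Complex.I) *
          gammaKernel α w) - (Complex.I / 2) *
          (Complex.exp ((2 * Real.pi * y * w : ℝ) * Complex.I) * gammaKernel α w) := by
      intro w
      rw [Complex.ofReal_sin, Complex.sin]
      push_cast
      ring_nf
    simp_rw [e]
    refine ⟨((hexp _).const_mul _).sub ((hexp _).const_mul _), ?_⟩
    rw [MeasureTheory.integral_sub ((hexp _).const_mul _) ((hexp _).const_mul _),
      MeasureTheory.integral_const_mul, MeasureTheory.integral_const_mul,
      integral_exp_mul_gammaKernel hα0, integral_exp_mul_gammaKernel hα0,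
      gammaCut_of_nonneg hy.le, gammaCut_of_nonpos hα0 (by linarith)]
    ring
  have hK0 : ∫ w : ℝ, gammaKernel α w = 0 := by
    have := integral_exp_mul_gammaKernel hα0 0
    rw [gammaCut_of_nonpos hα0 le_rfl] at this
    simpa using this
  have hVint : ∀ y : ℝ, 0 < y → ∫ w : ℝ, V (2 * Real.pi * y * w) * gammaKernel α w =
      p * ((((2 * Real.pi / m) ^ α * y ^ α : ℝ) : ℂ) * H (x + y * Complex.I)) +
        D * (Complex.I / 2) * gammaWeight α y := by
    intro y hy
    obtain ⟨hs1, hs2⟩ := hsin y hy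
    have hUi : MeasureTheory.Integrable fun w : ℝ =>
        U (x + 2 * Real.pi * y * w) * gammaKernel α w :=
      hK.bdd_mul (Continuous.aestronglyMeasurable (hUc.comp (by fun_prop)))
        (Eventually.of_forall fun w => hUb _)
    have e : ∀ w : ℝ, V (2 * Real.pi * y * w) * gammaKernel α w =
        U (x + 2 * Real.pi * y * w) * gammaKernel α w - U x * gammaKernel α w -
          D * ((Real.sin (2 * Real.pi * y * w) : ℂ) * gammaKernel α w) := by
      intro w
      simp only [hV]
      ring
    simp_rw [e]
    rw [MeasureTheory.integral_sub (hUi.sub' (hK.const_mul _)) (hs1.const_mul _),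
      MeasureTheory.integral_sub hUi (hK.const_mul _), MeasureTheory.integral_const_mul,
      MeasureTheory.integral_const_mul, hs2, hK0,
      h.integral_fracLimit_mul_gammaKernel hα p q x hy]
    ring
  have hw0 : Tendsto (fun y : ℝ => D * (Complex.I / 2) * ((y ^ a * Real.exp (-y) : ℝ) : ℂ))
      (𝓝[>] 0) (𝓝 0) := by
    have hc : Continuous fun y : ℝ => D * (Complex.I / 2) * ((gammaWeight a y : ℝ) : ℂ) :=
      continuous_const.mul (Complex.continuous_ofReal.comp (continuous_gammaWeight ha))
    exact (hc.tendsto' 0 0 (by simp [gammaWeight, ha.ne'])).mono_left nhdsWithin_le_nhds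
  have hω : 0 < (2 * Real.pi / m) ^ α := by positivity
  have hfin := ((hlim.sub hw0).norm).const_mul (‖p‖⁻¹ * ((2 * Real.pi / m) ^ α)⁻¹)
  simp only [sub_zero, norm_zero, mul_zero] at hfin
  refine hfin.congr' ?_
  filter_upwards [self_mem_nhdsWithin] with y hy
  have hy : 0 < y := hy
  have hpa : y ^ (-(α - a)) * y ^ α = y ^ a := by
    rw [← Real.rpow_add hy]
    congr 1
    ring
  have e : ((y ^ (-(α - a)) : ℝ) : ℂ) * (p * ((((2 * Real.pi / m) ^ α * y ^ α : ℝ) : ℂ) *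
      H (x + y * Complex.I)) + D * (Complex.I / 2) * gammaWeight α y) -
      D * (Complex.I / 2) * ((y ^ a * Real.exp (-y) : ℝ) : ℂ) =
      p * (((2 * Real.pi / m) ^ α : ℝ) : ℂ) * (((y ^ a : ℝ) : ℂ) * H (x + y * Complex.I)) := by
    rw [gammaWeight, ← hpa]
    push_cast
    ring
  rw [hVint y hy, e, norm_mul, norm_mul, norm_mul, Complex.norm_real, Complex.norm_real,
    Real.norm_of_nonneg hω.le, Real.norm_of_nonneg (by positivity : 0 ≤ y ^ a)]
  have : ‖p‖ ≠ 0 := norm_ne_zero_iff.mpr hp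
  field_simp

end IsFourierExpansion

end FracInt


namespace FracInt

/-! ### The automorphy factor and the invariant norm -/

/-- The automorphy factor `c z + d`. -/
noncomputable def autFactor (γ : SL(2, ℤ)) (z : ℍ) : ℂ :=
  (γ 1 0 : ℂ) * (z : ℂ) + (γ 1 1 : ℂ)

lemma autFactor_eq_denom (γ : SL(2, ℤ)) (z : ℍ) : autFactor γ z = denom γ z :=
  (ModularGroup.denom_apply γ z).symm

lemma autFactor_ne_zero (γ : SL(2, ℤ)) (z : ℍ) : autFactor γ z ≠ 0 := by
  rw [autFactor_eq_denom]
  exact denom_ne_zero _ z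

lemma im_smul_eq (γ : SL(2, ℤ)) (z : ℍ) : (γ • z).im = z.im / ‖autFactor γ z‖ ^ 2 := by
  rw [ModularGroup.im_smul_eq_div_normSq, Complex.normSq_eq_norm_sq, autFactor_eq_denom]

lemma im_autFactor (γ : SL(2, ℤ)) (z : ℍ) : (autFactor γ z).im = γ 1 0 * z.im := by
  simp [autFactor]

lemma abs_mul_im_le_norm_autFactor (γ : SL(2, ℤ)) (z : ℍ) :
    |(γ 1 0 : ℝ)| * z.im ≤ ‖autFactor γ z‖ := by
  have := Complex.abs_im_le_norm (autFactor γ z)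
  rwa [im_autFactor, abs_mul, abs_of_pos z.im_pos] at this

lemma one_le_abs_intCast {k : ℤ} (hk : k ≠ 0) : (1 : ℝ) ≤ |(k : ℝ)| := by
  exact_mod_cast Int.one_le_abs hk

/-- The function `|f z| (Im z) ^ (r / 2)`, invariant under the group of a modular form. -/
noncomputable def invNorm (r : ℝ) (f : ℍ → ℂ) (z : ℍ) : ℝ := ‖f z‖ * z.im ^ (r / 2)

lemma norm_cpow_ofReal {w : ℂ} (hw : w ≠ 0) (r : ℝ) : ‖w ^ (r : ℂ)‖ = ‖w‖ ^ r := by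
  rw [Complex.norm_cpow_of_ne_zero hw]
  simp

lemma im_smul_rpow (γ : SL(2, ℤ)) (z : ℍ) (r : ℝ) :
    (γ • z).im ^ (r / 2) = z.im ^ (r / 2) / ‖autFactor γ z‖ ^ r := by
  have h0 := norm_pos_iff.mpr (autFactor_ne_zero γ z)
  rw [im_smul_eq, Real.div_rpow z.im_pos.le (by positivity), ← Real.rpow_natCast,
    ← Real.rpow_mul h0.le]
  congr 2
  push_cast
  ring

lemma norm_slash (r : ℝ) (f : ℍ → ℂ) (γ : SL(2, ℤ)) (z : ℍ) :
    ‖slash r f γ z‖ = ‖f (γ • z)‖ / ‖autFactor γ z‖ ^ r := by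
  have := norm_cpow_ofReal (autFactor_ne_zero γ z) r
  rw [slash, norm_div, ← this, autFactor]

lemma norm_slash_mul_im_rpow (r : ℝ) (f : ℍ → ℂ) (γ : SL(2, ℤ)) (z : ℍ) :
    ‖slash r f γ z‖ * z.im ^ (r / 2) = invNorm r f (γ • z) := by
  rw [invNorm, im_smul_rpow, norm_slash]
  ring

lemma slash_one (r : ℝ) (f : ℍ → ℂ) : slash r f 1 = f := by
  ext z
  simp [slash]

namespace IsModularForm

variable {Γ : Subgroup SL(2, ℤ)} {r : ℝ} {μ : Γ → Circle} {f : ℍ → ℂ}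

lemma invNorm_smul (hf : IsModularForm Γ r μ f) {g : SL(2, ℤ)} (hg : g ∈ Γ) (z : ℍ) :
    invNorm r f (g • z) = invNorm r f z := by
  have h1 := hf.transform ⟨g, hg⟩ z
  have h2 := norm_cpow_ofReal (autFactor_ne_zero g z) r
  have h3 : ‖f (g • z)‖ = ‖autFactor g z‖ ^ r * ‖f z‖ := by
    rw [h1, norm_mul, norm_mul, Circle.norm_coe, one_mul, ← h2, autFactor]
  have h4 : 0 < ‖autFactor g z‖ ^ r :=
    Real.rpow_pos_of_pos (norm_pos_iff.mpr (autFactor_ne_zero g z)) r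
  rw [invNorm, invNorm, im_smul_rpow, h3]
  field_simp

lemma norm_slash_mul_left (hf : IsModularForm Γ r μ f) {g : SL(2, ℤ)} (hg : g ∈ Γ)
    (γ : SL(2, ℤ)) (z : ℍ) : ‖slash r f (g * γ) z‖ = ‖slash r f γ z‖ := by
  have h1 := norm_slash_mul_im_rpow r f (g * γ) z
  rw [mul_smul, hf.invNorm_smul hg, ← norm_slash_mul_im_rpow] at h1
  exact mul_right_cancel₀ (Real.rpow_pos_of_pos z.im_pos _).ne' h1

end IsModularForm

/-! ### Widths of cusps -/

/-- The normal core of Γ has finite index, so it contains a positive power of T. Being normal, it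
contains all conjugates of that power, so one M serves every γ. -/
lemma exists_pow_T_conj_mem (Γ : Subgroup SL(2, ℤ)) (hΓ : Γ.FiniteIndex) :
    ∃ M : ℕ, 0 < M ∧ ∀ (γ : SL(2, ℤ)) (k : ℕ),
      γ * ModularGroup.T ^ (M * k) * γ⁻¹ ∈ Γ := by
  have := Subgroup.finiteIndex_normalCore Γ
  obtain ⟨M, hM, -, hT⟩ := Subgroup.exists_pow_mem_of_index_ne_zero
    (H := Γ.normalCore) Subgroup.FiniteIndex.index_ne_zero ModularGroup.T
  refine ⟨M, hM, fun γ k => ?_⟩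
  rw [pow_mul]
  exact Γ.normalCore_le (Γ.normalCore_normal.conj_mem _ (Subgroup.pow_mem _ hT k) γ)

lemma width_spec (Γ : Subgroup SL(2, ℤ)) (hΓ : Γ.FiniteIndex) (γ : SL(2, ℤ)) :
    0 < width Γ γ ∧ (γ * ModularGroup.T ^ width Γ γ * γ⁻¹ ∈ Γ ∨
      -(γ * ModularGroup.T ^ width Γ γ * γ⁻¹) ∈ Γ) := by
  obtain ⟨M, hM, h⟩ := exists_pow_T_conj_mem Γ hΓ
  have := h γ 1
  rw [mul_one] at this
  exact Nat.sInf_mem (s := {m : ℕ | 0 < m ∧ (γ * ModularGroup.T ^ m * γ⁻¹ ∈ Γ ∨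
    -(γ * ModularGroup.T ^ m * γ⁻¹) ∈ Γ)}) ⟨M, hM, Or.inl this⟩

lemma T_pow_smul (n : ℕ) (z : ℍ) : ModularGroup.T ^ n • z = (n : ℝ) +ᵥ z := by
  have := modular_T_zpow_smul z n
  simpa using this

/-- Translation by the width is conjugate under γ to plus or minus an element of Γ, and -1 acts
trivially. Working with absolute values avoids any cocycle computation with the branches of
(cz+d)^r. -/
lemma IsModularForm.norm_slash_width {Γ : Subgroup SL(2, ℤ)} {r : ℝ} {μ : Γ → Circle} {f : ℍ → ℂ}
    (hf : IsModularForm Γ r μ f) (hΓ : Γ.FiniteIndex) (γ : SL(2, ℤ)) (z : ℍ) :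
    ‖slash r f γ ((width Γ γ : ℝ) +ᵥ z)‖ = ‖slash r f γ z‖ := by
  have h1 := norm_slash_mul_im_rpow r f γ ((width Γ γ : ℝ) +ᵥ z)
  have h2 : invNorm r f (γ • ((width Γ γ : ℝ) +ᵥ z)) = invNorm r f (γ • z) := by
    rw [← T_pow_smul]
    have e : γ • ModularGroup.T ^ width Γ γ • z =
        (γ * ModularGroup.T ^ width Γ γ * γ⁻¹) • γ • z := by
      simp only [← mul_smul]
      congr 1
      group
    rw [e]
    rcases (width_spec Γ hΓ γ).2 with h | h
    · exact hf.invNorm_smul h _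
    · rw [← ModularGroup.SL_neg_smul]
      exact hf.invNorm_smul h _
  rw [h2, ← norm_slash_mul_im_rpow, vadd_im] at h1
  exact mul_right_cancel₀ (Real.rpow_pos_of_pos z.im_pos _).ne' h1

/-! ### Holomorphy of the slash operator and the multiplier of a cusp -/

lemma differentiableOn_autFactor_cpow (γ : SL(2, ℤ)) (s : ℂ) :
    DifferentiableOn ℂ (fun z : ℂ => ((γ 1 0 : ℂ) * z + (γ 1 1 : ℂ)) ^ s) {z | 0 < z.im} := by
  by_cases hc : γ 1 0 = 0
  -- For c = 0 the base is constant, possibly on the branch cut. For c ≠ 0 its imaginary part is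
  -- nonzero on the upper half-plane and the cut is not met.
  · simp [hc]
  · intro z hz
    refine DifferentiableAt.differentiableWithinAt ?_
    refine DifferentiableAt.cpow_const (by fun_prop) ?_
    right
    have hz : 0 < z.im := hz
    have hc' : (γ 1 0 : ℝ) ≠ 0 := by exact_mod_cast hc
    simpa using ⟨hc, hz.ne'⟩

lemma mdifferentiable_slash {r : ℝ} {f : ℍ → ℂ} (hf : MDifferentiable 𝓘(ℂ) 𝓘(ℂ) f)
    (γ : SL(2, ℤ)) : MDifferentiable 𝓘(ℂ) 𝓘(ℂ) (slash r f γ) := by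
  have h1 : MDifferentiable 𝓘(ℂ) 𝓘(ℂ) (fun z : ℍ => f (γ • z)) := by
    refine hf.comp ?_
    exact mdifferentiable_smul (g := (γ : GL (Fin 2) ℝ)) (by simp)
  rw [mdifferentiable_iff] at h1 ⊢
  refine (h1.div (differentiableOn_autFactor_cpow γ r) fun z hz => ?_).congr fun z hz => ?_
  · have hz : 0 < z.im := hz
    have := autFactor_ne_zero γ ⟨z, hz⟩
    rw [autFactor] at this
    rw [Complex.cpow_ne_zero_iff]
    exact Or.inl this
  · have hz : 0 < z.im := hz
    simp [slash, ofComplex_apply_of_im_pos hz]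

/-- Two holomorphic functions on the upper half-plane with the same absolute value are
proportional. -/
lemma exists_eq_mul_of_norm_eq {g k : ℍ → ℂ} (hg : MDifferentiable 𝓘(ℂ) 𝓘(ℂ) g)
    (hk : MDifferentiable 𝓘(ℂ) 𝓘(ℂ) k) (hn : ∀ z, ‖g z‖ = ‖k z‖) {z₀ : ℍ} (h0 : k z₀ ≠ 0) :
    ∃ c : ℂ, ‖c‖ = 1 ∧ ∀ z, g z = c * k z := by
  rw [mdifferentiable_iff] at hg hk
  have hopen : IsOpen {z : ℂ | 0 < z.im} := isOpen_lt continuous_const Complex.continuous_im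
  set G : ℂ → ℂ := g ∘ ofComplex with hG
  set K : ℂ → ℂ := k ∘ ofComplex with hK
  have hz₀ : (z₀ : ℂ) ∈ {z : ℂ | 0 < z.im} := z₀.im_pos
  have hK0 : K z₀ ≠ 0 := by simpa [hK] using h0
  have hKc : ContinuousAt K z₀ := (hk.differentiableAt (hopen.mem_nhds hz₀)).continuousAt
  have hev : ∀ᶠ w in 𝓝 (z₀ : ℂ), w ∈ {z : ℂ | 0 < z.im} ∧ K w ≠ 0 :=
    Filter.Eventually.and (hopen.mem_nhds hz₀) (hKc.eventually_ne hK0)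
  have hnorm : ∀ w, ‖G w‖ = ‖K w‖ := fun w => hn _
  have hq : ∀ᶠ w in 𝓝 (z₀ : ℂ), ‖G w / K w‖ = 1 := by
    filter_upwards [hev] with w hw
    rw [norm_div, hnorm, div_self (norm_ne_zero_iff.mpr hw.2)]
  have hloc : ∀ᶠ w in 𝓝 (z₀ : ℂ), G w / K w = G z₀ / K z₀ := by
    refine Complex.eventually_eq_of_isLocalMax_norm (f := fun w => G w / K w) ?_ ?_
    · filter_upwards [hev] with w hw
      exact (hg.differentiableAt (hopen.mem_nhds hw.1)).div
        (hk.differentiableAt (hopen.mem_nhds hw.1)) hw.2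
    · filter_upwards [hq] with w hw
      simp only [Function.comp]
      rw [hw, hq.self_of_nhds]
  refine ⟨G z₀ / K z₀, hq.self_of_nhds, ?_⟩
  have heq := (hg.analyticOnNhd hopen).eqOn_of_preconnected_of_eventuallyEq
    ((hk.const_mul (G z₀ / K z₀)).analyticOnNhd hopen)
    (convex_halfSpace_im_gt 0).isPreconnected hz₀ (by
      filter_upwards [hloc, hev] with w h1 h2
      rw [← h1, div_mul_cancel₀ _ h2.2])
  intro z
  have := heq (x := (z : ℂ)) z.im_pos
  simpa [hG, hK] using this

lemma exp_two_pi_I_inj {κ κ' : ℝ} (h0 : 0 ≤ κ) (h1 : κ < 1) (h0' : 0 ≤ κ') (h1' : κ' < 1)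
    (h : Complex.exp (2 * Real.pi * Complex.I * κ) = Complex.exp (2 * Real.pi * Complex.I * κ')) :
    κ = κ' := by
  obtain ⟨n, hn⟩ := Complex.exp_eq_exp_iff_exists_int.mp h
  have h2 : (κ : ℂ) = κ' + n := by
    have := Complex.two_pi_I_ne_zero
    apply mul_left_cancel₀ this
    linear_combination hn
  have h3 : κ = κ' + n := by exact_mod_cast h2
  have hn0 : n = 0 := by
    have e1 : (n : ℝ) < 1 := by linarith
    have e2 : (-1 : ℝ) < n := by linarith
    have e1' : n < 1 := by exact_mod_cast e1
    have e2' : -1 < n := by exact_mod_cast e2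
    omega
  simpa [hn0] using h3

lemma exists_exp_two_pi_I_eq {c : ℂ} (hc : ‖c‖ = 1) :
    ∃ κ : ℝ, 0 ≤ κ ∧ κ < 1 ∧ c = Complex.exp (2 * Real.pi * Complex.I * κ) := by
  refine ⟨Int.fract (c.arg / (2 * Real.pi)), Int.fract_nonneg _, Int.fract_lt_one _, ?_⟩
  have h1 : c = Complex.exp (c.arg * Complex.I) := by
    have := Complex.norm_mul_exp_arg_mul_I c
    rw [hc] at this
    simpa using this.symm
  conv_lhs => rw [h1]
  rw [Complex.exp_eq_exp_iff_exists_int]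
  refine ⟨⌊c.arg / (2 * Real.pi)⌋, ?_⟩
  rw [Int.fract]
  have hpi : (Real.pi : ℂ) ≠ 0 := by exact_mod_cast Real.pi_ne_zero
  push_cast
  field_simp
  ring

/-- Since g is not identically zero, the set in the definition is a singleton, so its infimum is the
parameter itself. -/
lemma cuspParam_spec {g : ℍ → ℂ} {m : ℕ} {z₀ : ℍ} (h0 : g z₀ ≠ 0) {c : ℂ} (hc : ‖c‖ = 1)
    (h : ∀ z : ℍ, g ((m : ℝ) +ᵥ z) = c * g z) :
    0 ≤ cuspParam g m ∧ cuspParam g m < 1 ∧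
      ∀ z : ℍ, g ((m : ℝ) +ᵥ z) = Complex.exp (2 * Real.pi * Complex.I * cuspParam g m) * g z := by
  obtain ⟨κ, hκ0, hκ1, rfl⟩ := exists_exp_two_pi_I_eq hc
  have hset : {κ : ℝ | 0 ≤ κ ∧ κ < 1 ∧ ∀ z : ℍ, g ((m : ℝ) +ᵥ z) =
      Complex.exp (2 * Real.pi * Complex.I * κ) * g z} = {κ} := by
    ext κ'
    constructor
    · rintro ⟨h0', h1', h'⟩
      refine exp_two_pi_I_inj h0' h1' hκ0 hκ1 ?_
      have := h' z₀
      rw [h z₀] at this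
      exact (mul_right_cancel₀ h0 this).symm
    · rintro rfl
      exact ⟨hκ0, hκ1, h⟩
  rw [cuspParam, hset, csInf_singleton]
  exact ⟨hκ0, hκ1, h⟩

/-- The slashed form and its translate by the width are holomorphic with equal absolute values,
hence differ by a unimodular constant. This yields the multiplier of the cusp from the norm identity
alone. -/
lemma IsModularForm.cuspParam_slash {Γ : Subgroup SL(2, ℤ)} {r : ℝ} {μ : Γ → Circle} {f : ℍ → ℂ}
    (hf : IsModularForm Γ r μ f) (hΓ : Γ.FiniteIndex) (hf0 : f ≠ 0) (γ : SL(2, ℤ)) :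
    0 ≤ cuspParam (slash r f γ) (width Γ γ) ∧ cuspParam (slash r f γ) (width Γ γ) < 1 ∧
      ∀ z : ℍ, slash r f γ ((width Γ γ : ℝ) +ᵥ z) = Complex.exp (2 * Real.pi * Complex.I *
        cuspParam (slash r f γ) (width Γ γ)) * slash r f γ z := by
  obtain ⟨z₀, hz₀⟩ := Function.ne_iff.mp hf0
  have hs : slash r f γ (γ⁻¹ • z₀) ≠ 0 := by
    have h1 := norm_slash r f γ (γ⁻¹ • z₀)
    rw [smul_inv_smul] at h1
    have h2 : 0 < ‖autFactor γ (γ⁻¹ • z₀)‖ ^ r :=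
      Real.rpow_pos_of_pos (norm_pos_iff.mpr (autFactor_ne_zero _ _)) r
    have h3 : 0 < ‖f z₀‖ := norm_pos_iff.mpr (by simpa using hz₀)
    rw [← norm_pos_iff, h1]
    positivity
  have hd := mdifferentiable_slash (r := r) hf.holo γ
  have hd' : MDifferentiable 𝓘(ℂ) 𝓘(ℂ) (fun z : ℍ => slash r f γ ((width Γ γ : ℝ) +ᵥ z)) := by
    simp_rw [← T_pow_smul]
    refine hd.comp ?_
    exact mdifferentiable_smul (g := ((ModularGroup.T ^ width Γ γ : SL(2, ℤ)) : GL (Fin 2) ℝ))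
      (by simp)
  obtain ⟨c, hc, h⟩ := exists_eq_mul_of_norm_eq hd' hd (hf.norm_slash_width hΓ γ) hs
  exact cuspParam_spec hs hc h

end FracInt


namespace FracInt

/-! ### Fourier expansions at the cusps -/

/-- If γ fixes ∞, multiply by the conjugate of T^M by S, a lower triangular unipotent matrix that
moves ∞. -/
lemma exists_mem_apply_one_zero_ne_zero (Γ : Subgroup SL(2, ℤ)) (hΓ : Γ.FiniteIndex)
    (γ : SL(2, ℤ)) : ∃ g ∈ Γ, (g * γ) 1 0 ≠ 0 := by
  by_cases hc : γ 1 0 = 0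
  · obtain ⟨M, hM, h⟩ := exists_pow_T_conj_mem Γ hΓ
    refine ⟨_, h ModularGroup.S 1, ?_⟩
    have hdet := γ.det_coe
    rw [Matrix.det_fin_two] at hdet
    have h00 : γ 0 0 ≠ 0 := by
      intro h0
      simp [h0, hc] at hdet
    have e : (ModularGroup.S * ModularGroup.T ^ (M * 1) * ModularGroup.S⁻¹ * γ) 1 0 =
        -(M * γ 0 0) := by
      have hT : ((ModularGroup.T ^ (M * 1) : SL(2, ℤ)) : Matrix (Fin 2) (Fin 2) ℤ) =
          !![1, (M : ℤ); 0, 1] := by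
        have := ModularGroup.coe_T_zpow M
        rw [zpow_natCast] at this
        rw [mul_one, this]
      simp only [Matrix.SpecialLinearGroup.coe_mul, hT]
      simp [ ModularGroup.coe_S,
        Matrix.SpecialLinearGroup.coe_inv, Matrix.adjugate_fin_two, Matrix.mul_apply,
        Fin.sum_univ_two, hc]
    rw [e]
    simp [hM.ne', h00]
  · exact ⟨1, Γ.one_mem, by simpa using hc⟩

lemma norm_eq_of_norm_vadd {g : ℍ → ℂ} {m : ℝ} (hm : 0 < m) (h : ∀ z, ‖g (m +ᵥ z)‖ = ‖g z‖)
    (z : ℍ) : ∃ w : ℍ, 0 ≤ w.re ∧ w.re ≤ m ∧ w.im = z.im ∧ ‖g z‖ = ‖g w‖ := by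
  have hp : Function.Periodic (fun x : ℝ => ‖g (x +ᵥ z)‖) m := by
    intro x
    simp only
    rw [add_comm, ← vadd_vadd, h]
  obtain ⟨y, hy, he⟩ := hp.exists_mem_Ico hm 0 (-z.re)
  refine ⟨y +ᵥ z, ?_, ?_, vadd_im _ _, ?_⟩
  · rw [vadd_re]; linarith [hy.1]
  · rw [vadd_re]; linarith [hy.2]
  · simpa using he

lemma periodic_comp_ofComplex {g : ℍ → ℂ} {m : ℝ} (h : ∀ z : ℍ, g (m +ᵥ z) = g z) :
    Function.Periodic (g ∘ ofComplex) (m : ℂ) := by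
  intro w
  by_cases hw : 0 < w.im
  · have hw' : 0 < (w + (m : ℂ)).im := by simpa using hw
    simp only [Function.comp]
    rw [ofComplex_apply_of_im_pos hw, ofComplex_apply_of_im_pos hw', ← h ⟨w, hw⟩]
    congr 1
    ext
    simp [add_comm]
  · have hw' : ¬ 0 < (w + (m : ℂ)).im := by simpa using hw
    simp only [Function.comp]
    rw [ofComplex_apply_of_im_nonpos (not_lt.mp hw), ofComplex_apply_of_im_nonpos (not_lt.mp hw')]

namespace IsModularForm

variable {Γ : Subgroup SL(2, ℤ)} {r : ℝ} {μ : Γ → Circle} {f : ℍ → ℂ}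

/-- The growth hypothesis concerns small imaginary parts. Replacing γ by σ = gγ with nonzero lower
left entry does not change the norm, and σ sends high points to low ones; periodicity first brings
the real part into a bounded interval. -/
lemma exists_norm_slash_le (hf : IsModularForm Γ r μ f) (hΓ : Γ.FiniteIndex) (hr : 0 < r)
    (γ : SL(2, ℤ)) : ∃ B C Y : ℝ, ∀ z : ℍ, Y ≤ z.im → ‖slash r f γ z‖ ≤ C * z.im ^ B := by
  obtain ⟨g, hg, hc⟩ := exists_mem_apply_one_zero_ne_zero Γ hΓ γ
  obtain ⟨C, A, δ, hδ, hgr⟩ := hf.growth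
  set σ := g * γ with hσ
  set m : ℝ := (width Γ γ : ℝ) with hm
  have hm0 : 0 < m := by rw [hm]; exact_mod_cast (width_spec Γ hΓ γ).1
  set L : ℝ := |(σ 1 0 : ℝ)| * (m + 1) + |(σ 1 1 : ℝ)| with hL
  -- L Im w bounds |cw + d| when 0 ≤ Re w ≤ m and Im w ≥ 1. Height at least 2/δ places σw below δ,
  -- and |A| covers both signs of the growth exponent.
  refine ⟨2 * |A|, |C| * L ^ (2 * |A|), max 1 (2 / δ), fun z hz => ?_⟩
  obtain ⟨w, hw0, hwm, hwi, hwn⟩ := norm_eq_of_norm_vadd hm0 (hf.norm_slash_width hΓ γ) z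
  have hy1 : 1 ≤ w.im := by rw [hwi]; exact (le_max_left _ _).trans hz
  have hyδ : 2 / δ ≤ w.im := by rw [hwi]; exact (le_max_right _ _).trans hz
  rw [hwn, ← hwi, ← hf.norm_slash_mul_left hg, ← hσ, norm_slash]
  have hq : 1 ≤ |(σ 1 0 : ℝ)| := one_le_abs_intCast hc
  have hlow : w.im ≤ ‖autFactor σ w‖ :=
    (le_mul_of_one_le_left w.im_pos.le hq).trans (abs_mul_im_le_norm_autFactor σ w)
  have hN1 : 1 ≤ ‖autFactor σ w‖ := hy1.trans hlow
  have hup : ‖autFactor σ w‖ ≤ L * w.im := by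
    have h1 : ‖autFactor σ w‖ ≤ |(σ 1 0 : ℝ)| * ‖(w : ℂ)‖ + |(σ 1 1 : ℝ)| := by
      refine (norm_add_le _ _).trans ?_
      rw [norm_mul, Complex.norm_intCast, Complex.norm_intCast]
    have h2 : ‖(w : ℂ)‖ ≤ m + w.im := by
      refine (Complex.norm_le_abs_re_add_abs_im _).trans ?_
      simp only [coe_re, coe_im]
      rw [abs_of_nonneg hw0, abs_of_pos w.im_pos]
      linarith
    have h3 : m + w.im ≤ (m + 1) * w.im := by nlinarith
    calc _ ≤ |(σ 1 0 : ℝ)| * ((m + 1) * w.im) + |(σ 1 1 : ℝ)| * w.im := by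
          refine h1.trans (add_le_add ?_ ?_)
          · exact mul_le_mul_of_nonneg_left (h2.trans h3) (abs_nonneg _)
          · exact le_mul_of_one_le_right (abs_nonneg _) hy1
      _ = L * w.im := by rw [hL]; ring
  have him : (σ • w).im = w.im / ‖autFactor σ w‖ ^ 2 := im_smul_eq σ w
  have himp := (σ • w).im_pos
  have himle : (σ • w).im ≤ 1 / w.im := by
    rw [him, div_le_div_iff₀ (by positivity) w.im_pos, one_mul]
    nlinarith [w.im_pos]
  have himδ : (σ • w).im < δ := by
    refine himle.trans_lt ?_
    rw [div_lt_iff₀ w.im_pos]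
    rw [div_le_iff₀ hδ] at hyδ
    nlinarith
  have him1 : (σ • w).im ≤ 1 := himle.trans (by rw [div_le_one w.im_pos]; exact hy1)
  have hmain : ‖f (σ • w)‖ ≤ |C| * (L * w.im) ^ (2 * |A|) := by
    refine (hgr _ himδ).trans ?_
    have e1 : (σ • w).im ^ (-A) ≤ (σ • w).im ^ (-|A|) :=
      Real.rpow_le_rpow_of_exponent_ge himp him1 (neg_le_neg (le_abs_self A))
    have e2 : (σ • w).im ^ (-|A|) ≤ (L * w.im) ^ (2 * |A|) := by
      rw [Real.rpow_neg himp.le, ← Real.inv_rpow himp.le, Real.rpow_mul (by positivity)]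
      refine Real.rpow_le_rpow (by positivity) ?_ (abs_nonneg _)
      rw [him, inv_div, Real.rpow_two]
      refine (div_le_self (by positivity) hy1).trans ?_
      gcongr
    calc C * (σ • w).im ^ (-A) ≤ |C| * (σ • w).im ^ (-A) := by
          gcongr; exact le_abs_self C
      _ ≤ _ := by gcongr; exact e1.trans e2
  calc _ ≤ ‖f (σ • w)‖ := div_le_self (norm_nonneg _) (Real.one_le_rpow hN1 hr.le)
    _ ≤ _ := hmain
    _ = _ := by rw [Real.mul_rpow (by positivity) w.im_pos.le, mul_assoc]

lemma hasSum_cuspCoeff (hf : IsModularForm Γ r μ f) (hΓ : Γ.FiniteIndex) (hr : 0 < r)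
    (hf0 : f ≠ 0) (γ : SL(2, ℤ)) (z : ℍ) :
    HasSum (fun n => cuspCoeff (slash r f γ) (width Γ γ) (cuspParam (slash r f γ) (width Γ γ)) n *
      expMode (width Γ γ) (cuspParam (slash r f γ) (width Γ γ)) n z) (slash r f γ z) := by
  obtain ⟨hκ0, hκ1, hper⟩ := hf.cuspParam_slash hΓ hf0 γ
  set κ := cuspParam (slash r f γ) (width Γ γ) with hκ
  obtain ⟨hm, -⟩ := width_spec Γ hΓ γ
  set m := width Γ γ with hmdef
  have hmR : (0 : ℝ) < m := by exact_mod_cast hm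
  have hmC : (m : ℂ) ≠ 0 := by exact_mod_cast hm.ne'
  set s := slash r f γ with hs
  set h : ℍ → ℂ := fun z => s z * expMode m κ 0 (-z) with hh
  have hexp0 : ∀ w : ℂ, expMode m κ 0 (w + m) = Complex.exp (2 * Real.pi * Complex.I * κ) *
      expMode m κ 0 w := by
    intro w
    rw [expMode, expMode, ← Complex.exp_add]
    congr 1
    push_cast
    field_simp
    ring
  have hhper : ∀ z : ℍ, h ((m : ℝ) +ᵥ z) = h z := by
    intro z
    simp only [hh]
    rw [hper]
    have := hexp0 (-((((m : ℝ) +ᵥ z : ℍ) : ℂ)))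
    rw [coe_vadd] at this ⊢
    rw [show -(((m : ℝ) : ℂ) + (z : ℂ)) + m = -(z : ℂ) by push_cast; ring] at this
    rw [this]
    ring
  have hhper' : Function.Periodic (h ∘ ofComplex) ((m : ℝ) : ℂ) :=
    periodic_comp_ofComplex hhper
  have hhol : MDifferentiable 𝓘(ℂ) 𝓘(ℂ) h := by
    have h1 := mdifferentiable_slash (r := r) hf.holo γ
    rw [UpperHalfPlane.mdifferentiable_iff] at h1 ⊢
    refine (h1.mul (b := fun z => expMode m κ 0 (-z)) ?_).congr fun w hw => ?_
    · exact ((differentiable_expMode m κ 0).comp differentiable_neg).differentiableOn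
    · have hw : 0 < w.im := hw
      simp [hh, hs, ofComplex_apply_of_im_pos hw]
  -- Polynomial growth alone does not bound h, since e^(-2πiκz/m) may grow. But h times q =
  -- e^(2πiz/m) still has the factor e^(-2π(1-κ)y/m) and tends to 0 because κ < 1. A periodic
  -- holomorphic function vanishing at i∞ is O(q), and dividing by q bounds h.
  have hbdd : IsBoundedAtImInfty h := by
    set k : ℍ → ℂ := fun z => h z * expMode m 0 1 z with hk
    have hkper : Function.Periodic (k ∘ ofComplex) ((m : ℝ) : ℂ) := by
      refine periodic_comp_ofComplex fun z => ?_
      simp only [hk]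
      rw [hhper]
      congr 1
      rw [coe_vadd, expMode, expMode, Complex.exp_eq_exp_iff_exists_int]
      refine ⟨1, ?_⟩
      push_cast
      field_simp
      ring
    have hkhol : MDifferentiable 𝓘(ℂ) 𝓘(ℂ) k := by
      rw [UpperHalfPlane.mdifferentiable_iff] at hhol ⊢
      refine (hhol.mul (differentiable_expMode m 0 1).differentiableOn).congr fun w hw => ?_
      have hw : 0 < w.im := hw
      simp [hk, ofComplex_apply_of_im_pos hw]
    obtain ⟨B, C, Y, hB⟩ := hf.exists_norm_slash_le hΓ hr γ
    have hknorm : ∀ z : ℍ, ‖k z‖ = ‖s z‖ * Real.exp (-(2 * Real.pi * (1 - κ) / m) * z.im) := by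
      intro z
      simp only [hk, hh, norm_mul, norm_expMode]
      rw [mul_assoc, ← Real.exp_add]
      congr 2
      simp only [Complex.neg_im, coe_im]
      push_cast
      ring
    have hb : 0 < 2 * Real.pi * (1 - κ) / m := by
      have := Real.pi_pos
      have : 0 < 1 - κ := by linarith
      positivity
    have hkzero : IsZeroAtImInfty k := by
      rw [isZeroAtImInfty_iff]
      intro ε hε
      have ht := (tendsto_rpow_mul_exp_neg_mul_atTop_nhds_zero B _ hb).const_mul C
      rw [mul_zero] at ht
      obtain ⟨A, hA⟩ := eventually_atTop.mp (ht.eventually (eventually_le_nhds hε))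
      refine ⟨max A Y, fun z hz => ?_⟩
      rw [hknorm]
      refine le_trans ?_ (hA z.im ((le_max_left _ _).trans hz))
      rw [← mul_assoc]
      gcongr
      exact hB z ((le_max_right _ _).trans hz)
    have hO := hkzero.exp_decay_atImInfty hmR hkper hkhol hkzero.isBoundedAtImInfty
    obtain ⟨C', hC'⟩ := hO.bound
    obtain ⟨A, hA⟩ := (atImInfty_mem _).mp hC'
    rw [isBoundedAtImInfty_iff]
    refine ⟨C', A, fun z hz => ?_⟩
    have h1 : ‖k z‖ ≤ C' * ‖Real.exp (-2 * Real.pi * z.im / m)‖ := hA z hz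
    simp only [hk, norm_mul, norm_expMode, Real.norm_eq_abs, Real.abs_exp] at h1
    have e : -(2 * Real.pi * (((1 : ℕ) : ℝ) + 0) / m * (z : ℂ).im) =
        -2 * Real.pi * z.im / m := by
      simp only [coe_im]; push_cast; ring
    rw [e] at h1
    exact le_of_mul_le_mul_right h1 (Real.exp_pos _)
  have key := hasSum_qExpansion hmR hhper' hhol hbdd z
  have hcoeff : ∀ n, (PowerSeries.coeff n) (qExpansion m h) = cuspCoeff s m κ n := by
    intro n
    rw [qExpansion_coeff_eq_intervalIntegral hmR hhper' hhol hbdd n one_pos, cuspCoeff]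
    rw [Complex.ofReal_natCast]
    congr 1
    refine intervalIntegral.integral_congr fun u _ => ?_
    simp only [hh]
    have e2 : (⟨(u : ℂ) + ((1 : ℝ) : ℂ) * (UpperHalfPlane.I : ℂ), by simp⟩ : ℍ) = u +ᵥ UpperHalfPlane.I := by
      ext; simp
    have e4 : (u : ℂ) + ((1 : ℝ) : ℂ) * (UpperHalfPlane.I : ℂ) = u + Complex.I := by simp
    rw [e2, e4, Function.Periodic.qParam, ← Complex.exp_nat_mul, one_div, ← Complex.exp_neg,
      expMode, mul_comm, mul_assoc, ← Complex.exp_add]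
    congr 2
    push_cast
    field_simp
    ring
  have hmul := key.mul_right (expMode m κ 0 z)
  have e1 : h z * expMode m κ 0 z = s z := by
    simp only [hh]
    rw [mul_assoc, expMode_neg_mul, mul_one]
  rw [e1] at hmul
  refine hmul.congr_fun fun n => ?_
  rw [hcoeff, smul_eq_mul, mul_assoc]
  congr 1
  have := expMode_add_nat m κ 0 n z
  rw [zero_add] at this
  rw [this, mul_comm]
  congr 2
  rw [expMode, Function.Periodic.qParam]
  congr 1
  push_cast
  ring

end IsModularForm

end FracInt


namespace FracInt

/-! ### Growth of modular forms -/

/-- Compare each term with its value at height Y, where the series converges absolutely; every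
occurring frequency is at least δ, so the exponential gain is uniform. -/
lemma norm_le_exp_of_hasSum {m κ δ Y : ℝ} (hm : 0 < m) (hY : 0 < Y) {a : ℕ → ℂ} {g : ℍ → ℂ}
    (hδ : ∀ n : ℕ, a n ≠ 0 → δ ≤ n + κ)
    (hs : ∀ z : ℍ, HasSum (fun n => a n * expMode m κ n z) (g z)) :
    ∃ C : ℝ, 0 < C ∧ ∀ z : ℍ, Y ≤ z.im → ‖g z‖ ≤ C * Real.exp (-(2 * Real.pi * δ / m * z.im)) := by
  set w : ℍ := ⟨Y * Complex.I, by simpa using hY⟩ with hw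
  have hwi : (w : ℂ).im = Y := by simp [hw]
  have hsum : Summable fun n => ‖a n * expMode m κ n w‖ := (hs w).summable.norm
  set S := ∑' n, ‖a n * expMode m κ n w‖ with hS
  have hS0 : 0 ≤ S := tsum_nonneg fun n => norm_nonneg _
  refine ⟨(S + 1) * Real.exp (2 * Real.pi * δ / m * Y), by positivity, fun z hz => ?_⟩
  have hbd : ∀ n, ‖a n * expMode m κ n z‖ ≤
      ‖a n * expMode m κ n w‖ * Real.exp (-(2 * Real.pi * δ / m * (z.im - Y))) := by
    intro n
    by_cases h0 : a n = 0
    · simp [h0]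
    rw [norm_mul, norm_mul, mul_assoc, norm_expMode, norm_expMode, ← Real.exp_add, hwi, coe_im]
    refine mul_le_mul_of_nonneg_left (Real.exp_le_exp.mpr ?_) (norm_nonneg _)
    have h1 : 2 * Real.pi * δ / m ≤ 2 * Real.pi * (n + κ) / m := by
      have := Real.pi_pos
      gcongr
      exact hδ n h0
    nlinarith
  have h2 := tsum_of_norm_bounded (hsum.hasSum.mul_right _) hbd
  rw [(hs z).tsum_eq] at h2
  refine h2.trans ?_
  rw [← hS, mul_assoc (S + 1), ← Real.exp_add]
  have e : 2 * Real.pi * δ / m * Y + -(2 * Real.pi * δ / m * z.im) =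
      -(2 * Real.pi * δ / m * (z.im - Y)) := by ring
  rw [e]
  gcongr
  linarith

/-- The Fourier coefficients of positive frequency, extended by zero. -/
noncomputable def posCoeff (g : ℍ → ℂ) (m : ℕ) (n : ℕ) : ℂ :=
  if 0 < (n : ℝ) + cuspParam g m then cuspCoeff g m (cuspParam g m) n else 0

/-- The coefficient of frequency zero. -/
noncomputable def constTerm (g : ℍ → ℂ) (m : ℕ) : ℂ :=
  if cuspParam g m = 0 then cuspCoeff g m (cuspParam g m) 0 else 0

namespace IsModularForm

variable {Γ : Subgroup SL(2, ℤ)} {r : ℝ} {μ : Γ → Circle} {f : ℍ → ℂ}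

lemma isCuspidalAt_iff (hf : IsModularForm Γ r μ f) (hΓ : Γ.FiniteIndex) (hf0 : f ≠ 0)
    (γ : SL(2, ℤ)) :
    IsCuspidalAt Γ r f γ ↔ constTerm (slash r f γ) (width Γ γ) = 0 := by
  obtain ⟨h0, -, -⟩ := hf.cuspParam_slash hΓ hf0 γ
  rw [IsCuspidalAt, constTerm]
  rcases h0.eq_or_lt with h | h
  · rw [if_pos h.symm, ← h]
    simp
  · rw [if_neg h.ne']
    simp [h]

lemma hasSum_posCoeff (hf : IsModularForm Γ r μ f) (hΓ : Γ.FiniteIndex) (hr : 0 < r)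
    (hf0 : f ≠ 0) (γ : SL(2, ℤ)) (z : ℍ) :
    HasSum (fun n => posCoeff (slash r f γ) (width Γ γ) n *
      expMode (width Γ γ) (cuspParam (slash r f γ) (width Γ γ)) n z)
      (slash r f γ z - constTerm (slash r f γ) (width Γ γ)) := by
  obtain ⟨h0, -, -⟩ := hf.cuspParam_slash hΓ hf0 γ
  refine ((hf.hasSum_cuspCoeff hΓ hr hf0 γ z).sub
    (hasSum_ite_eq 0 (constTerm (slash r f γ) (width Γ γ)))).congr_fun fun n => ?_
  rw [posCoeff, constTerm]
  rcases Nat.eq_zero_or_pos n with rfl | hn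
  · rcases h0.eq_or_lt with h | h
    · rw [← h]
      simp [expMode]
    · simp [h, h.ne']
  · have : 0 < (n : ℝ) + cuspParam (slash r f γ) (width Γ γ) := by positivity
    simp [this, hn.ne']

lemma norm_slash_sub_constTerm_le (hf : IsModularForm Γ r μ f) (hΓ : Γ.FiniteIndex) (hr : 0 < r)
    (hf0 : f ≠ 0) (γ : SL(2, ℤ)) :
    ∃ C p : ℝ, 0 < C ∧ 0 < p ∧ ∀ z : ℍ, 1 / 2 ≤ z.im →
      ‖slash r f γ z - constTerm (slash r f γ) (width Γ γ)‖ ≤ C * Real.exp (-(p * z.im)) := by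
  obtain ⟨h0, -, -⟩ := hf.cuspParam_slash hΓ hf0 γ
  set κ := cuspParam (slash r f γ) (width Γ γ) with hκ
  have hm : (0 : ℝ) < width Γ γ := by exact_mod_cast (width_spec Γ hΓ γ).1
  -- A lower bound for the positive frequencies: 1 when κ = 0, and κ otherwise.
  obtain ⟨δ, hδ0, hδ⟩ : ∃ δ : ℝ, 0 < δ ∧ ∀ n : ℕ, 0 < (n : ℝ) + κ → δ ≤ n + κ := by
    rcases h0.eq_or_lt with h | h
    · refine ⟨1, one_pos, fun n hn => ?_⟩
      rw [← h, add_zero] at hn ⊢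
      exact_mod_cast hn
    · exact ⟨κ, h, fun n _ => by simp⟩
  obtain ⟨C, hC, h⟩ := norm_le_exp_of_hasSum hm one_half_pos (δ := δ) (κ := κ)
    (a := posCoeff (slash r f γ) (width Γ γ)) (fun n hn => hδ n (by
      by_contra hneg
      exact hn (if_neg hneg))) (hf.hasSum_posCoeff hΓ hr hf0 γ)
  have := Real.pi_pos
  exact ⟨C, 2 * Real.pi * δ / width Γ γ, hC, by positivity, h⟩

/-- By Γ-invariance the constant need only depend on the coset Γγ, and there are finitely many of
these. -/
lemma exists_invNorm_smul_le (hf : IsModularForm Γ r μ f) (hΓ : Γ.FiniteIndex) {P : ℍ → ℝ}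
    (hP : ∀ z, 0 ≤ P z) (h : ∀ γ : SL(2, ℤ), ∃ C : ℝ, ∀ z : ℍ, 1 / 2 ≤ z.im →
      invNorm r f (γ • z) ≤ C * P z) :
    ∃ C : ℝ, ∀ (γ : SL(2, ℤ)) (z : ℍ), 1 / 2 ≤ z.im → invNorm r f (γ • z) ≤ C * P z := by
  choose C hC using h
  have : Finite (SL(2, ℤ) ⧸ Γ) := inferInstance
  obtain ⟨B, hB⟩ := (Set.finite_range fun q : SL(2, ℤ) ⧸ Γ => C q.out⁻¹).bddAbove
  refine ⟨B, fun γ z hz => ?_⟩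
  obtain ⟨g, hg⟩ := QuotientGroup.mk_out_eq_mul Γ γ⁻¹
  set σ := (QuotientGroup.mk (s := Γ) γ⁻¹).out with hσ
  have e : γ = (g : SL(2, ℤ)) * σ⁻¹ := by
    rw [hg]; group
  rw [e, mul_smul, hf.invNorm_smul g.2]
  refine (hC _ z hz).trans (mul_le_mul_of_nonneg_right ?_ (hP z))
  exact hB ⟨_, rfl⟩

/-- Some element of SL(2, ℤ) moves z to height at least 1/2, where the expansion at a cusp controls
the invariant norm. For cusp forms that norm is bounded, giving exponent r/2. In general it is O((Im
γz)^(r/2)), and Im γz ≤ 1/Im z costs a further r/2. -/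
lemma exists_norm_le_rpow (hf : IsModularForm Γ r μ f) (hΓ : Γ.FiniteIndex) (hr : 0 < r)
    (hf0 : f ≠ 0) :
    ∃ C : ℝ, ∀ z : ℍ, z.im ≤ 1 → ‖f z‖ ≤ C * z.im ^ (-alphaZero Γ r f) := by
  by_cases hcusp : IsCuspForm Γ r f
  · rw [alphaZero, if_pos hcusp]
    obtain ⟨C, hC⟩ := hf.exists_invNorm_smul_le hΓ (P := fun _ => 1) (fun _ => zero_le_one) (by
      intro γ
      obtain ⟨C, p, hC, hp, h⟩ := hf.norm_slash_sub_constTerm_le hΓ hr hf0 γ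
      refine ⟨C * ((r / 2) / p) ^ (r / 2), fun z hz => ?_⟩
      have h1 := h z hz
      rw [(hf.isCuspidalAt_iff hΓ hf0 γ).mp (hcusp γ), sub_zero] at h1
      rw [← norm_slash_mul_im_rpow, mul_one]
      have h2 := exp_neg_mul_le_rpow hp (half_pos hr) z.im_pos
      have hzr := Real.rpow_pos_of_pos z.im_pos (r / 2)
      calc _ ≤ C * (((r / 2) / p) ^ (r / 2) * z.im ^ (-(r / 2))) * z.im ^ (r / 2) := by
            gcongr
            exact h1.trans (by gcongr)
        _ = C * ((r / 2) / p) ^ (r / 2) := by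
            rw [Real.rpow_neg z.im_pos.le]
            field_simp)
    refine ⟨C, fun z _ => ?_⟩
    obtain ⟨γ, hγ⟩ := ModularGroup.exists_one_half_le_im_smul z
    have h1 := hC γ⁻¹ (γ • z) hγ
    rw [inv_smul_smul, invNorm, mul_one] at h1
    rw [Real.rpow_neg z.im_pos.le, ← div_eq_mul_inv,
      le_div_iff₀ (Real.rpow_pos_of_pos z.im_pos _)]
    exact h1
  · rw [alphaZero, if_neg hcusp]
    obtain ⟨C, hC⟩ := hf.exists_invNorm_smul_le hΓ (P := fun z => z.im ^ (r / 2))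
      (fun z => (Real.rpow_pos_of_pos z.im_pos _).le) (by
      intro γ
      obtain ⟨C, p, hC, hp, h⟩ := hf.norm_slash_sub_constTerm_le hΓ hr hf0 γ
      refine ⟨C + ‖constTerm (slash r f γ) (width Γ γ)‖, fun z hz => ?_⟩
      rw [← norm_slash_mul_im_rpow]
      refine mul_le_mul_of_nonneg_right ?_ (Real.rpow_pos_of_pos z.im_pos _).le
      have h1 := h z hz
      have h2 : Real.exp (-(p * z.im)) ≤ 1 :=
        Real.exp_le_one_iff.mpr (neg_nonpos.mpr (mul_pos hp z.im_pos).le)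
      have h3 := norm_le_norm_sub_add (slash r f γ z) (constTerm (slash r f γ) (width Γ γ))
      nlinarith)
    refine ⟨|C|, fun z hz => ?_⟩
    obtain ⟨γ, hγ⟩ := ModularGroup.exists_one_half_le_im_smul z
    have h1 := hC γ⁻¹ (γ • z) hγ
    rw [inv_smul_smul, invNorm] at h1
    -- It suffices that |cz + d| ≥ Im z: for c ≠ 0 the imaginary part gives this, and for c = 0 it
    -- is |d| ≥ 1 ≥ Im z.
    have hle : (γ • z).im ≤ 1 / z.im := by
      have hp := norm_pos_iff.mpr (autFactor_ne_zero γ z)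
      rw [im_smul_eq, div_le_div_iff₀ (by positivity) z.im_pos, one_mul, ← pow_two]
      refine pow_le_pow_left₀ z.im_pos.le ?_ 2
      by_cases hc : γ 1 0 = 0
      · have hdet := γ.det_coe
        rw [Matrix.det_fin_two] at hdet
        have h11 : γ 1 1 ≠ 0 := by
          intro h0
          simp [h0, hc] at hdet
        have : ‖autFactor γ z‖ = |(γ 1 1 : ℝ)| := by simp [autFactor, hc]
        rw [this]
        exact hz.trans (one_le_abs_intCast h11)
      · exact (le_mul_of_one_le_left z.im_pos.le (one_le_abs_intCast hc)).trans
          (abs_mul_im_le_norm_autFactor γ z)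
    have h2 : (γ • z).im ^ (r / 2) ≤ (1 / z.im) ^ (r / 2) :=
      Real.rpow_le_rpow (γ • z).im_pos.le hle (by positivity)
    have hzr := Real.rpow_pos_of_pos z.im_pos (r / 2)
    have h3 : ‖f z‖ * z.im ^ (r / 2) ≤ |C| * (1 / z.im ^ (r / 2)) := by
      refine h1.trans ?_
      rw [Real.div_rpow zero_le_one z.im_pos.le, Real.one_rpow] at h2
      have := Real.rpow_pos_of_pos (γ • z).im_pos (r / 2)
      calc _ ≤ |C| * (γ • z).im ^ (r / 2) := by gcongr; exact le_abs_self C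
        _ ≤ _ := by gcongr
    have e : z.im ^ (-r) = 1 / z.im ^ (r / 2) / z.im ^ (r / 2) := by
      rw [div_div, ← Real.rpow_add z.im_pos, add_halves, Real.rpow_neg z.im_pos.le, one_div]
    rw [e, ← mul_div_assoc, le_div_iff₀ hzr]
    exact h3

lemma alphaZero_pos (Γ : Subgroup SL(2, ℤ)) (f : ℍ → ℂ) (hr : 0 < r) : 0 < alphaZero Γ r f := by
  rw [alphaZero]
  split_ifs
  · exact half_pos hr
  · exact hr

theorem isFourierExpansion (hf : IsModularForm Γ r μ f) (hΓ : Γ.FiniteIndex) (hr : 0 < r)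
    (hf0 : f ≠ 0) :
    IsFourierExpansion (width Γ 1) (cuspParam f (width Γ 1)) (alphaZero Γ r f)
      (posCoeff f (width Γ 1)) (fun z => f (ofComplex z) - constTerm f (width Γ 1)) where
  m_pos := by exact_mod_cast (width_spec Γ hΓ 1).1
  κ_nonneg := by
    have := (hf.cuspParam_slash hΓ hf0 1).1
    rwa [slash_one] at this
  a_pos := alphaZero_pos Γ f hr
  coeff_eq_zero n hn := if_neg hn
  holo := (UpperHalfPlane.mdifferentiable_iff.mp hf.holo).sub_const _
  hasSum z hz := by
    have := hf.hasSum_posCoeff hΓ hr hf0 1 ⟨z, hz⟩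
    rw [slash_one] at this
    rwa [ofComplex_apply_of_im_pos hz]
  bound := by
    set a := alphaZero Γ r f with ha
    have ha0 : 0 < a := alphaZero_pos Γ f hr
    obtain ⟨C, hC⟩ := hf.exists_norm_le_rpow hΓ hr hf0
    obtain ⟨D, p, hD, hp, h⟩ := hf.norm_slash_sub_constTerm_le hΓ hr hf0 1
    rw [slash_one] at h
    set b := constTerm f (width Γ 1) with hb
    refine ⟨|C| + ‖b‖ + D * (a / p) ^ a, by positivity, fun z hz => ?_⟩
    rw [ofComplex_apply_of_im_pos hz]
    have hza := Real.rpow_pos_of_pos hz (-a)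
    have hpa : 0 < D * (a / p) ^ a := by positivity
    -- At height at most 1 the subtracted constant is absorbed because (Im z)^(-a) ≥ 1. Higher up,
    -- the subtraction leaves an exponentially decaying function.
    rcases le_total z.im 1 with h1 | h1
    · have h2 : ‖f ⟨z, hz⟩‖ ≤ C * z.im ^ (-a) := hC ⟨z, hz⟩ h1
      have h3 : 1 ≤ z.im ^ (-a) := Real.one_le_rpow_of_pos_of_le_one_of_nonpos hz h1 (by linarith)
      have h4 := norm_sub_le (f ⟨z, hz⟩) b
      have h5 := le_abs_self C
      nlinarith [norm_nonneg b]
    · have h2 : ‖f ⟨z, hz⟩ - b‖ ≤ D * Real.exp (-(p * z.im)) :=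
        h ⟨z, hz⟩ (le_trans (by norm_num) h1)
      have h3 := exp_neg_mul_le_rpow hp ha0 hz
      calc _ ≤ D * ((a / p) ^ a * z.im ^ (-a)) := h2.trans (by gcongr)
        _ = D * (a / p) ^ a * z.im ^ (-a) := by ring
        _ ≤ _ := by
          gcongr
          have := norm_nonneg b
          have := abs_nonneg C
          linarith

end IsModularForm

end FracInt


namespace FracInt

/-! ### Boundary behaviour on a dense set -/

lemma tendsto_div_affine {A B b p q d : ℂ} (hB : B ≠ 0) (hq : q ≠ 0) :
    Tendsto (fun k : ℕ => (p * (A + k * B) + b) / (q * (A + k * B) + d)) atTop (𝓝 (p / q)) ∧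
      ∀ᶠ k : ℕ in atTop, q * (A + k * B) + d ≠ 0 := by
  have h1 : ∀ p b : ℂ,
      Tendsto (fun k : ℕ => p * (A * (1 / (k : ℂ)) + B) + b * (1 / (k : ℂ))) atTop (𝓝 (p * B)) := by
    intro p b
    have h := tendsto_one_div_atTop_nhds_zero_nat (𝕜 := ℂ)
    simpa using (((h.const_mul A).add_const B).const_mul p).add (h.const_mul b)
  have h2 : ∀ (p b : ℂ) {k : ℕ}, k ≠ 0 →
      p * (A + k * B) + b = k * (p * (A * (1 / (k : ℂ)) + B) + b * (1 / (k : ℂ))) := by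
    intro p b k hk
    have hk' : (k : ℂ) ≠ 0 := by exact_mod_cast hk
    field_simp
  constructor
  · have := (h1 p b).div (h1 q d) (mul_ne_zero hq hB)
    rw [mul_div_mul_right _ _ hB] at this
    refine this.congr' ?_
    filter_upwards [eventually_ne_atTop 0] with k hk
    have hk' : (k : ℂ) ≠ 0 := by exact_mod_cast hk
    rw [h2 p b hk, h2 q d hk, mul_div_mul_left _ _ hk']
    rfl
  · filter_upwards [eventually_ne_atTop 0, (h1 q d).eventually_ne (mul_ne_zero hq hB)] with k hk hk2
    rw [h2 q d hk]
    exact mul_ne_zero (by exact_mod_cast hk) hk2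

lemma exists_SL2_ratio_mem {V : Set ℝ} (hV : IsOpen V) (hne : V.Nonempty) :
    ∃ δ : SL(2, ℤ), δ 1 0 ≠ 0 ∧ (δ 0 0 : ℝ) / δ 1 0 ∈ V := by
  obtain ⟨q, hq⟩ := Rat.denseRange_cast.exists_mem_open hV hne
  obtain ⟨δ, h0, h1⟩ := (Rat.isCoprime_num_den q).exists_SL2_col 0
  refine ⟨δ, ?_, ?_⟩
  · rw [h1]
    exact_mod_cast q.den_ne_zero
  · rw [h0, h1]
    rw [Rat.cast_def] at hq
    exact_mod_cast hq

lemma coe_SL2_smul (γ : SL(2, ℤ)) (z : ℍ) :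
    ((γ • z : ℍ) : ℂ) = ((γ 0 0 : ℂ) * z + γ 0 1) / ((γ 1 0 : ℂ) * z + γ 1 1) := by
  simp [specialLinearGroup_apply]

lemma coe_T_pow (n : ℕ) : ((ModularGroup.T ^ n : SL(2, ℤ)) : Matrix (Fin 2) (Fin 2) ℤ) =
    !![1, (n : ℤ); 0, 1] := by
  have := ModularGroup.coe_T_zpow n
  rwa [zpow_natCast] at this

/-- The points `γ z` for `γ` in a finite index subgroup accumulate at every rational number. -/
lemma tendsto_conj_T_pow_smul {M : ℕ} (hM : 0 < M) {δ : SL(2, ℤ)} (hδ : δ 1 0 ≠ 0) (z : ℍ) :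
    Tendsto (fun k : ℕ => (((δ * ModularGroup.T ^ (M * k) * δ⁻¹) • z : ℍ) : ℂ)) atTop
      (𝓝 ((δ 0 0 : ℂ) / δ 1 0)) := by
  have h := (tendsto_div_affine (A := (δ⁻¹ • z : ℍ)) (B := M) (b := δ 0 1) (p := δ 0 0)
    (q := δ 1 0) (d := δ 1 1) (by exact_mod_cast hM.ne') (by exact_mod_cast hδ)).1
  refine h.congr fun k => ?_
  rw [mul_smul, mul_smul, coe_SL2_smul δ (_ • _), T_pow_smul, coe_vadd]
  push_cast
  congr 2 <;> ring

/-- The parabolic elements fixing the cusp δ(∞) push every cusp γ(∞) towards it, so the Γ-orbit of a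
cusp is dense in the real line. If δ⁻¹γ fixes ∞, the sequence is constant. -/
lemma tendsto_conj_T_pow_mul {M : ℕ} (hM : 0 < M) {δ : SL(2, ℤ)} (hδ : δ 1 0 ≠ 0)
    (γ : SL(2, ℤ)) :
    Tendsto (fun k : ℕ => ((δ * ModularGroup.T ^ (M * k) * δ⁻¹ * γ) 0 0 : ℂ) /
      (δ * ModularGroup.T ^ (M * k) * δ⁻¹ * γ) 1 0) atTop (𝓝 ((δ 0 0 : ℂ) / δ 1 0)) ∧
      ∀ᶠ k : ℕ in atTop, (δ * ModularGroup.T ^ (M * k) * δ⁻¹ * γ) 1 0 ≠ 0 := by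
  set ε := δ⁻¹ * γ with hε
  have he : ∀ (k : ℕ) (i : Fin 2), ((δ * ModularGroup.T ^ (M * k) * δ⁻¹ * γ) i 0 : ℂ) =
      δ i 0 * (ε 0 0 + k * (M * ε 1 0)) + δ i 1 * ε 1 0 := by
    intro k i
    rw [mul_assoc, ← hε]
    simp only [Matrix.SpecialLinearGroup.coe_mul, coe_T_pow, Matrix.mul_apply, Fin.sum_univ_two]
    simp
    ring
  have hδ' : (δ 1 0 : ℂ) ≠ 0 := by exact_mod_cast hδ
  have hcast : ∀ k : ℕ, (δ * ModularGroup.T ^ (M * k) * δ⁻¹ * γ) 1 0 ≠ 0 ↔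
      (δ 1 0 : ℂ) * (ε 0 0 + k * (M * ε 1 0)) + δ 1 1 * ε 1 0 ≠ 0 := by
    intro k
    rw [← he]
    norm_cast
  simp only [hcast, he]
  by_cases h0 : ε 1 0 = 0
  · have hdet := ε.det_coe
    rw [Matrix.det_fin_two] at hdet
    have h00 : (ε 0 0 : ℂ) ≠ 0 := by
      intro h00
      have h00' : ε 0 0 = 0 := by exact_mod_cast h00
      simp [h00', h0] at hdet
    constructor
    · refine tendsto_const_nhds.congr fun k => ?_
      simp only [h0, Int.cast_zero, mul_zero, add_zero]
      rw [mul_div_mul_right _ _ h00]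
    · refine Eventually.of_forall fun k => ?_
      simpa [h0] using ⟨hδ, by exact_mod_cast h00⟩
  · exact tendsto_div_affine (mul_ne_zero (by exact_mod_cast hM.ne') (by exact_mod_cast h0)) hδ'

namespace IsModularForm

variable {Γ : Subgroup SL(2, ℤ)} {r : ℝ} {μ : Γ → Circle} {f : ℍ → ℂ}

lemma continuous_norm_line (hf : IsModularForm Γ r μ f) {y : ℝ} (hy : 0 < y) :
    Continuous fun x : ℝ => y ^ (r / 2) * ‖f (ofComplex (x + y * Complex.I))‖ := by
  have h := (UpperHalfPlane.mdifferentiable_iff.mp hf.holo).continuousOn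
  have h2 : Continuous fun x : ℝ => (f ∘ ofComplex) (x + y * Complex.I) :=
    h.comp_continuous (by fun_prop) fun x => by simpa using hy
  exact continuous_const.mul h2.norm

lemma invNorm_eq_line (z : ℍ) :
    invNorm r f z = z.im ^ (r / 2) * ‖f (ofComplex (z.re + z.im * Complex.I))‖ := by
  have : (z.re : ℂ) + z.im * Complex.I = z := Complex.re_add_im _
  rw [this, ofComplex_apply, invNorm, mul_comm]

/-- Suppose the limit is 0 throughout an open set U. By Baire, on some smaller open set the
invariant norm is at most half its value at z₀ for all heights below a fixed bound. But the Γ-orbit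
of z₀ enters that region near any rational of the open set, and the invariant norm is constant on
the orbit. -/
lemma dense_not_tendsto_half (hf : IsModularForm Γ r μ f) (hΓ : Γ.FiniteIndex) (hf0 : f ≠ 0) :
    Dense {x : ℝ | ¬ Tendsto (fun y : ℝ => y ^ (r / 2) * ‖f (ofComplex (x + y * Complex.I))‖)
      (𝓝[>] 0) (𝓝 0)} := by
  obtain ⟨z₀, hz₀⟩ := Function.ne_iff.mp hf0
  have hG0 : 0 < invNorm r f z₀ :=
    mul_pos (norm_pos_iff.mpr (by simpa using hz₀)) (Real.rpow_pos_of_pos z₀.im_pos _)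
  set ε := invNorm r f z₀ / 2 with hε
  set F : ℝ → ℝ → ℝ := fun x y => y ^ (r / 2) * ‖f (ofComplex (x + y * Complex.I))‖ with hF
  set E : ℕ → Set ℝ := fun n => {x | ∀ y : ℝ, 0 < y → y < 1 / ((n : ℝ) + 1) → F x y ≤ ε} with hE
  have hEc : ∀ n, IsClosed (E n) := by
    intro n
    have : E n = ⋂ (y : ℝ) (_ : 0 < y) (_ : y < 1 / ((n : ℝ) + 1)), {x | F x y ≤ ε} := by
      ext x
      simp [hE]
    rw [this]
    exact isClosed_iInter fun y => isClosed_iInter fun hy => isClosed_iInter fun _ =>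
      isClosed_le (hf.continuous_norm_line hy) continuous_const
  rw [dense_iff_inter_open]
  intro U hU hUne
  by_contra hcon
  have hlim : ∀ x ∈ U, Tendsto (F x) (𝓝[>] 0) (𝓝 0) := by
    intro x hx
    by_contra hx'
    exact hcon ⟨x, hx, hx'⟩
  -- Adding the closed complement of U makes closed sets that cover the whole line, as the Baire
  -- statement requires.
  have hcover : ⋃ n, (E n ∪ Uᶜ) = Set.univ := by
    refine Set.eq_univ_of_forall fun x => Set.mem_iUnion.mpr ?_
    by_cases hx : x ∈ U
    · have h1 := (hlim x hx).eventually (eventually_le_nhds (half_pos hG0))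
      rw [eventually_nhdsWithin_iff, Metric.eventually_nhds_iff] at h1
      obtain ⟨η, hη, h1⟩ := h1
      obtain ⟨n, hn⟩ := exists_nat_one_div_lt hη
      refine ⟨n, Or.inl fun y hy hyn => h1 ?_ hy⟩
      rw [Real.dist_eq, sub_zero, abs_of_pos hy]
      exact hyn.trans hn
    · exact ⟨0, Or.inr hx⟩
  have hdense := dense_iUnion_interior_of_closed
    (fun n => (hEc n).union hU.isClosed_compl) hcover
  obtain ⟨x, hxU, hx⟩ := hdense.inter_open_nonempty U hU hUne
  obtain ⟨n, hxn⟩ := Set.mem_iUnion.mp hx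
  obtain ⟨δ, hδ, hδV⟩ := exists_SL2_ratio_mem (hU.inter isOpen_interior) ⟨x, hxU, hxn⟩
  obtain ⟨M, hM, hT⟩ := exists_pow_T_conj_mem Γ hΓ
  have ht := tendsto_conj_T_pow_smul hM hδ z₀
  have hre := (Complex.continuous_re.tendsto _).comp ht
  have him := (Complex.continuous_im.tendsto _).comp ht
  have e : ((δ 0 0 : ℂ) / δ 1 0) = (((δ 0 0 : ℝ) / δ 1 0 : ℝ) : ℂ) := by push_cast; rfl
  rw [e, Complex.ofReal_re] at hre
  rw [e, Complex.ofReal_im] at him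
  have h1 := hre.eventually ((hU.inter isOpen_interior).mem_nhds hδV)
  have h2 := him.eventually (eventually_lt_nhds (show (0 : ℝ) < 1 / ((n : ℝ) + 1) by positivity))
  obtain ⟨k, hk1, hk2⟩ := (h1.and h2).exists
  set w := (δ * ModularGroup.T ^ (M * k) * δ⁻¹) • z₀ with hw
  have hwE : w.re ∈ E n := by
    rcases interior_subset hk1.2 with h | h
    · exact h
    · exact absurd hk1.1 h
  have h3 : invNorm r f w ≤ ε := by
    rw [invNorm_eq_line]
    exact hwE w.im w.im_pos hk2
  rw [hw, hf.invNorm_smul (hT δ k)] at h3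
  rw [hε] at h3
  linarith

lemma tendsto_norm_slash (hf : IsModularForm Γ r μ f) (hΓ : Γ.FiniteIndex) (hr : 0 < r)
    (hf0 : f ≠ 0) (γ : SL(2, ℤ)) :
    Tendsto (fun z => ‖slash r f γ z‖) atImInfty
      (𝓝 ‖constTerm (slash r f γ) (width Γ γ)‖) := by
  obtain ⟨C, p, hC, hp, h⟩ := hf.norm_slash_sub_constTerm_le hΓ hr hf0 γ
  refine Tendsto.norm ?_
  rw [tendsto_iff_norm_sub_tendsto_zero]
  have hexp : Tendsto (fun z : ℍ => C * Real.exp (-(p * z.im))) atImInfty (𝓝 0) := by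
    have h1 : Tendsto (fun t : ℝ => C * Real.exp (-(p * t))) atTop (𝓝 0) := by
      have := (Real.tendsto_exp_neg_atTop_nhds_zero.comp (tendsto_id.const_mul_atTop hp)).const_mul C
      simpa using this
    exact h1.comp tendsto_comap
  refine squeeze_zero' (Eventually.of_forall fun _ => norm_nonneg _) ?_ hexp
  exact (atImInfty_mem _).mpr ⟨1 / 2, h⟩

/-- With c the lower left entry of σ = gγ, the map σ⁻¹ sends the point at height y above σ(∞) to
height 1/(c²y), which tends to infinity. There the slashed form approaches its constant term, and
the invariant norm carries the limit back to f. -/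
lemma tendsto_at_cusp (hf : IsModularForm Γ r μ f) (hΓ : Γ.FiniteIndex) (hr : 0 < r)
    (hf0 : f ≠ 0) {g γ : SL(2, ℤ)} (hg : g ∈ Γ) (hq : (g * γ) 1 0 ≠ 0) :
    Tendsto (fun y : ℝ => y ^ r * ‖f (ofComplex ((((g * γ) 0 0 : ℝ) / (g * γ) 1 0 : ℝ) +
      y * Complex.I))‖) (𝓝[>] 0)
      (𝓝 (‖constTerm (slash r f γ) (width Γ γ)‖ * (1 / ((g * γ) 1 0 : ℝ) ^ 2) ^ (r / 2))) := by
  set σ := g * γ with hσ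
  have hqR : (σ 1 0 : ℝ) ≠ 0 := by exact_mod_cast hq
  set x : ℝ := (σ 0 0 : ℝ) / σ 1 0 with hx
  set w : ℝ → ℍ := fun y => σ⁻¹ • ofComplex (x + y * Complex.I) with hw
  have hz : ∀ {y : ℝ}, 0 < y → (ofComplex (x + y * Complex.I)).im = y := by
    intro y hy
    have : 0 < ((x : ℂ) + y * Complex.I).im := by simpa using hy
    rw [ofComplex_apply_of_im_pos this]
    simp [UpperHalfPlane.im]
  have hzc : ∀ {y : ℝ}, 0 < y → ((ofComplex (x + y * Complex.I) : ℍ) : ℂ) = x + y * Complex.I := by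
    intro y hy
    have : 0 < ((x : ℂ) + y * Complex.I).im := by simpa using hy
    rw [ofComplex_apply_of_im_pos this]
  have hwim : ∀ {y : ℝ}, 0 < y → (w y).im = 1 / ((σ 1 0 : ℝ) ^ 2 * y) := by
    intro y hy
    simp only [hw]
    have e : autFactor σ⁻¹ (ofComplex (x + y * Complex.I)) =
        ((-(σ 1 0 * y) : ℝ) : ℂ) * Complex.I := by
      rw [autFactor, hzc hy]
      have h10 : σ⁻¹ 1 0 = -σ 1 0 := by
        simp [Matrix.SpecialLinearGroup.coe_inv, Matrix.adjugate_fin_two]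
      have h11 : σ⁻¹ 1 1 = σ 0 0 := by
        simp [Matrix.SpecialLinearGroup.coe_inv, Matrix.adjugate_fin_two]
      have hqC : (σ 1 0 : ℂ) ≠ 0 := by exact_mod_cast hq
      rw [h10, h11, hx]
      push_cast
      field_simp
      ring
    rw [im_smul_eq, hz hy, e, norm_mul, Complex.norm_I, mul_one, Complex.norm_real,
      Real.norm_eq_abs, sq_abs]
    field_simp
  have hwinf : Tendsto w (𝓝[>] 0) atImInfty := by
    rw [atImInfty, tendsto_comap_iff]
    have h1 : Tendsto (fun y : ℝ => (1 / (σ 1 0 : ℝ) ^ 2) * y⁻¹) (𝓝[>] 0) atTop :=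
      tendsto_inv_nhdsGT_zero.const_mul_atTop (by positivity)
    refine h1.congr' ?_
    filter_upwards [self_mem_nhdsWithin] with y hy
    have hy : 0 < y := hy
    simp only [Function.comp]
    rw [hwim hy]
    field_simp
  have hmain := ((hf.tendsto_norm_slash hΓ hr hf0 γ).comp hwinf).mul_const
    ((1 / (σ 1 0 : ℝ) ^ 2) ^ (r / 2))
  refine hmain.congr' ?_
  filter_upwards [self_mem_nhdsWithin] with y hy
  have hy : 0 < y := hy
  have h1 := norm_slash_mul_im_rpow r f σ (w y)
  have h2 : σ • w y = ofComplex (x + y * Complex.I) := by simp only [hw, smul_inv_smul]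
  rw [h2, invNorm, hz hy, hσ, hf.norm_slash_mul_left hg, hwim hy] at h1
  simp only [Function.comp]
  have h3 : (1 / (σ 1 0 : ℝ) ^ 2) ^ (r / 2) = (1 / ((σ 1 0 : ℝ) ^ 2 * y)) ^ (r / 2) * y ^ (r / 2) := by
    rw [← Real.mul_rpow (by positivity) hy.le]
    congr 1
    field_simp
  have h4 : y ^ r = y ^ (r / 2) * y ^ (r / 2) := by
    rw [← Real.rpow_add hy, add_halves]
  rw [h3, ← mul_assoc, h1, h4]
  ring

theorem dense_not_tendsto (hf : IsModularForm Γ r μ f) (hΓ : Γ.FiniteIndex) (hr : 0 < r)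
    (hf0 : f ≠ 0) :
    Dense {x : ℝ | ¬ Tendsto
      (fun y : ℝ => y ^ alphaZero Γ r f * ‖f (ofComplex (x + y * Complex.I))‖)
      (𝓝[>] 0) (𝓝 0)} := by
  by_cases hcusp : IsCuspForm Γ r f
  · rw [alphaZero, if_pos hcusp]
    exact hf.dense_not_tendsto_half hΓ hf0
  · rw [alphaZero, if_neg hcusp]
    obtain ⟨γ, hγ⟩ := not_forall.mp hcusp
    rw [hf.isCuspidalAt_iff hΓ hf0] at hγ
    obtain ⟨M, hM, hT⟩ := exists_pow_T_conj_mem Γ hΓ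
    rw [dense_iff_inter_open]
    intro U hU hUne
    obtain ⟨δ, hδ, hδU⟩ := exists_SL2_ratio_mem hU hUne
    obtain ⟨ht, hne⟩ := tendsto_conj_T_pow_mul hM hδ γ
    have hre := (Complex.continuous_re.tendsto _).comp ht
    have e : ∀ a b : ℤ, ((a : ℂ) / b).re = (a : ℝ) / b := by
      intro a b
      have : ((a : ℂ) / b) = (((a : ℝ) / b : ℝ) : ℂ) := by push_cast; rfl
      rw [this, Complex.ofReal_re]
    simp only [Function.comp_def, e] at hre
    obtain ⟨k, hk1, hk2⟩ := ((hre.eventually (hU.mem_nhds hδU)).and hne).exists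
    refine ⟨_, hk1, fun hlim => ?_⟩
    have huniq := tendsto_nhds_unique hlim (hf.tendsto_at_cusp hΓ hr hf0 (hT δ k) hk2)
    have hq : ((δ * ModularGroup.T ^ (M * k) * δ⁻¹ * γ) 1 0 : ℝ) ≠ 0 := by exact_mod_cast hk2
    have h1 := norm_pos_iff.mpr hγ
    have : 0 < ‖constTerm (slash r f γ) (width Γ γ)‖ *
        (1 / ((δ * ModularGroup.T ^ (M * k) * δ⁻¹ * γ) 1 0 : ℝ) ^ 2) ^ (r / 2) := by
      have : 0 < 1 / ((δ * ModularGroup.T ^ (M * k) * δ⁻¹ * γ) 1 0 : ℝ) ^ 2 := by positivity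
      exact mul_pos h1 (Real.rpow_pos_of_pos this _)
    linarith

end IsModularForm

end FracInt


namespace FracInt

/-! ### The fractional integral of a modular form -/

lemma fracSum_eq (Γ : Subgroup SL(2, ℤ)) (f : ℍ → ℂ) (α : ℝ) :
    fracSum Γ f α =
      fracPartial (width Γ 1) (cuspParam f (width Γ 1)) α (posCoeff f (width Γ 1)) := by
  ext N x
  rw [fracSum, fracPartial]
  refine Finset.sum_congr rfl fun n _ => ?_
  simp only [fracTerm, posCoeff]
  split_ifs with h
  · rw [expMode]
    simp
  · simp

lemma MemCk.differentiableAt {E : Type*} [NormedAddCommGroup E] [NormedSpace ℝ E] {s : ℝ}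
    {g : ℝ → E} {Ω : Set ℝ} (h : MemCk 1 s g Ω) {x : ℝ} (hx : x ∈ Ω) : DifferentiableAt ℝ g x := by
  have := h.2.1 0 one_pos x hx
  rwa [iteratedDeriv_zero] at this

namespace IsModularForm

variable {Γ : Subgroup SL(2, ℤ)} {r : ℝ} {μ : Γ → Circle} {f : ℍ → ℂ}

lemma fracInt_eq (hf : IsModularForm Γ r μ f) (hΓ : Γ.FiniteIndex) (hr : 0 < r)
    (hf0 : f ≠ 0) {α : ℝ} (hα : alphaZero Γ r f < α) :
    fracInt Γ f α =
      fracLimit (width Γ 1) α (fun z => f (ofComplex z) - constTerm f (width Γ 1)) := by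
  ext x
  rw [fracInt, fracSum_eq]
  exact (((hf.isFourierExpansion hΓ hr hf0).tendstoUniformly_fracPartial hα).tendsto_at x).limUnder_eq

/-- For y < 1 raising the exponent decreases the power, and the constant b contributes only y^β ‖b‖.
This transfers decay from H to f. -/
lemma tendsto_rpow_mul_norm {b : ℂ} {x β : ℝ} (hβ : 0 < β) (hβα : β ≤ alphaZero Γ r f)
    (h : Tendsto (fun y : ℝ => y ^ β * ‖f (ofComplex (x + y * Complex.I)) - b‖) (𝓝[>] 0) (𝓝 0)) :
    Tendsto (fun y : ℝ => y ^ alphaZero Γ r f * ‖f (ofComplex (x + y * Complex.I))‖)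
      (𝓝[>] 0) (𝓝 0) := by
  have hconst : Tendsto (fun y : ℝ => y ^ β * ‖b‖) (𝓝[>] 0) (𝓝 0) := by
    have h1 := ((Real.continuousAt_rpow_const 0 β (Or.inr hβ.le)).tendsto.mono_left
      (nhdsWithin_le_nhds (s := Set.Ioi 0))).mul_const ‖b‖
    rwa [Real.zero_rpow hβ.ne', zero_mul] at h1
  have hsum := h.add hconst
  rw [add_zero] at hsum
  refine squeeze_zero' ?_ ?_ hsum
  · filter_upwards [self_mem_nhdsWithin] with y hy
    have hy : 0 < y := hy
    positivity
  · filter_upwards [Ioo_mem_nhdsGT (zero_lt_one' ℝ)] with y hy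
    rw [← mul_add]
    exact mul_le_mul (Real.rpow_le_rpow_of_exponent_ge hy.1 hy.2.le hβα)
      (norm_le_norm_sub_add _ _) (norm_nonneg _) (Real.rpow_nonneg hy.1.le _)

lemma dense_not_exists_tendsto_fracSum (hf : IsModularForm Γ r μ f) (hΓ : Γ.FiniteIndex)
    (hr : 0 < r) (hf0 : f ≠ 0) {α : ℝ} (hα : 0 < α) (hle : α ≤ alphaZero Γ r f) :
    Dense {x : ℝ | ¬ ∃ l : ℂ, Tendsto (fun N : ℕ => fracSum Γ f α N x) atTop (𝓝 l)} := by
  refine (hf.dense_not_tendsto hΓ hr hf0).mono fun x hx => ?_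
  rintro ⟨l, hl⟩
  rw [fracSum_eq] at hl
  exact hx (tendsto_rpow_mul_norm hα hle
    ((hf.isFourierExpansion hΓ hr hf0).tendsto_of_tendsto_fracPartial hα hl))

lemma exists_mem_not_differentiableAt (hf : IsModularForm Γ r μ f) (hΓ : Γ.FiniteIndex)
    (hr : 0 < r) (hf0 : f ≠ 0) {α : ℝ} (hα : alphaZero Γ r f < α) (hα1 : α ≤ alphaZero Γ r f + 1)
    {I : Set ℝ} (hI : IsOpen I) (hne : I.Nonempty) :
    ∃ x ∈ I, ∀ p q : ℂ, p ≠ 0 → ¬ DifferentiableAt ℝ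
      (fun u => p * fracInt Γ f α u + q * (starRingEnd ℂ) (fracInt Γ f α u)) x := by
  obtain ⟨x, hxI, hx⟩ := (hf.dense_not_tendsto hΓ hr hf0).inter_open_nonempty I hI hne
  refine ⟨x, hxI, fun p q hp hd => hx ?_⟩
  rw [hf.fracInt_eq hΓ hr hf0 hα] at hd
  exact tendsto_rpow_mul_norm (alphaZero_pos Γ f hr) le_rfl
    ((hf.isFourierExpansion hΓ hr hf0).tendsto_of_differentiableAt hα hα1 hp hd)

end IsModularForm

end FracInt

theorem theorem2p1 (Γ : Subgroup SL(2, ℤ)) (hΓ : Γ.FiniteIndex) (r : ℝ) (hr : 0 < r)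
    (μ : Γ → Circle) (f : ℍ → ℂ) (hf : FracInt.IsModularForm Γ r μ f) (hf0 : f ≠ 0)
    (hκ : ∀ γ : SL(2, ℤ), ∃ q : ℚ,
      FracInt.cuspParam (FracInt.slash r f γ) (FracInt.width Γ γ) = (q : ℝ))
    (α : ℝ) (hα : 0 < α) :
    -- divergence on a dense set
    (α ≤ FracInt.alphaZero Γ r f →
      Dense {x : ℝ | ¬ ∃ l : ℂ, Tendsto (fun N : ℕ => FracInt.fracSum Γ f α N x) atTop (𝓝 l)}) ∧
    -- uniform convergence and global regularity
    (FracInt.alphaZero Γ r f < α →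
      TendstoUniformly (FracInt.fracSum Γ f α) (FracInt.fracInt Γ f α) atTop ∧
      Continuous (FracInt.fracInt Γ f α) ∧
      ((∀ j : ℤ, α - FracInt.alphaZero Γ r f ≠ j) →
        FracInt.MemCk ⌊α - FracInt.alphaZero Γ r f⌋₊ (Int.fract (α - FracInt.alphaZero Γ r f))
          (FracInt.fracInt Γ f α) Set.univ) ∧
      (∀ k : ℕ, α - FracInt.alphaZero Γ r f = (k : ℝ) + 1 →
        FracInt.MemCkLog k 1 (FracInt.fracInt Γ f α) Set.univ)) ∧
    -- failure of continuous differentiability on every open interval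
    (0 < α - FracInt.alphaZero Γ r f → α - FracInt.alphaZero Γ r f ≤ 1 →
      ∀ I : Set ℝ, IsOpen I → I.OrdConnected → I.Nonempty →
        ¬ FracInt.MemCk 1 0 (FracInt.fracInt Γ f α) I ∧
        ¬ FracInt.MemCk 1 0 (fun x => (FracInt.fracInt Γ f α x).re) I ∧
        ¬ FracInt.MemCk 1 0 (fun x => (FracInt.fracInt Γ f α x).im) I) := by
  have h := hf.isFourierExpansion hΓ hr hf0
  refine ⟨hf.dense_not_exists_tendsto_fracSum hΓ hr hf0 hα, fun hα0 => ?_,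
    fun hpos hle I hI _ hne => ?_⟩
  · rw [hf.fracInt_eq hΓ hr hf0 hα0, FracInt.fracSum_eq]
    exact ⟨h.tendstoUniformly_fracPartial hα0, h.continuous_fracLimit hα0,
      h.memCk_fracLimit hα0, fun k => h.memCkLog_fracLimit⟩
  · obtain ⟨x, hxI, hx⟩ := hf.exists_mem_not_differentiableAt hΓ hr hf0 (sub_pos.mp hpos)
      (by linarith) hI hne
    -- The pairs (p, q) express the function, its real part (1/2, 1/2) and its imaginary part
    -- (1/(2i), -1/(2i)) as pF + q times the conjugate of F. Differentiability at the single point x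
    -- is already contradictory.
    refine ⟨fun hC => hx 1 0 one_ne_zero ?_, fun hC => hx (1 / 2) (1 / 2) (by norm_num) ?_,
      fun hC => hx (1 / (2 * Complex.I)) (-(1 / (2 * Complex.I)))
        (one_div_ne_zero (mul_ne_zero two_ne_zero Complex.I_ne_zero)) ?_⟩
    · simpa using hC.differentiableAt hxI
    · refine (Complex.ofRealCLM.differentiableAt.comp x (hC.differentiableAt hxI)).congr_of_eventuallyEq
        (Eventually.of_forall fun u => ?_)
      simp only [Function.comp, Complex.ofRealCLM_apply, Complex.re_eq_add_conj]
      ring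
    · refine (Complex.ofRealCLM.differentiableAt.comp x (hC.differentiableAt hxI)).congr_of_eventuallyEq
        (Eventually.of_forall fun u => ?_)
      simp only [Function.comp, Complex.ofRealCLM_apply, Complex.im_eq_sub_conj]
      ring
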